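/- **Corollary 3 (Performance comparison).** *Algorithm.* $N$ agents have individual costs $J_k:\mathbb R^M\to\mathbb R$ with a common minimizer $w^o$, twice differentiable with $0<\nu_d I_M\le\nabla^2J_k(w)\le\delta_d I_M$ for all $w$. Let $A_1=[a_{1,\ell k}],A_2=[a_{2,\ell k}]$ be $N\times N$ left-stochastic matrices (nonnegative entries, columns summing to one) with $P=A_1A_2$ primitive, and let $p$ be the vector with $Pp=p$, $\mathbb 1^{\sf T}p=1$. The step-sizes are $\mu_k=\mu_{\max}\tau_k$ with fixed $\tau_k\in(0,1]$, $\max_k\tau_k=1$. From random initial conditions $w_{k,-1}$ with finite fourth-order moments the agents run, for $i\ge0$, $$\phi_{k,i-1}=\sum_\ell a_{1,\ell k}w_{\ell,i-1},\qquad \psi_{k,i}=\phi_{k,i-1}-\mu_k\Gamma_{k,i}\,\widehat{\nabla J}_{k,i}(\phi_{k,i-1}),\qquad w_{k,i}=\sum_\ell a_{2,\ell k}\psi_{\ell,i}.$$ In the *coordinate-descent* case (subscript "coor") $\Gamma_{k,i}=\mathrm{diag}\{r_{k,i}(1),\dots,r_{k,i}(M)\}$, where the $r_{k,i}(m)$ are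 $0$ or $1$ with $\mathrm{Prob}(r_{k,i}(m)=0)=r_k$, $0\le r_k<1$; in the *full-gradient* case (subscript "grad") $\Gamma_{k,i}=I_M$. *Uniform costs.* There are a loss $Q(w;x)$, differentiable in $w$, and identically distributed data $x_{k,i}$ such that $J_k(w)=J(w)=\mathbb E\,Q(w;x_{k,i})$ and $\widehat{\nabla J}_{k,i}(w)=\nabla_wQ(w;x_{k,i})$ for all $k$ and $i$. Put $G=\mathbb E\big[\nabla_wQ(w^o;x_{k,i})\nabla_wQ(w^o;x_{k,i})^{\sf T}\big]$. *Assumptions.* Let $\mathcal F_{i-1}$ be the $\sigma$-algebra generated by all $w_{k,j},\Gamma_{k,j}$ with $j\le i-1$ (it depends on the case and on $\mu_{\max}$), call *iterate* any $\mathcal F_{i-1}$-measurable random vector $w$ with finite fourth-order moment, let $s_{k,i}(w)=\widehat{\nabla J}_{k,i}(w)-\nabla J_k(w)$ and $R_{s,k,i}(w)=\mathbb E[s_{k,i}(w)s_{k,i}(w)^{\sf T}\,|\,\mathcal F_{i-1}]$. For each of the two cases the following holds for all small enough $\mu_{\max}>0$, all $i\geq 0$ and all agents, with constants that do not depend on $\mu_{\max}$.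 1. The variables $\{r_{k,i}(m)\}_{k,m}$ are mutually independent and, jointly, independent of $\mathcal F_{i-1}$ together with the vectors $\widehat{\nabla J}_{\ell,i}(w_\ell)$, $\ell=1,\dots,N$, for any iterates $w_1,\dots,w_N$. 2. For all iterates $w,w'$ the vector $s_{k,i}(w)$ has finite fourth-order moment and, almost surely, $\mathbb E[s_{k,i}(w)|\mathcal F_{i-1}]=0$, $\mathbb E[s_{k,i}(w)s_{\ell,i}(w')^{\sf T}|\mathcal F_{i-1}]=0$ for $k\ne\ell$, and $\mathbb E[\|s_{k,i}(w)\|^4|\mathcal F_{i-1}]\le\beta_k^4\|w\|^4+\sigma_{s,k}^4$. 3. For some $\varepsilon>0$, $\kappa_c,\kappa_d\ge0$, $0<\gamma\le4$: $\|\nabla^2J_k(w^o+h)-\nabla^2J_k(w^o)\|\le\kappa_c\|h\|$ for $\|h\|\le\varepsilon$, and $\|R_{s,k,i}(w^o+h)-R_{s,k,i}(w^o)\|\le\kappa_d\|h\|^\gamma$ almost surely for every $\mathcal F_{i-1}$-measurable $h$ with $\|h\|\le\varepsilon$. 4. $\lim_{i\to\infty}R_{s,k,i}(w^o)$ exists almost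 surely and is a constant matrix (which does not depend on $\mu_{\max}$). *Performance measures.* Let $q=\mathrm{diag}\{\mu_1,\dots,\mu_N\}A_2p$ with entries $q_k$, and $\bar J(w)=(\sum_kq_k)^{-1}\sum_kq_kJ_k(w)$. For each case and each agent $k$ let $$\mathrm{MSD}_k=\mu_{\max}\lim_{\mu_{\max}\to0}\limsup_{i\to\infty}\frac1{\mu_{\max}}\mathbb E\|w^o-w_{k,i}\|^2,\qquad \mathrm{ER}_k=\mu_{\max}\lim_{\mu_{\max}\to0}\limsup_{i\to\infty}\frac1{\mu_{\max}}\mathbb E\{\bar J(w_{k,i})-\bar J(w^o)\}.$$ Let $$\alpha=\frac{\sum_kq_k^2(1-r_k)^2}{\sum_kq_k(1-r_k)}-\frac{\sum_kq_k^2}{\sum_kq_k},\qquad \theta=\frac{\sum_kq_k^2(1-r_k)}{\sum_kq_k(1-r_k)}-\frac{\sum_kq_k^2}{\sum_kq_k}.$$ *Conclusion.* For every agent $k$ the limits that define $\mathrm{MSD}_{\mathrm{coor},k}$, $\mathrm{MSD}_{\mathrm{grad},k}$, $\mathrm{ER}_{\mathrm{coor},k}$, $\mathrm{ER}_{\mathrm{grad},k}$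 exist and are finite, and for every $\mu_{\max}>0$: a) if $\alpha\ge0$, then $0\le\mathrm{MSD}_{\mathrm{coor},k}-\mathrm{MSD}_{\mathrm{grad},k}\le\frac12\frac{\theta}{\nu_d}\mathrm{Tr}(G)$; b) if $\alpha<0$ and $\theta\ge(1-\delta_d/\nu_d)\alpha$ (which is $\ge0$), then $0\le\mathrm{MSD}_{\mathrm{coor},k}-\mathrm{MSD}_{\mathrm{grad},k}\le\frac12\left(\frac{\theta}{\nu_d}+\left(\frac1{\delta_d}-\frac1{\nu_d}\right)\alpha\right)\mathrm{Tr}(G)$; c) if $\alpha<0$ and $\theta\le(1-\nu_d/\delta_d)\alpha$ (which is $\le0$), then $\frac12\left(\frac{\theta}{\delta_d}+\left(\frac1{\nu_d}-\frac1{\delta_d}\right)\alpha\right)\mathrm{Tr}(G)\le\mathrm{MSD}_{\mathrm{coor},k}-\mathrm{MSD}_{\mathrm{grad},k}\le0$. Moreover $\mathrm{ER}_{\mathrm{coor},k}-\mathrm{ER}_{\mathrm{grad},k}=\frac\theta4\mathrm{Tr}(G)$; in particular, if all $r_k$ are equal or all $q_k$ are equal, then $\mathrm{ER}_{\mathrm{coor},k}=\mathrm{ER}_{\mathrm{grad},k}$.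 -/

import Mathlib

open MeasureTheory ProbabilityTheory Filter Topology Matrix
open scoped NNReal ENNReal

noncomputable section

namespace Diffusion

/-- Weight vectors: `ℝ^M` with the Euclidean norm. -/
abbrev Vec (M : ℕ) := EuclideanSpace ℝ (Fin M)

/-- The Hessian matrix of `J` at `w`, i.e. the Jacobian matrix of the gradient of `J`. -/
def hessian {M : ℕ} (J : Vec M → ℝ) (w : Vec M) : Matrix (Fin M) (Fin M) ℝ :=
  Matrix.of fun m n => (fderiv ℝ (gradient J) w (EuclideanSpace.single n 1)) m

/-- The two-induced norm of a square matrix. -/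
def matNorm {M : ℕ} (B : Matrix (Fin M) (Fin M) ℝ) : ℝ :=
  ‖Matrix.toEuclideanCLM (n := Fin M) (𝕜 := ℝ) B‖

/-- A combination step: agent `k` forms `∑ ℓ, a_{ℓ k} v_ℓ`. -/
def combine {N M : ℕ} (A : Matrix (Fin N) (Fin N) ℝ) (v : Fin N → Vec M) : Fin N → Vec M :=
  fun k => ∑ l, A l k • v l

/-- Multiplication of a vector by the diagonal matrix with diagonal `c`. -/
def mask {M : ℕ} (c : Fin M → ℝ) (v : Vec M) : Vec M :=
  WithLp.toLp 2 fun m => c m * v m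

/-- The data of a diffusion strategy with partial gradients, for `N` agents and weight vectors of
size `M`. The step-sizes are `μ_k = μ * τ k`, where `μ` is the largest one; `μ` is not part of the
data, since it is varied. Iterates are indexed from time `0`, the initial condition. -/
structure Model (N M : ℕ) (Ω : Type*) where
  /-- first combination matrix, entry `(ℓ, k)` is the weight that `k` gives to `ℓ` -/
  A₁ : Matrix (Fin N) (Fin N) ℝ
  /-- second combination matrix -/
  A₂ : Matrix (Fin N) (Fin N) ℝ
  /-- Perron vector of `A₁ * A₂` -/
  p : Fin N → ℝ
  /-- relative step-sizes -/
  τ : Fin N → ℝ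
  /-- individual costs -/
  J : Fin N → Vec M → ℝ
  /-- common minimizer -/
  wo : Vec M
  /-- `gradHat i k w` is the complete approximate gradient vector of agent `k` at time `i`,
  evaluated at `w` -/
  gradHat : ℕ → Fin N → Vec M → Ω → Vec M
  /-- missing probabilities -/
  r : Fin N → ℝ
  /-- `ind i k m` is the Bernoulli variable which tells whether entry `m` of the approximate
  gradient is available to agent `k` at time `i` -/
  ind : ℕ → Fin N → Fin M → Ω → ℝ
  /-- initial conditions -/
  w₀ : Fin N → Ω → Vec M

namespace Model

variable {N M : ℕ} {Ω : Type*}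

/-- The stochastic full-gradient diffusion strategy with the same data: no entry is missing. -/
def fullGradient (D : Model N M Ω) : Model N M Ω :=
  { D with r := fun _ => 0, ind := fun _ _ _ _ => 1 }

/-- The iterates `w_{k,i}` of the diffusion strategy (combine, adapt, combine) with largest
step-size `μ`. -/
def iterate (D : Model N M Ω) (μ : ℝ) : ℕ → Fin N → Ω → Vec M
  | 0 => D.w₀
  | i + 1 => fun k ω =>
      let φ : Fin N → Vec M := combine D.A₁ fun l => D.iterate μ i l ω
      let ψ : Fin N → Vec M := fun l =>
        φ l - (μ * D.τ l) • mask (fun m => D.ind i l m ω) (D.gradHat i l (φ l) ω)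
      combine D.A₂ ψ k

/-- The events generated by all iterates up to the `i`-th one and by all the indicator variables
that were used to produce them. -/
@[reducible] def past (D : Model N M Ω) (μ : ℝ) (i : ℕ) : MeasurableSpace Ω :=
  (⨆ k : Fin N, ⨆ j : ℕ, ⨆ _ : j ≤ i,
      MeasurableSpace.comap (D.iterate μ j k) inferInstance) ⊔
  (⨆ k : Fin N, ⨆ m : Fin M, ⨆ j : ℕ, ⨆ _ : j < i,
      MeasurableSpace.comap (D.ind j k m) inferInstance)

/-- The gradient noise `s_{k,i}(w)` at a random vector `w`. -/
def noise (D : Model N M Ω) (i : ℕ) (k : Fin N) (w : Ω → Vec M) (ω : Ω) : Vec M :=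
  D.gradHat i k (w ω) ω - gradient (D.J k) (w ω)

/-- The conditional second-order moment `R_{s,k,i}(w)` of the gradient noise. -/
def noiseCov [MeasurableSpace Ω] (D : Model N M Ω) (P : Measure Ω) (μ : ℝ) (i : ℕ) (k : Fin N)
    (w : Ω → Vec M) (ω : Ω) : Matrix (Fin M) (Fin M) ℝ :=
  Matrix.of fun m n =>
    (P[fun ω' => D.noise i k w ω' m * D.noise i k w ω' n | D.past μ i]) ω

/-- The random vectors that play the role of iterates at time `i`: they are determined by the
past and have a finite fourth-order moment. -/
def IsIterate [MeasurableSpace Ω] (D : Model N M Ω) (P : Measure Ω) (μ : ℝ) (i : ℕ)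
    (w : Ω → Vec M) : Prop :=
  Measurable[D.past μ i] w ∧ MemLp w 4 P

/-- Conditions on combination matrices, Perron vector, step-sizes and missing probabilities. -/
structure NetworkConditions (D : Model N M Ω) : Prop where
  stochastic₁ : D.A₁ ∈ Matrix.colStochastic ℝ (Fin N)
  stochastic₂ : D.A₂ ∈ Matrix.colStochastic ℝ (Fin N)
  primitive : (D.A₁ * D.A₂).IsPrimitive
  perron : (D.A₁ * D.A₂) *ᵥ D.p = D.p
  perron_sum : ∑ k, D.p k = 1
  step_pos : ∀ k, 0 < D.τ k
  step_le : ∀ k, D.τ k ≤ 1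
  step_max : ∃ k, D.τ k = 1
  missing_nonneg : ∀ k, 0 ≤ D.r k
  missing_lt : ∀ k, D.r k < 1

/-- Conditions on the individual costs: common minimizer, twice differentiable with
`0 < ν I ≤ ∇² J_k ≤ δ I`, and Hessian locally Lipschitz around the minimizer. -/
structure CostConditions (D : Model N M Ω) (ν δ : ℝ) : Prop where
  ν_pos : 0 < ν
  ν_le_δ : ν ≤ δ
  minimizer : ∀ k w, D.J k D.wo ≤ D.J k w
  differentiable : ∀ k, Differentiable ℝ (D.J k)
  twice_differentiable : ∀ k, Differentiable ℝ (gradient (D.J k))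
  hessian_lower : ∀ k w, (hessian (D.J k) w - ν • (1 : Matrix (Fin M) (Fin M) ℝ)).PosSemidef
  hessian_upper : ∀ k w, (δ • (1 : Matrix (Fin M) (Fin M) ℝ) - hessian (D.J k) w).PosSemidef
  hessian_lipschitz : ∃ κ : ℝ, 0 ≤ κ ∧ ∃ ε : ℝ, 0 < ε ∧ ∀ k (h : Vec M), ‖h‖ ≤ ε →
    matNorm (hessian (D.J k) (D.wo + h) - hessian (D.J k) D.wo) ≤ κ * ‖h‖

/-- Conditions on the indicator variables, for step-size `μ`. -/
structure IndicatorConditions [MeasurableSpace Ω] (D : Model N M Ω) (P : Measure Ω) (μ : ℝ) :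
    Prop where
  zero_or_one : ∀ i k m ω, D.ind i k m ω = 0 ∨ D.ind i k m ω = 1
  prob_zero : ∀ i k m, P {ω | D.ind i k m ω = 0} = ENNReal.ofReal (D.r k)
  indep : ∀ i, iIndepFun (fun a : Fin N × Fin M => D.ind i a.1 a.2) P
  indep_past : ∀ i (w : Fin N → Ω → Vec M), (∀ k, D.IsIterate P μ i (w k)) →
    Indep (⨆ k : Fin N, ⨆ m : Fin M, MeasurableSpace.comap (D.ind i k m) inferInstance)
      (D.past μ i ⊔ ⨆ k : Fin N,
        MeasurableSpace.comap (fun ω => D.gradHat i k (w k ω) ω) inferInstance) P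

/-- Conditions on the gradient noise, for step-size `μ` and given constants. -/
structure NoiseConditions [MeasurableSpace Ω] (D : Model N M Ω) (P : Measure Ω)
    (β σ : Fin N → ℝ) (κ γ ε : ℝ) (G : Fin N → Matrix (Fin M) (Fin M) ℝ) (μ : ℝ) : Prop where
  memLp : ∀ i k w, D.IsIterate P μ i w → MemLp (D.noise i k w) 4 P
  mean_zero : ∀ i k w, D.IsIterate P μ i w → P[D.noise i k w | D.past μ i] =ᵐ[P] 0
  uncorrelated : ∀ i k l, k ≠ l → ∀ w w', D.IsIterate P μ i w → D.IsIterate P μ i w' →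
    ∀ m n, P[fun ω => D.noise i k w ω m * D.noise i l w' ω n | D.past μ i] =ᵐ[P] 0
  fourth_moment : ∀ i k w, D.IsIterate P μ i w → ∀ᵐ ω ∂P,
    (P[fun ω' => ‖D.noise i k w ω'‖ ^ 4 | D.past μ i]) ω ≤ β k ^ 4 * ‖w ω‖ ^ 4 + σ k ^ 4
  cov_smooth : ∀ i k (h : Ω → Vec M), Measurable[D.past μ i] h → (∀ ω, ‖h ω‖ ≤ ε) →
    ∀ᵐ ω ∂P, matNorm (D.noiseCov P μ i k (fun ω' => D.wo + h ω') ω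
      - D.noiseCov P μ i k (fun _ => D.wo) ω) ≤ κ * ‖h ω‖ ^ γ
  cov_limit : ∀ k, ∀ᵐ ω ∂P,
    Tendsto (fun i => D.noiseCov P μ i k (fun _ => D.wo) ω) atTop (𝓝 (G k))

/-- All conditions on the random quantities: measurability, finite fourth-order moments of the
initial conditions, and, for all small step-sizes and with constants that do not depend on the
step-size, the conditions on indicator variables and gradient noise. -/
structure StochasticConditions [MeasurableSpace Ω] (D : Model N M Ω) (P : Measure Ω) : Prop where
  measurable_init : ∀ k, Measurable (D.w₀ k)
  memLp_init : ∀ k, MemLp (D.w₀ k) 4 P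
  measurable_ind : ∀ i k m, Measurable (D.ind i k m)
  measurable_gradHat : ∀ i k, Measurable fun z : Vec M × Ω => D.gradHat i k z.1 z.2
  indicator : ∀ᶠ μ in 𝓝[>] (0 : ℝ), D.IndicatorConditions P μ
  noise : ∃ (β σ : Fin N → ℝ) (κ γ ε : ℝ) (G : Fin N → Matrix (Fin M) (Fin M) ℝ),
    0 ≤ κ ∧ 0 < γ ∧ γ ≤ 4 ∧ 0 < ε ∧ ∀ᶠ μ in 𝓝[>] (0 : ℝ), D.NoiseConditions P β σ κ γ ε G μ

/-- The vector `q = diag{μ_1, …, μ_N} A₂ p`. -/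
def q (D : Model N M Ω) (μ : ℝ) (k : Fin N) : ℝ :=
  μ * D.τ k * (D.A₂ *ᵥ D.p) k

/-- The normalized aggregate cost. -/
def aggregateCost (D : Model N M Ω) (μ : ℝ) (w : Vec M) : ℝ :=
  (∑ k, D.q μ k)⁻¹ * ∑ k, D.q μ k * D.J k w

/-- `v` is the mean-square-deviation of agent `k` at largest step-size `μ`, namely
`μ * lim_{μ' → 0} limsup_i (1 / μ') E ‖wo - w_{k,i}‖²`, and this limit exists and is finite. -/
def IsMSD [MeasurableSpace Ω] (D : Model N M Ω) (P : Measure Ω) (μ : ℝ) (k : Fin N) (v : ℝ) :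
    Prop :=
  ∃ L : ℝ≥0, v = μ * L ∧
    Tendsto
      (fun μ' : ℝ => limsup (fun i : ℕ =>
        (∫⁻ ω, ‖D.wo - D.iterate μ' i k ω‖ₑ ^ 2 ∂P) / ENNReal.ofReal μ') atTop)
      (𝓝[>] 0) (𝓝 (L : ℝ≥0∞))

/-- `v` is the excess-risk of agent `k` at largest step-size `μ`, namely
`μ * lim_{μ' → 0} limsup_i (1 / μ') E {J(w_{k,i}) - J(wo)}` with `J` the normalized aggregate cost,
and this limit exists and is finite. (The random variable in braces is nonnegative, since `wo`
minimizes every cost.) -/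
def IsER [MeasurableSpace Ω] (D : Model N M Ω) (P : Measure Ω) (μ : ℝ) (k : Fin N) (v : ℝ) :
    Prop :=
  ∃ L : ℝ≥0, v = μ * L ∧
    Tendsto
      (fun μ' : ℝ => limsup (fun i : ℕ =>
        (∫⁻ ω, ENNReal.ofReal (D.aggregateCost μ' (D.iterate μ' i k ω)
          - D.aggregateCost μ' D.wo) ∂P) / ENNReal.ofReal μ') atTop)
      (𝓝[>] 0) (𝓝 (L : ℝ≥0∞))

/-- The number `α`. -/
def alpha (D : Model N M Ω) (μ : ℝ) : ℝ :=
  (∑ k, D.q μ k ^ 2 * (1 - D.r k) ^ 2) / (∑ k, D.q μ k * (1 - D.r k))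
    - (∑ k, D.q μ k ^ 2) / (∑ k, D.q μ k)

/-- The number `θ`. -/
def theta (D : Model N M Ω) (μ : ℝ) : ℝ :=
  (∑ k, D.q μ k ^ 2 * (1 - D.r k)) / (∑ k, D.q μ k * (1 - D.r k))
    - (∑ k, D.q μ k ^ 2) / (∑ k, D.q μ k)

/-- Uniform individual costs: all agents have the cost `J(w) = E Q(w; x)`, where the loss `Q` is
the same for all agents and the data `x_{k,i}` all have the law `law`, and the approximate gradient
of agent `k` at time `i` is the gradient of the loss at the datum `x_{k,i}`. -/
structure UniformCosts [MeasurableSpace Ω] {X : Type*} [MeasurableSpace X] (D : Model N M Ω)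
    (P : Measure Ω) (law : Measure X) (Q : Vec M → X → ℝ) (x : ℕ → Fin N → Ω → X) : Prop where
  measurable_data : ∀ i k, Measurable (x i k)
  data_law : ∀ i k, P.map (x i k) = law
  integrable_loss : ∀ w, Integrable (Q w) law
  cost_eq : ∀ k w, D.J k w = ∫ y, Q w y ∂law
  differentiable_loss : ∀ y, Differentiable ℝ fun w => Q w y
  measurable_grad : Measurable fun z : Vec M × X => gradient (fun w => Q w z.2) z.1
  gradHat_eq : ∀ i k w ω, D.gradHat i k w ω = gradient (fun v => Q v (x i k ω)) w

end Model

/-- The matrix `G = E [∇Q(w; x) ∇Q(w; x)ᵀ]`. -/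
def lossGradCov {M : ℕ} {X : Type*} [MeasurableSpace X] (law : Measure X) (Q : Vec M → X → ℝ)
    (w : Vec M) : Matrix (Fin M) (Fin M) ℝ :=
  Matrix.of fun m n => ∫ y, gradient (fun v => Q v y) w m * gradient (fun v => Q v y) w n ∂law

end Diffusion

end

/-!
All agents follow the centroid `∑ k, p k • w k` of their iterates, where `p` is the Perron vector of
`A₁ * A₂`. Since `A₁ * A₂` is primitive, some power of it is close to the matrix all of whose
columns are `p`; hence a combination round strictly contracts a suitable seminorm of the
disagreement (`exists_disagreementNorm_combine_le`), and the disagreement is kept at the order `μ`.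
With `π k = τ k * (A₂ p) k`, the centroid performs a gradient step of size `μ * m`, where
`m = ∑ k, π k * (1 - r k)`, perturbed by conditionally centred noise of size `μ`. A coupled
recursion for fourth moments (`exists_fourth_moment_bound`) shows that the centroid error is of the
order `√μ`.

At this scale the gradient may be replaced by its linearization at the minimizer, and the covariance
of the gradient noise by its value `G` at the minimizer. In the direction of an eigenvector `e j` of
the Hessian matrix, with eigenvalue `lam j`, the second moment `z` of the centroid error satisfies
`z (i + 1) ≈ (1 - 2 * μ * m * lam j) * z i + μ ^ 2 * Y j`, so that `z i / μ` approaches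
`Y j / (2 * m * lam j)` (`eventually_abs_div_sub_le`). Here `Y j` is the noise variance in direction
`e j`. Since the indicators of an agent are independent of each other and of the noise, masking
multiplies the off-diagonal entries of `G` by `(1 - r k) ^ 2` and the diagonal ones by `1 - r k`
(`Model.noiseVariance_eq`); the fluctuation of the masks acts on true gradients, which are small,
and does not contribute. Summation over `j` gives the mean-square-deviation, and with the weights
`lam j / 2` the excess-risk (`Model.isMSD_isER`).

Both strategies have the same cost, so a single eigenbasis serves for the comparison. The difference
of the mean-square-deviations is `(α * T₁ + (θ - α) * T₂) / 2`, where
`T₁ = ∑ j, ⟪e j, G e j⟫ / lam j` and `T₂` is the same expression for the diagonal part of `G`. Both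
lie between `Tr G / δ` and `Tr G / ν`, and `α ≤ θ`, which gives all bounds (`comparison_bounds`). In
the excess-risk the eigenvalues cancel, and the difference is exactly `θ / 4 * Tr G`.
-/

namespace Diffusion

/-! ### Perron vectors of primitive stochastic matrices -/

section Perron

variable {N : ℕ} {B : Matrix (Fin N) (Fin N) ℝ}

/-- Dobrushin's estimate: a column-stochastic matrix whose entries are at least `ε` contracts the
`ℓ¹` norm of vectors with zero sum. -/
lemma sum_abs_mulVec_le (hB : B ∈ Matrix.colStochastic ℝ (Fin N)) {ε : ℝ}
    (hε : ∀ i j, ε ≤ B i j) {v : Fin N → ℝ} (hv : ∑ j, v j = 0) :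
    ∑ i, |(B *ᵥ v) i| ≤ (1 - N * ε) * ∑ j, |v j| := by
  have h1 : ∀ i, |(B *ᵥ v) i| ≤ ∑ j, (B i j - ε) * |v j| := by
    intro i
    have : (B *ᵥ v) i = ∑ j, (B i j - ε) * v j := by
      simp only [Matrix.mulVec, dotProduct, sub_mul, Finset.sum_sub_distrib, ← Finset.mul_sum, hv]
      simp
    rw [this]
    refine (Finset.abs_sum_le_sum_abs _ _).trans (Finset.sum_le_sum fun j _ => ?_)
    rw [abs_mul, abs_of_nonneg (sub_nonneg.2 (hε i j))]
  refine (Finset.sum_le_sum fun i _ => h1 i).trans (le_of_eq ?_)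
  rw [Finset.sum_comm, Finset.mul_sum]
  refine Finset.sum_congr rfl fun j _ => ?_
  rw [← Finset.sum_mul, Finset.sum_sub_distrib, Matrix.sum_col_of_mem_colStochastic hB]
  simp

/-- The powers of a primitive column-stochastic matrix come arbitrarily close to the matrix all of
whose columns are the Perron vector. -/
lemma exists_pow_close_perron (hB : B ∈ Matrix.colStochastic ℝ (Fin N)) (hprim : B.IsPrimitive)
    {p : Fin N → ℝ} (hp : B *ᵥ p = p) (hsum : ∑ k, p k = 1) {η : ℝ} (hη : 0 < η) :
    ∃ m, 0 < m ∧ ∀ l k, |(B ^ m) l k - p l| ≤ η := by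
  obtain ⟨n, hn, hpos⟩ := hprim.exists_pos_pow
  have hN : 0 < N := by
    rcases Nat.eq_zero_or_pos N with rfl | h
    · simp at hsum
    · exact h
  have : Nonempty (Fin N) := ⟨⟨0, hN⟩⟩
  obtain ⟨ε, hε0, hε⟩ : ∃ ε : ℝ, 0 < ε ∧ ∀ i j, ε ≤ (B ^ n) i j := by
    obtain ⟨a, ha⟩ := Finite.exists_min fun a : Fin N × Fin N => (B ^ n) a.1 a.2
    exact ⟨_, hpos a.1 a.2, fun i j => ha (i, j)⟩
  have hBn : B ^ n ∈ Matrix.colStochastic ℝ (Fin N) := pow_mem hB n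
  have hε1 : 0 ≤ 1 - N * ε := by
    have := Matrix.sum_col_of_mem_colStochastic hBn ⟨0, hN⟩
    have h2 : ∑ _i : Fin N, ε ≤ ∑ i, (B ^ n) i ⟨0, hN⟩ := Finset.sum_le_sum fun i _ => hε i _
    simp at h2
    linarith
  have hlt : 1 - N * ε < 1 := by
    have : (0 : ℝ) < N := by exact_mod_cast hN
    have := mul_pos this hε0
    linarith
  have hpn : ∀ m, (B ^ m) *ᵥ p = p := by
    intro m
    induction m with
    | zero => simp
    | succ m ih => rw [pow_succ, ← Matrix.mulVec_mulVec, hp, ih]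
  have key : ∀ (t : ℕ) (k : Fin N), ∑ l, |((B ^ n) ^ t) l k - p l| ≤
      (1 - N * ε) ^ t * ∑ l, |(Pi.single k 1 : Fin N → ℝ) l - p l| := by
    intro t k
    have hcol : ∀ t, ((B ^ n) ^ t) *ᵥ (Pi.single k 1 - p) = fun l => ((B ^ n) ^ t) l k - p l := by
      intro t
      rw [Matrix.mulVec_sub, ← pow_mul, hpn]
      ext l
      simp
    induction t with
    | zero => simp [Matrix.one_apply, Pi.single_apply]
    | succ t ih =>
      have h0 : ∑ l, (((B ^ n) ^ t) *ᵥ (Pi.single k 1 - p)) l = 0 := by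
        rw [hcol]
        rw [Finset.sum_sub_distrib, Matrix.sum_col_of_mem_colStochastic (pow_mem hBn t), hsum,
          sub_self]
      have h1 := sum_abs_mulVec_le hBn hε h0
      rw [Matrix.mulVec_mulVec, ← pow_succ', hcol, hcol] at h1
      refine h1.trans ?_
      rw [pow_succ', mul_assoc]
      exact mul_le_mul_of_nonneg_left ih hε1
  obtain ⟨K, hK⟩ : ∃ K : ℝ, ∀ k, ∑ l, |(Pi.single k 1 : Fin N → ℝ) l - p l| ≤ K := by
    obtain ⟨a, ha⟩ := Finite.exists_max
      fun k : Fin N => ∑ l, |(Pi.single k 1 : Fin N → ℝ) l - p l|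
    exact ⟨_, ha⟩
  have hlim : Tendsto (fun t : ℕ => (1 - N * ε) ^ t * K) atTop (𝓝 0) := by
    simpa using (tendsto_pow_atTop_nhds_zero_of_lt_one hε1 hlt).mul_const K
  obtain ⟨t, ht1, ht⟩ := ((eventually_ge_atTop 1).and (hlim.eventually (gt_mem_nhds hη))).exists
  refine ⟨n * t, Nat.mul_pos hn ht1, fun l k => ?_⟩
  rw [pow_mul]
  refine (Finset.single_le_sum (f := fun l => |((B ^ n) ^ t) l k - p l|)
    (fun _ _ => abs_nonneg _) (Finset.mem_univ l)).trans ((key t k).trans ?_)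
  exact (mul_le_mul_of_nonneg_left (hK k) (pow_nonneg hε1 t)).trans ht.le

/-- The Perron vector is a limit of columns of powers of the matrix. -/
lemma perron_nonneg (hB : B ∈ Matrix.colStochastic ℝ (Fin N)) (hprim : B.IsPrimitive)
    {p : Fin N → ℝ} (hp : B *ᵥ p = p) (hsum : ∑ k, p k = 1) (k : Fin N) : 0 ≤ p k := by
  by_contra! h
  obtain ⟨m, -, hm⟩ := exists_pow_close_perron hB hprim hp hsum (η := -p k / 2) (by linarith)
  have h1 := (abs_le.1 (hm k k)).2
  have h2 := Matrix.nonneg_of_mem_colStochastic (pow_mem hB m) (i := k) (j := k)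
  linarith

end Perron

/-! ### Disagreement between agents -/

section Disagreement

variable {N M : ℕ}

lemma combine_sub (A : Matrix (Fin N) (Fin N) ℝ) (v w : Fin N → Vec M) :
    combine A (v - w) = combine A v - combine A w := by
  ext1 k
  simp [combine, smul_sub, Finset.sum_sub_distrib]

lemma combine_combine (A B : Matrix (Fin N) (Fin N) ℝ) (v : Fin N → Vec M) :
    combine B (combine A v) = combine (A * B) v := by
  ext1 k
  simp only [combine, Finset.smul_sum, Matrix.mul_apply, Finset.sum_smul]
  rw [Finset.sum_comm]
  refine Finset.sum_congr rfl fun j _ => Finset.sum_congr rfl fun l _ => ?_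
  rw [smul_smul, mul_comm]

lemma combine_one (v : Fin N → Vec M) : combine 1 v = v := by
  ext1 k
  simp [combine, Matrix.one_apply]

lemma combine_const {A : Matrix (Fin N) (Fin N) ℝ} (hA : A ∈ Matrix.colStochastic ℝ (Fin N))
    (c : Vec M) : combine A (fun _ => c) = fun _ => c := by
  ext1 k
  simp [combine, ← Finset.sum_smul, Matrix.sum_col_of_mem_colStochastic hA]

lemma norm_combine_le {A : Matrix (Fin N) (Fin N) ℝ} (hA : A ∈ Matrix.colStochastic ℝ (Fin N))
    (v : Fin N → Vec M) : ‖combine A v‖ ≤ ‖v‖ := by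
  refine (pi_norm_le_iff_of_nonneg (norm_nonneg v)).2 fun k => ?_
  calc ‖combine A v k‖ ≤ ∑ l, ‖A l k • v l‖ := norm_sum_le _ _
    _ ≤ ∑ l, A l k * ‖v‖ := Finset.sum_le_sum fun l _ => by
        rw [norm_smul, Real.norm_of_nonneg (Matrix.nonneg_of_mem_colStochastic hA)]
        exact mul_le_mul_of_nonneg_left (norm_le_pi_norm v l)
          (Matrix.nonneg_of_mem_colStochastic hA)
    _ = ‖v‖ := by rw [← Finset.sum_mul, Matrix.sum_col_of_mem_colStochastic hA, one_mul]

/-- The average of the agents' vectors with weights `p`. -/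
noncomputable def centroid (p : Fin N → ℝ) (v : Fin N → Vec M) : Vec M := ∑ l, p l • v l

/-- The deviations of the agents' vectors from their weighted average. -/
noncomputable def disagreement (p : Fin N → ℝ) (v : Fin N → Vec M) : Fin N → Vec M :=
  fun k => v k - centroid p v

lemma centroid_sub (p : Fin N → ℝ) (v w : Fin N → Vec M) :
    centroid p (v - w) = centroid p v - centroid p w := by
  simp [centroid, smul_sub, Finset.sum_sub_distrib]

lemma centroid_combine (p : Fin N → ℝ) (A : Matrix (Fin N) (Fin N) ℝ) (v : Fin N → Vec M) :
    centroid p (combine A v) = centroid (A *ᵥ p) v := by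
  simp only [centroid, combine, Finset.smul_sum, Matrix.mulVec, dotProduct, Finset.sum_smul]
  rw [Finset.sum_comm]
  refine Finset.sum_congr rfl fun j _ => Finset.sum_congr rfl fun l _ => ?_
  rw [smul_smul, mul_comm]

lemma disagreement_sub (p : Fin N → ℝ) (v w : Fin N → Vec M) :
    disagreement p (v - w) = disagreement p v - disagreement p w := by
  ext1 k
  simp only [disagreement, centroid_sub, Pi.sub_apply]
  abel

lemma norm_centroid_le {p : Fin N → ℝ} (hp0 : ∀ k, 0 ≤ p k) (hp1 : ∑ k, p k = 1)
    (v : Fin N → Vec M) : ‖centroid p v‖ ≤ ‖v‖ := by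
  calc ‖centroid p v‖ ≤ ∑ l, ‖p l • v l‖ := norm_sum_le _ _
    _ ≤ ∑ l, p l * ‖v‖ := Finset.sum_le_sum fun l _ => by
        rw [norm_smul, Real.norm_of_nonneg (hp0 l)]
        exact mul_le_mul_of_nonneg_left (norm_le_pi_norm v l) (hp0 l)
    _ = ‖v‖ := by rw [← Finset.sum_mul, hp1, one_mul]

lemma norm_disagreement_le {p : Fin N → ℝ} (hp0 : ∀ k, 0 ≤ p k) (hp1 : ∑ k, p k = 1)
    (v : Fin N → Vec M) : ‖disagreement p v‖ ≤ 2 * ‖v‖ := by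
  refine (pi_norm_le_iff_of_nonneg (by positivity)).2 fun k => ?_
  have h1 := norm_sub_le (v k) (centroid p v)
  have h2 := norm_le_pi_norm v k
  have h3 := norm_centroid_le hp0 hp1 v
  simp only [disagreement]
  linarith

lemma combine_disagreement {p : Fin N → ℝ} {A : Matrix (Fin N) (Fin N) ℝ}
    (hA : A ∈ Matrix.colStochastic ℝ (Fin N)) (hp : A *ᵥ p = p) (v : Fin N → Vec M) :
    combine A (disagreement p v) = disagreement p (combine A v) := by
  have : disagreement p v = v - fun _ => centroid p v := rfl
  rw [this, combine_sub, combine_const hA]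
  ext1 k
  simp [disagreement, centroid_combine, hp]

lemma centroid_disagreement {p : Fin N → ℝ} (hp1 : ∑ k, p k = 1) (v : Fin N → Vec M) :
    centroid p (disagreement p v) = 0 := by
  have : disagreement p v = v - fun _ => centroid p v := rfl
  rw [this, centroid_sub]
  simp [centroid, ← Finset.sum_smul, hp1]

/-- The total disagreement over the first `m` noiseless combination rounds. For suitable `m` it is
a seminorm equivalent to the norm of the disagreement, and it is a strict contraction for a single
combination round. -/
noncomputable def disagreementNorm (B : Matrix (Fin N) (Fin N) ℝ) (p : Fin N → ℝ) (m : ℕ)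
    (v : Fin N → Vec M) : ℝ :=
  ∑ n ∈ Finset.range m, ‖disagreement p (combine (B ^ n) v)‖

lemma disagreementNorm_nonneg (B : Matrix (Fin N) (Fin N) ℝ) (p : Fin N → ℝ) (m : ℕ)
    (v : Fin N → Vec M) : 0 ≤ disagreementNorm B p m v :=
  Finset.sum_nonneg fun _ _ => norm_nonneg _

lemma disagreementNorm_sub_le (B : Matrix (Fin N) (Fin N) ℝ) (p : Fin N → ℝ) (m : ℕ)
    (v w : Fin N → Vec M) :
    disagreementNorm B p m (v - w) ≤ disagreementNorm B p m v + disagreementNorm B p m w := by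
  simp only [disagreementNorm, ← Finset.sum_add_distrib]
  refine Finset.sum_le_sum fun n _ => ?_
  rw [combine_sub, disagreement_sub]
  exact norm_sub_le _ _

lemma disagreementNorm_le {B : Matrix (Fin N) (Fin N) ℝ}
    (hB : B ∈ Matrix.colStochastic ℝ (Fin N)) {p : Fin N → ℝ} (hp0 : ∀ k, 0 ≤ p k)
    (hp1 : ∑ k, p k = 1) (m : ℕ) (v : Fin N → Vec M) :
    disagreementNorm B p m v ≤ 2 * m * ‖v‖ := by
  calc disagreementNorm B p m v ≤ ∑ _n ∈ Finset.range m, 2 * ‖v‖ :=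
        Finset.sum_le_sum fun n _ => (norm_disagreement_le hp0 hp1 _).trans
          (mul_le_mul_of_nonneg_left (norm_combine_le (pow_mem hB n) v) (by norm_num))
    _ = 2 * m * ‖v‖ := by simp; ring

/-- The number of rounds in the disagreement seminorm is chosen so that the powers of `B` have
almost reached their limit; the telescoping sum then loses a fixed proportion in each round. -/
lemma exists_disagreementNorm_combine_le {B : Matrix (Fin N) (Fin N) ℝ}
    (hB : B ∈ Matrix.colStochastic ℝ (Fin N)) (hprim : B.IsPrimitive)
    {p : Fin N → ℝ} (hp : B *ᵥ p = p) (hsum : ∑ k, p k = 1) :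
    ∃ m : ℕ, ∃ ρ : ℝ, 0 ≤ ρ ∧ ρ < 1 ∧
      (∀ v : Fin N → Vec M, ‖disagreement p v‖ ≤ disagreementNorm B p m v) ∧
      ∀ v : Fin N → Vec M, disagreementNorm B p m (combine B v) ≤ ρ * disagreementNorm B p m v := by
  have hN : (0 : ℝ) < N := by
    rcases Nat.eq_zero_or_pos N with rfl | h
    · simp at hsum
    · exact_mod_cast h
  obtain ⟨m, hm, hclose⟩ := exists_pow_close_perron hB hprim hp hsum (η := 1 / (2 * N))
    (by positivity)
  have hpn : ∀ n, (B ^ n) *ᵥ p = p := by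
    intro m
    induction m with
    | zero => simp
    | succ m ih => rw [pow_succ, ← Matrix.mulVec_mulVec, hp, ih]
  have hm1 : (1 : ℝ) ≤ m := by exact_mod_cast hm
  have hbase : ∀ v : Fin N → Vec M, ‖disagreement p v‖ ≤ disagreementNorm B p m v := by
    intro v
    have := Finset.single_le_sum (f := fun n => ‖disagreement p (combine (B ^ n) v)‖)
      (fun _ _ => norm_nonneg _) (Finset.mem_range.2 hm)
    simpa [disagreementNorm, combine_one] using this
  -- after `m` rounds the disagreement is halved
  have hhalf : ∀ v : Fin N → Vec M,
      ‖disagreement p (combine (B ^ m) v)‖ ≤ 1 / 2 * ‖disagreement p v‖ := by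
    intro v
    rw [← combine_disagreement (pow_mem hB m) (hpn m)]
    set d := disagreement p v with hd
    refine (pi_norm_le_iff_of_nonneg (by positivity)).2 fun k => ?_
    have h1 : combine (B ^ m) d k = ∑ l, ((B ^ m) l k - p l) • d l := by
      have := centroid_disagreement hsum v
      simp only [← hd, centroid] at this
      simp [combine, sub_smul, Finset.sum_sub_distrib, this]
    rw [h1]
    calc ‖∑ l, ((B ^ m) l k - p l) • d l‖ ≤ ∑ l, ‖((B ^ m) l k - p l) • d l‖ := norm_sum_le _ _
      _ ≤ ∑ _l : Fin N, 1 / (2 * N) * ‖d‖ := Finset.sum_le_sum fun l _ => by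
          rw [norm_smul]
          exact mul_le_mul (hclose l k) (norm_le_pi_norm d l) (norm_nonneg _) (by positivity)
      _ = 1 / 2 * ‖d‖ := by
          simp
          field_simp
  refine ⟨m, 1 - 1 / (2 * m), ?_, ?_, hbase, fun v => ?_⟩
  · have : 1 / (2 * (m : ℝ)) ≤ 1 := by
      rw [div_le_one (by positivity)]
      linarith
    linarith
  · have : 0 < 1 / (2 * (m : ℝ)) := by positivity
    linarith
  · -- both sides are the sum over the rounds `0, …, m`
    have hshift : disagreementNorm B p m (combine B v) + ‖disagreement p v‖ =
        disagreementNorm B p m v + ‖disagreement p (combine (B ^ m) v)‖ := by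
      have h1 := Finset.sum_range_succ (fun n => ‖disagreement p (combine (B ^ n) v)‖) m
      have h2 := Finset.sum_range_succ' (fun n => ‖disagreement p (combine (B ^ n) v)‖) m
      simp only [disagreementNorm, combine_combine, ← pow_succ']
      rw [← h1, h2, pow_zero, combine_one]
    have hup : disagreementNorm B p m v ≤ m * ‖disagreement p v‖ := by
      calc disagreementNorm B p m v ≤ ∑ _n ∈ Finset.range m, ‖disagreement p v‖ :=
            Finset.sum_le_sum fun n _ => by
              rw [← combine_disagreement (pow_mem hB n) (hpn n)]
              exact norm_combine_le (pow_mem hB n) _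
        _ = m * ‖disagreement p v‖ := by simp
    have h3 := hhalf v
    have h4 : 1 / (2 * (m : ℝ)) * disagreementNorm B p m v ≤ 1 / 2 * ‖disagreement p v‖ := by
      calc 1 / (2 * (m : ℝ)) * disagreementNorm B p m v
          ≤ 1 / (2 * (m : ℝ)) * (m * ‖disagreement p v‖) :=
            mul_le_mul_of_nonneg_left hup (by positivity)
        _ = 1 / 2 * ‖disagreement p v‖ := by field_simp
    linarith

end Disagreement

/-! ### Quadratic approximation of the cost at its minimizer -/

section Cost

variable {M : ℕ} {J : Vec M → ℝ} {ν δ : ℝ}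

lemma toEuclideanCLM_hessian (J : Vec M → ℝ) (w : Vec M) :
    Matrix.toEuclideanCLM (n := Fin M) (𝕜 := ℝ) (hessian J w) = fderiv ℝ (gradient J) w := by
  ext h m
  have hh : h = ∑ n, h n • EuclideanSpace.single n (1 : ℝ) := by
    ext i
    simp [Finset.sum_apply, Pi.single_apply]
  rw [Matrix.ofLp_toEuclideanCLM]
  conv_rhs => rw [hh]
  simp [hessian, Matrix.mulVec, dotProduct, map_sum, Finset.sum_apply, mul_comm]

/-- Second-order information on a cost `J` at its minimizer `wo`: the gradient is strongly monotone
and Lipschitz, and `e`, `lam` diagonalize the Hessian matrix at `wo`, which governs gradient and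
cost up to a quadratic and a cubic remainder, on the whole space. -/
structure QuadraticApprox (J : Vec M → ℝ) (wo : Vec M) (ν δ K : ℝ)
    (e : OrthonormalBasis (Fin M) ℝ (Vec M)) (lam : Fin M → ℝ) : Prop where
  ν_pos : 0 < ν
  ν_le_δ : ν ≤ δ
  K_nonneg : 0 ≤ K
  le_lam : ∀ j, ν ≤ lam j
  lam_le : ∀ j, lam j ≤ δ
  differentiable : Differentiable ℝ J
  gradient_eq_zero : gradient J wo = 0
  lipschitz : ∀ v w, ‖gradient J v - gradient J w‖ ≤ δ * ‖v - w‖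
  monotone : ∀ h, ν * ‖h‖ ^ 2 ≤ inner ℝ h (gradient J (wo + h))
  gradient_approx : ∀ j h,
    |inner ℝ (e j) (gradient J (wo + h)) - lam j * inner ℝ (e j) h| ≤ K * ‖h‖ ^ 2
  cost_approx : ∀ h,
    |J (wo + h) - J wo - 1 / 2 * ∑ j, lam j * inner ℝ (e j) h ^ 2| ≤ K * ‖h‖ ^ 3

lemma inner_hessian_bounds (w : Vec M)
    (hl : (hessian J w - ν • (1 : Matrix (Fin M) (Fin M) ℝ)).PosSemidef)
    (hu : (δ • (1 : Matrix (Fin M) (Fin M) ℝ) - hessian J w).PosSemidef) (h : Vec M) :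
    ν * ‖h‖ ^ 2 ≤ inner ℝ h (fderiv ℝ (gradient J) w h) ∧
      inner ℝ h (fderiv ℝ (gradient J) w h) ≤ δ * ‖h‖ ^ 2 := by
  have h1 := hl.dotProduct_mulVec_nonneg h.ofLp
  have h2 := hu.dotProduct_mulVec_nonneg h.ofLp
  have h3 : ‖h‖ ^ 2 = h.ofLp ⬝ᵥ h.ofLp := by
    rw [EuclideanSpace.real_norm_sq_eq]
    simp [dotProduct, sq]
  rw [← toEuclideanCLM_hessian, Matrix.inner_toEuclideanCLM, h3]
  simp only [star_trivial, Matrix.sub_mulVec, Matrix.smul_mulVec, Matrix.one_mulVec,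
    dotProduct_sub, dotProduct_smul, smul_eq_mul] at h1 h2
  constructor <;> linarith

lemma inner_hessian_symm (w : Vec M)
    (hl : (hessian J w - ν • (1 : Matrix (Fin M) (Fin M) ℝ)).PosSemidef) (v h : Vec M) :
    inner ℝ (fderiv ℝ (gradient J) w v) h = inner ℝ v (fderiv ℝ (gradient J) w h) := by
  have hH : (hessian J w).IsHermitian := by
    have h1 := hl.isHermitian
    have h2 : (ν • (1 : Matrix (Fin M) (Fin M) ℝ)).IsHermitian := by
      simp [Matrix.IsHermitian]
    simpa using h1.add h2
  have := Matrix.isSymmetric_toEuclideanLin_iff.2 hH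
  rw [← toEuclideanCLM_hessian]
  exact this v h

/-- The generalized Cauchy–Schwarz inequality for the Hessian form, applied to `h` and `H h`. -/
lemma norm_fderiv_gradient_le (w : Vec M) (hν : 0 < ν) (hνδ : ν ≤ δ)
    (hl : (hessian J w - ν • (1 : Matrix (Fin M) (Fin M) ℝ)).PosSemidef)
    (hu : (δ • (1 : Matrix (Fin M) (Fin M) ℝ) - hessian J w).PosSemidef) :
    ‖fderiv ℝ (gradient J) w‖ ≤ δ := by
  refine ContinuousLinearMap.opNorm_le_bound _ (hν.le.trans hνδ) fun h => ?_
  set T := fderiv ℝ (gradient J) w with hT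
  have hδ : 0 < δ := hν.trans_le hνδ
  -- nonnegativity of the form at `δ h - T h`
  have h1 := (inner_hessian_bounds w hl hu (δ • h - T h)).1
  have h2 := (inner_hessian_bounds w hl hu (T h)).2
  have h3 := (inner_hessian_bounds w hl hu h).2
  have h4 := inner_hessian_symm w hl h (T h)
  rw [← hT] at h1 h2 h3 h4
  have h5 : inner ℝ (T h) (T h) = ‖T h‖ ^ 2 := real_inner_self_eq_norm_sq _
  simp only [map_sub, map_smul, inner_sub_left, inner_sub_right, inner_smul_left, inner_smul_right,
    RCLike.conj_to_real] at h1
  rw [← h4, h5] at h1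
  have h6 : 0 ≤ ν * ‖δ • h - T h‖ ^ 2 := by positivity
  have h7 : ‖T h‖ ^ 2 ≤ (δ * ‖h‖) ^ 2 := by
    have h8 : δ * ‖T h‖ ^ 2 ≤ δ * (δ * ‖h‖) ^ 2 := by
      have h9 := mul_le_mul_of_nonneg_left h3 (sq_nonneg δ)
      linear_combination h9 + h2 + h1 + h6
    exact le_of_mul_le_mul_left h8 hδ
  exact le_of_sq_le_sq h7 (by positivity)

/-- The Lipschitz condition on the Hessian matrix gives the quadratic remainder of the gradient near
the minimizer; away from it the gradient and its linearization are both of linear size, which is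
absorbed into a quadratic bound by enlarging the constant. -/
lemma exists_quadraticApprox {wo : Vec M} (hν : 0 < ν) (hνδ : ν ≤ δ)
    (hmin : ∀ w, J wo ≤ J w) (hd : Differentiable ℝ J) (hdd : Differentiable ℝ (gradient J))
    (hl : ∀ w, (hessian J w - ν • (1 : Matrix (Fin M) (Fin M) ℝ)).PosSemidef)
    (hu : ∀ w, (δ • (1 : Matrix (Fin M) (Fin M) ℝ) - hessian J w).PosSemidef)
    {κ ε : ℝ} (hκ : 0 ≤ κ) (hε : 0 < ε)
    (hlip : ∀ h : Vec M, ‖h‖ ≤ ε → matNorm (hessian J (wo + h) - hessian J wo) ≤ κ * ‖h‖) :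
    ∃ K e lam, QuadraticApprox J wo ν δ K e lam := by
  have hδ : 0 < δ := hν.trans_le hνδ
  set g := gradient J with hg
  set T := fderiv ℝ g wo with hT
  have hgrad0 : g wo = 0 := by
    have h1 : IsLocalMin J wo := Filter.Eventually.of_forall hmin
    rw [hg, gradient, h1.fderiv_eq_zero, map_zero]
  have hlips : ∀ v w, ‖g v - g w‖ ≤ δ * ‖v - w‖ := fun v w =>
    convex_univ.norm_image_sub_le_of_norm_fderiv_le (fun x _ => hdd x)
      (fun x _ => norm_fderiv_gradient_le x hν hνδ (hl x) (hu x)) (Set.mem_univ _) (Set.mem_univ _)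
  have hTn : ‖T‖ ≤ δ := norm_fderiv_gradient_le wo hν hνδ (hl wo) (hu wo)
  have hsymm : (T : Vec M →ₗ[ℝ] Vec M).IsSymmetric := fun v h => inner_hessian_symm wo (hl wo) v h
  have hfin : Module.finrank ℝ (Vec M) = M := by simp
  set e := hsymm.eigenvectorBasis hfin with he
  set lam := hsymm.eigenvalues hfin with hlam
  have hTe : ∀ j, T (e j) = lam j • e j := fun j => hsymm.apply_eigenvectorBasis hfin j
  have hlamb : ∀ j, ν ≤ lam j ∧ lam j ≤ δ := by
    intro j
    have h1 := inner_hessian_bounds wo (hl wo) (hu wo) (e j)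
    rw [← hg, ← hT, hTe, inner_smul_right, real_inner_self_eq_norm_sq, e.orthonormal.1 j] at h1
    simpa using h1
  have hinner : ∀ j h, inner ℝ (e j) (T h) = lam j * inner ℝ (e j) h := by
    intro j h
    have h1 := hsymm (e j) h
    simp only [ContinuousLinearMap.coe_coe] at h1
    rw [← h1, hTe, inner_smul_left, RCLike.conj_to_real]
  have hTquad : ∀ h, inner ℝ h (T h) = ∑ j, lam j * inner ℝ (e j) h ^ 2 := by
    intro h
    rw [← e.sum_inner_mul_inner h (T h)]
    refine Finset.sum_congr rfl fun j _ => ?_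
    rw [hinner, real_inner_comm]
    ring
  -- `κ` serves inside the ball of radius `ε`, and `2 δ / ε` outside of it
  set K := κ + 2 * δ / ε with hK
  have hK0 : 0 ≤ K := by positivity
  have hrem : ∀ h, ‖g (wo + h) - T h‖ ≤ K * ‖h‖ ^ 2 := by
    intro h
    rcases le_or_gt ‖h‖ ε with hle | hgt
    · have h1 := (convex_closedBall wo ‖h‖).norm_image_sub_le_of_norm_hasFDerivWithin_le'
        (f := g) (f' := fun x => fderiv ℝ g x) (φ := T) (C := κ * ‖h‖) (x := wo) (y := wo + h)
        (fun x _ => (hdd x).hasFDerivAt.hasFDerivWithinAt) (fun x hx => ?_) (by simp) (by simp)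
      · rw [hgrad0, sub_zero, add_sub_cancel_left] at h1
        have : κ * ‖h‖ * ‖h‖ ≤ K * ‖h‖ ^ 2 := by
          have : 0 ≤ 2 * δ / ε * ‖h‖ ^ 2 := by positivity
          rw [hK]
          linarith
        exact h1.trans this
      · have hxn : ‖x - wo‖ ≤ ‖h‖ := by simpa [dist_eq_norm] using hx
        have h2 := hlip (x - wo) (hxn.trans hle)
        rw [matNorm, map_sub, toEuclideanCLM_hessian, toEuclideanCLM_hessian,
          add_sub_cancel] at h2
        exact h2.trans (mul_le_mul_of_nonneg_left hxn hκ)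
    · have h1 : ‖g (wo + h)‖ ≤ δ * ‖h‖ := by simpa [hgrad0] using hlips (wo + h) wo
      have h2 : ‖T h‖ ≤ δ * ‖h‖ := (T.le_opNorm h).trans
        (mul_le_mul_of_nonneg_right hTn (norm_nonneg _))
      have h3 : ‖h‖ ≤ ‖h‖ ^ 2 / ε := by
        rw [le_div_iff₀ hε, sq]
        exact mul_le_mul_of_nonneg_left hgt.le (norm_nonneg _)
      calc ‖g (wo + h) - T h‖ ≤ 2 * δ * ‖h‖ := by
            have := norm_sub_le (g (wo + h)) (T h)
            linarith
        _ ≤ 2 * δ * (‖h‖ ^ 2 / ε) := by gcongr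
        _ ≤ K * ‖h‖ ^ 2 := by
            have : 0 ≤ κ * ‖h‖ ^ 2 := by positivity
            rw [hK]
            have h5 : 2 * δ * (‖h‖ ^ 2 / ε) = 2 * δ / ε * ‖h‖ ^ 2 := by ring
            rw [h5]
            linarith
  refine ⟨K, e, lam, hν, hνδ, hK0, fun j => (hlamb j).1, fun j => (hlamb j).2, hd, hgrad0, hlips,
    fun h => ?_, fun j h => ?_, fun h => ?_⟩
  · -- mean value theorem for `t ↦ ⟪h, ∇J (wo + t h)⟫`
    have hder : ∀ t : ℝ, HasDerivAt (fun t : ℝ => inner ℝ h (g (wo + t • h)))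
        (inner ℝ h (fderiv ℝ g (wo + t • h) h)) t := by
      intro t
      have h1 : HasDerivAt (fun t : ℝ => wo + t • h) h t := by
        simpa using ((hasDerivAt_id t).smul_const h).const_add wo
      have h2 := (hdd (wo + t • h)).hasFDerivAt.comp_hasDerivAt t h1
      have h3 := (innerSL ℝ h).hasFDerivAt.comp_hasDerivAt t h2
      exact h3
    obtain ⟨t, -, ht⟩ := exists_hasDerivAt_eq_slope (fun t : ℝ => inner ℝ h (g (wo + t • h))) _
      zero_lt_one (fun t _ => (hder t).continuousAt.continuousWithinAt) (fun t _ => hder t)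
    have h4 := (inner_hessian_bounds _ (hl (wo + t • h)) (hu (wo + t • h)) h).1
    rw [← hg, ht] at h4
    have h5 : inner ℝ h (g (wo + (1 : ℝ) • h)) - inner ℝ h (g (wo + (0 : ℝ) • h)) =
        inner ℝ h (g (wo + h)) := by
      rw [one_smul, zero_smul, add_zero, hgrad0, inner_zero_right, sub_zero]
    rwa [h5, sub_zero, div_one] at h4
  · rw [← hinner, ← inner_sub_right]
    refine (abs_real_inner_le_norm _ _).trans ?_
    rw [e.orthonormal.1 j, one_mul]
    exact hrem h
  · rw [← hTquad]
    -- mean value inequality for `v ↦ J (wo + v) - ⟪v, T v⟫ / 2` on the ball of radius `‖h‖`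
    have hder : ∀ v : Vec M, HasFDerivAt (fun v => J (wo + v) - 1 / 2 * inner ℝ v (T v))
        (innerSL ℝ (g (wo + v) - T v)) v := by
      intro v
      have h1 : HasFDerivAt (fun v => J (wo + v)) (innerSL ℝ (g (wo + v))) v := by
        have h2 : HasFDerivAt J (innerSL ℝ (g (wo + v))) (wo + v) := by
          have := (hd (wo + v)).hasGradientAt
          rw [hasGradientAt_iff_hasFDerivAt] at this
          exact this
        have h3 : HasFDerivAt (fun v : Vec M => wo + v) (ContinuousLinearMap.id ℝ (Vec M)) v :=
          (hasFDerivAt_id v).const_add wo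
        exact h2.comp v h3
      have h2 : HasFDerivAt (fun v : Vec M => inner ℝ v (T v)) _ v :=
        (hasFDerivAt_id v).inner ℝ T.hasFDerivAt
      refine (h1.sub (h2.const_mul (1 / 2))).congr_fderiv ?_
      ext z
      have h4 := hsymm v z
      simp only [ContinuousLinearMap.coe_coe] at h4
      simp [fderivInnerCLM_apply, ← h4, real_inner_comm z]
      ring
    have h1 := (convex_closedBall (0 : Vec M) ‖h‖).norm_image_sub_le_of_norm_hasFDerivWithin_le
      (C := K * ‖h‖ ^ 2) (x := 0) (y := h) (fun v _ => (hder v).hasFDerivWithinAt)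
      (fun v hv => ?_) (by simp) (by simp)
    · simp only [add_zero, map_zero, inner_zero_left, mul_zero, sub_zero, Real.norm_eq_abs] at h1
      calc |J (wo + h) - J wo - 1 / 2 * inner ℝ h (T h)|
          = |J (wo + h) - 1 / 2 * inner ℝ h (T h) - J wo| := by congr 1; ring
        _ ≤ K * ‖h‖ ^ 2 * ‖h‖ := h1
        _ = K * ‖h‖ ^ 3 := by ring
    · rw [innerSL_apply_norm]
      have hv' : ‖v‖ ≤ ‖h‖ := by simpa using hv
      refine (hrem v).trans (mul_le_mul_of_nonneg_left ?_ hK0)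
      gcongr

end Cost

/-! ### Scalar recursions -/

section Recursions

/-- A linear recursion with contraction factor `1 - c` and drive `b` ends up below every number
larger than `b / c`. -/
lemma eventually_le_of_recursion {a : ℕ → ℝ} {c b η : ℝ} (hc : 0 < c) (hc1 : c ≤ 1)
    (ha : ∀ᶠ i in atTop, a (i + 1) ≤ (1 - c) * a i + b) (hη : 0 < η) :
    ∀ᶠ i in atTop, a i ≤ b / c + η := by
  obtain ⟨i₀, hi₀⟩ := eventually_atTop.1 ha
  have hb : b = c * (b / c) := by field_simp
  have key : ∀ t, a (i₀ + t) - b / c ≤ (1 - c) ^ t * |a i₀ - b / c| := by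
    intro t
    induction t with
    | zero => simpa using le_abs_self (a i₀ - b / c)
    | succ t ih =>
      have h1 := hi₀ (i₀ + t) (by omega)
      have h2 := mul_le_mul_of_nonneg_left ih (sub_nonneg.2 hc1)
      rw [pow_succ', mul_assoc, ← add_assoc]
      linarith
  have hlim : Tendsto (fun t : ℕ => (1 - c) ^ t * |a i₀ - b / c|) atTop (𝓝 0) := by
    simpa using (tendsto_pow_atTop_nhds_zero_of_lt_one (sub_nonneg.2 hc1) (by linarith)).mul_const
      |a i₀ - b / c|
  obtain ⟨t₀, ht₀⟩ := eventually_atTop.1 (hlim.eventually (gt_mem_nhds hη))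
  filter_upwards [eventually_ge_atTop (i₀ + t₀)] with i hi
  obtain ⟨t, rfl⟩ := Nat.exists_eq_add_of_le hi
  have h1 := key (t₀ + t)
  have h2 := ht₀ (t₀ + t) (by omega)
  rw [← add_assoc] at h1
  linarith

/-- The coupled recursion of the fourth moments `x` of the centroid error and `y` of the
disagreement. The combination `x + κ μ y` with `κ = 2 C / (1 - ρ)` contracts by a factor
`1 - b μ / 2`, so that it ends up of the order `μ²`; then `y` ends up of the order `μ⁴`. -/
lemma exists_fourth_moment_bound {b ρ C : ℝ} (hb : 0 < b) (hρ0 : 0 ≤ ρ) (hρ1 : ρ < 1)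
    (hC : 0 < C) :
    ∃ C' : ℝ, ∀ᶠ μ : ℝ in 𝓝[>] 0, ∀ x y : ℕ → ℝ, (∀ i, 0 ≤ x i) → (∀ i, 0 ≤ y i) →
      (∀ i, y (i + 1) ≤ ρ * y i + C * μ ^ 4 * (1 + x i + y i)) →
      (∀ i, x (i + 1) ≤ (1 - b * μ) * x i + C * μ * y i + C * μ ^ 3 * (1 + x i + y i)) →
      ∀ᶠ i in atTop, x i ≤ C' * μ ^ 2 ∧ y i ≤ C' * μ ^ 4 := by
  set κ := 2 * C / (1 - ρ) with hκ
  have h1ρ : 0 < 1 - ρ := by linarith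
  have hκ0 : 0 < κ := by positivity
  have hκρ : κ * (1 - ρ) = 2 * C := by rw [hκ]; field_simp
  set C₁ := (C + κ * C) / (b / 2) + 1 with hC₁
  have hC₁0 : 0 < C₁ := by positivity
  set C₂ := C * (1 + C₁ + C₁ / κ) / (1 - ρ) + 1 with hC₂
  refine ⟨max C₁ C₂, ?_⟩
  have hμ1 : ∀ᶠ μ : ℝ in 𝓝[>] 0, μ < 1 := eventually_nhdsWithin_of_eventually_nhds
    (gt_mem_nhds zero_lt_one)
  have hμb : ∀ᶠ μ : ℝ in 𝓝[>] 0, b / 2 * μ < 1 := by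
    have h : Tendsto (fun μ : ℝ => b / 2 * μ) (𝓝 0) (𝓝 (b / 2 * 0)) :=
      Continuous.tendsto (by fun_prop) 0
    rw [mul_zero] at h
    exact eventually_nhdsWithin_of_eventually_nhds (h.eventually (gt_mem_nhds zero_lt_one))
  have hμx : ∀ᶠ μ : ℝ in 𝓝[>] 0, C * μ ^ 2 + κ * C * μ ^ 4 < b / 2 := by
    have h : Tendsto (fun μ : ℝ => C * μ ^ 2 + κ * C * μ ^ 4) (𝓝 0)
      (𝓝 (C * 0 ^ 2 + κ * C * 0 ^ 4)) := Continuous.tendsto (by fun_prop) 0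
    have h0 : C * 0 ^ 2 + κ * C * 0 ^ 4 = 0 := by ring
    rw [h0] at h
    exact eventually_nhdsWithin_of_eventually_nhds (h.eventually (gt_mem_nhds (by positivity)))
  have hμy : ∀ᶠ μ : ℝ in 𝓝[>] 0, C * μ ^ 2 + κ * C * μ ^ 4 + κ * (b / 2) * μ < C := by
    have h : Tendsto (fun μ : ℝ => C * μ ^ 2 + κ * C * μ ^ 4 + κ * (b / 2) * μ) (𝓝 0)
      (𝓝 (C * 0 ^ 2 + κ * C * 0 ^ 4 + κ * (b / 2) * 0)) := Continuous.tendsto (by fun_prop) 0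
    have h0 : C * 0 ^ 2 + κ * C * 0 ^ 4 + κ * (b / 2) * 0 = 0 := by ring
    rw [h0] at h
    exact eventually_nhdsWithin_of_eventually_nhds (h.eventually (gt_mem_nhds hC))
  filter_upwards [hμ1, hμb, hμx, hμy, self_mem_nhdsWithin] with μ hμ1 hμb hμx hμy hμ x y hx hy hyr
    hxr
  have hμ : 0 < μ := hμ
  -- `κ (1 - ρ) = 2 C`, so the contraction of `κ μ y` pays for the term `C μ y` in the
  -- recursion of `x`
  have hz : ∀ i, x (i + 1) + κ * μ * y (i + 1) ≤
      (1 - b / 2 * μ) * (x i + κ * μ * y i) + (C + κ * C) * μ ^ 3 := by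
    intro i
    have h1 := hxr i
    have h2 := mul_le_mul_of_nonneg_left (hyr i) (mul_pos hκ0 hμ).le
    have h3 := mul_nonneg (mul_nonneg hμ.le (sub_nonneg.2 hμx.le)) (hx i)
    have h4 := mul_nonneg (mul_nonneg hμ.le (sub_nonneg.2 hμy.le)) (hy i)
    have h5 : κ * C * μ ^ 5 ≤ κ * C * μ ^ 3 :=
      mul_le_mul_of_nonneg_left (pow_le_pow_of_le_one hμ.le hμ1.le (by norm_num)) (by positivity)
    linear_combination h1 + h2 + h3 + h4 + h5 - hκρ * μ * y i
  have hz' := eventually_le_of_recursion (a := fun i => x i + κ * μ * y i)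
    (mul_pos (half_pos hb) hμ) hμb.le
    (Eventually.of_forall hz) (pow_pos hμ 2)
  have hdiv : (C + κ * C) * μ ^ 3 / (b / 2 * μ) + μ ^ 2 = C₁ * μ ^ 2 := by
    rw [hC₁]; field_simp
  rw [hdiv] at hz'
  have hx' : ∀ᶠ i in atTop, x i ≤ C₁ * μ ^ 2 := by
    filter_upwards [hz'] with i hi
    have := mul_nonneg (mul_pos hκ0 hμ).le (hy i)
    linarith
  have hy' : ∀ᶠ i in atTop, y (i + 1) ≤ (1 - (1 - ρ)) * y i +
      C * (1 + C₁ + C₁ / κ) * μ ^ 4 := by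
    filter_upwards [hz', hx'] with i hi hxi
    have h1 : x i ≤ C₁ := hxi.trans (mul_le_of_le_one_right hC₁0.le (pow_le_one₀ hμ.le hμ1.le))
    have h2 : y i ≤ C₁ / κ := by
      rw [le_div_iff₀ hκ0]
      have h3 : μ * (κ * y i) ≤ μ * (C₁ * μ) := by nlinarith [hx i]
      have h4 := le_of_mul_le_mul_left h3 hμ
      have h5 : C₁ * μ ≤ C₁ := mul_le_of_le_one_right hC₁0.le hμ1.le
      linarith
    have h3 : C * μ ^ 4 * (1 + x i + y i) ≤ C * μ ^ 4 * (1 + C₁ + C₁ / κ) := by gcongr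
    linarith [hyr i]
  have hy'' := eventually_le_of_recursion h1ρ (by linarith) hy' (pow_pos hμ 4)
  have hdiv2 : C * (1 + C₁ + C₁ / κ) * μ ^ 4 / (1 - ρ) + μ ^ 4 = C₂ * μ ^ 4 := by
    rw [hC₂]; field_simp
  rw [hdiv2] at hy''
  filter_upwards [hx', hy''] with i h1 h2
  exact ⟨h1.trans (by gcongr; exact le_max_left _ _), h2.trans (by gcongr; exact le_max_right _ _)⟩

/-- A linear recursion with contraction factor `1 - c μ` and drive `μ² Y + o(μ²)` ends up at
`μ Y / c + o(μ)`. -/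
lemma eventually_abs_div_sub_le {z : ℝ → ℕ → ℝ} {err : ℝ → ℝ} {c Y η : ℝ} (hc : 0 < c)
    (herr : Tendsto err (𝓝[>] 0) (𝓝 0))
    (hz : ∀ᶠ μ : ℝ in 𝓝[>] 0, ∀ᶠ i in atTop,
      |z μ (i + 1) - (1 - c * μ) * z μ i - μ ^ 2 * Y| ≤ μ ^ 2 * err μ) (hη : 0 < η) :
    ∀ᶠ μ : ℝ in 𝓝[>] 0, ∀ᶠ i in atTop, |z μ i / μ - Y / c| ≤ η := by
  have hμc : ∀ᶠ μ : ℝ in 𝓝[>] 0, c * μ < 1 := by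
    have h : Tendsto (fun μ : ℝ => c * μ) (𝓝 0) (𝓝 (c * 0)) := Continuous.tendsto (by fun_prop) 0
    rw [mul_zero] at h
    exact eventually_nhdsWithin_of_eventually_nhds (h.eventually (gt_mem_nhds zero_lt_one))
  filter_upwards [hz, hμc, self_mem_nhdsWithin,
    herr.eventually (gt_mem_nhds (show 0 < c * (η / 2) by positivity))] with μ hz hμc hμ he
  have hμ : 0 < μ := hμ
  have h1 := eventually_le_of_recursion (a := z μ) (b := μ ^ 2 * (Y + err μ)) (mul_pos hc hμ)
    hμc.le (by filter_upwards [hz] with i hi; linarith [(abs_le.1 hi).2])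
    (show 0 < μ * (η / 2) by positivity)
  have h2 := eventually_le_of_recursion (a := fun i => -z μ i) (b := μ ^ 2 * (-Y + err μ))
    (mul_pos hc hμ) hμc.le (by filter_upwards [hz] with i hi; linarith [(abs_le.1 hi).1])
    (show 0 < μ * (η / 2) by positivity)
  have he' : err μ / c ≤ η / 2 := by
    rw [div_le_iff₀ hc]
    linarith
  filter_upwards [h1, h2] with i h1 h2
  have e1 : μ ^ 2 * (Y + err μ) / (c * μ) + μ * (η / 2) = μ * (Y / c + err μ / c + η / 2) := by
    field_simp
  have e2 : μ ^ 2 * (-Y + err μ) / (c * μ) + μ * (η / 2) = μ * (-(Y / c) + err μ / c + η / 2) := by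
    field_simp
  rw [e1] at h1
  rw [e2] at h2
  have hzi : z μ i = μ * (z μ i / μ) := by field_simp
  rw [hzi] at h1 h2
  rw [← mul_neg] at h2
  have h3 := le_of_mul_le_mul_left h1 hμ
  have h4 := le_of_mul_le_mul_left h2 hμ
  rw [abs_le]
  constructor <;> linarith

end Recursions

/-! ### Moment recursions for one noisy step -/

section NoisyStep

/-- Convexity of the fourth power. -/
lemma add_mul_pow_four_le {c x y : ℝ} (hc0 : 0 ≤ c) (hc1 : c ≤ 1) :
    ((1 - c) * x + c * y) ^ 4 ≤ (1 - c) * x ^ 4 + c * y ^ 4 := by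
  have h := (Even.convexOn_pow (𝕜 := ℝ) (n := 4) (by decide)).2 (Set.mem_univ x) (Set.mem_univ y)
    (sub_nonneg.2 hc1) hc0 (by ring)
  simpa using h

variable {M : ℕ} {Ω : Type*} [MeasurableSpace Ω]

lemma integrable_norm_pow_four {E : Type*} [NormedAddCommGroup E] {P : Measure Ω}
    {f : Ω → E} (hf : MemLp f 4 P) : Integrable (fun ω => ‖f ω‖ ^ 4) P := by
  have h : MemLp f ((4 : ℕ) : ℝ≥0∞) P := by exact_mod_cast hf
  exact h.integrable_norm_pow (by norm_num)

lemma integrable_pow_four {P : Measure Ω} {f : Ω → ℝ} (hf : MemLp f 4 P) :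
    Integrable (fun ω => f ω ^ 4) P := by
  simpa [Even.pow_abs (show Even 4 by decide)] using integrable_norm_pow_four hf

lemma integrable_scaled {P : Measure Ω} [IsProbabilityMeasure P] {H S : Ω → ℝ} (hH : MemLp H 4 P)
    (hS : MemLp S 4 P) (μ : ℝ) :
    Integrable (fun ω => 1 + H ω ^ 4 / μ ^ 2 + S ω ^ 4 / μ ^ 4) P :=
  ((integrable_const _).add ((integrable_pow_four hH).div_const _)).add
    ((integrable_pow_four hS).div_const _)

lemma integral_scaled {P : Measure Ω} [IsProbabilityMeasure P] {H S : Ω → ℝ} (hH : MemLp H 4 P)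
    (hS : MemLp S 4 P) (μ : ℝ) :
    ∫ ω, (1 + H ω ^ 4 / μ ^ 2 + S ω ^ 4 / μ ^ 4) ∂P =
      1 + (∫ ω, H ω ^ 4 ∂P) / μ ^ 2 + (∫ ω, S ω ^ 4 ∂P) / μ ^ 4 := by
  have i1 := (integrable_pow_four hH).div_const (μ ^ 2)
  have i2 := (integrable_pow_four hS).div_const (μ ^ 4)
  have i3 : Integrable (fun ω => 1 + H ω ^ 4 / μ ^ 2) P := (integrable_const _).add i1
  rw [integral_add i3 i2, integral_add (integrable_const _) i1, integral_div, integral_div]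
  simp

/-- Unscaled fourth moments are dominated by those in units of `μ ^ 2` and `μ ^ 4`. -/
lemma one_add_le_scaled {μ x y : ℝ} (hμ : 0 < μ) (hμ1 : μ ≤ 1) (hx : 0 ≤ x) (hy : 0 ≤ y) :
    1 + x + y ≤ 1 + x / μ ^ 2 + y / μ ^ 4 := by
  have h1 : x ≤ x / μ ^ 2 := by
    rw [le_div_iff₀ (by positivity)]
    exact mul_le_of_le_one_right hx (pow_le_one₀ hμ.le hμ1)
  have h2 : y ≤ y / μ ^ 4 := by
    rw [le_div_iff₀ (by positivity)]
    exact mul_le_of_le_one_right hy (pow_le_one₀ hμ.le hμ1)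
  linarith

/-- The bounds that turn products of the normalized sizes `H / √μ` and `S / μ` into fourth
moments. -/
lemma scaled_bounds {μ H S : ℝ} (hμ : 0 < μ) (hμ1 : μ ≤ 1) (hH : 0 ≤ H) (hS : 0 ≤ S) :
    H * S ≤ μ * √μ * (1 + H ^ 4 / μ ^ 2 + S ^ 4 / μ ^ 4) ∧
    H ^ 3 ≤ μ * √μ * (1 + H ^ 4 / μ ^ 2 + S ^ 4 / μ ^ 4) ∧
    H ^ 2 ≤ μ * (1 + H ^ 4 / μ ^ 2 + S ^ 4 / μ ^ 4) ∧
    H ^ 4 ≤ μ ^ 2 * (1 + H ^ 4 / μ ^ 2 + S ^ 4 / μ ^ 4) ∧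
    S ^ 2 ≤ μ ^ 2 * (1 + H ^ 4 / μ ^ 2 + S ^ 4 / μ ^ 4) ∧
    S ^ 3 ≤ μ * √μ * (1 + H ^ 4 / μ ^ 2 + S ^ 4 / μ ^ 4) ∧
    S ^ 4 ≤ μ ^ 4 * (1 + H ^ 4 / μ ^ 2 + S ^ 4 / μ ^ 4) := by
  obtain ⟨r, hr, rfl⟩ : ∃ r : ℝ, 0 < r ∧ μ = r ^ 2 := ⟨√μ, Real.sqrt_pos.2 hμ,
    (Real.sq_sqrt hμ.le).symm⟩
  obtain ⟨t, ht, rfl⟩ : ∃ t : ℝ, 0 ≤ t ∧ H = r * t := ⟨H / r, by positivity, by field_simp⟩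
  obtain ⟨s, hs, rfl⟩ : ∃ s : ℝ, 0 ≤ s ∧ S = r ^ 2 * s := ⟨S / r ^ 2, by positivity, by field_simp⟩
  have hB : 1 + (r * t) ^ 4 / (r ^ 2) ^ 2 + (r ^ 2 * s) ^ 4 / (r ^ 2) ^ 4 = 1 + t ^ 4 + s ^ 4 := by
    field_simp
  rw [hB, Real.sqrt_sq hr.le]
  have hr1 : r ≤ 1 := by nlinarith
  have ht4 : 0 ≤ t ^ 4 := by positivity
  have hs4 : 0 ≤ s ^ 4 := by positivity
  have ht2 : t ^ 2 ≤ 1 + t ^ 4 := by nlinarith [sq_nonneg (t ^ 2 - 1), sq_nonneg (t ^ 2)]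
  have hs2 : s ^ 2 ≤ 1 + s ^ 4 := by nlinarith [sq_nonneg (s ^ 2 - 1), sq_nonneg (s ^ 2)]
  have ht3 : t ^ 3 ≤ 1 + t ^ 4 := by nlinarith [sq_nonneg (t ^ 2 - t), sq_nonneg t]
  have hs3 : s ^ 3 ≤ 1 + s ^ 4 := by nlinarith [sq_nonneg (s ^ 2 - s), sq_nonneg s]
  have hts : t * s ≤ 1 + t ^ 4 + s ^ 4 := by
    nlinarith [sq_nonneg (t - s), sq_nonneg (t ^ 2 - 1), sq_nonneg (s ^ 2 - 1)]
  refine ⟨?_, ?_, ?_, ?_, ?_, ?_, ?_⟩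
  · calc r * t * (r ^ 2 * s) = r ^ 2 * r * (t * s) := by ring
      _ ≤ _ := by gcongr
  · calc (r * t) ^ 3 = r ^ 2 * r * t ^ 3 := by ring
      _ ≤ _ := by gcongr; linarith
  · calc (r * t) ^ 2 = r ^ 2 * t ^ 2 := by ring
      _ ≤ _ := by gcongr; linarith
  · calc (r * t) ^ 4 = (r ^ 2) ^ 2 * t ^ 4 := by ring
      _ ≤ _ := by gcongr; linarith
  · calc (r ^ 2 * s) ^ 2 = (r ^ 2) ^ 2 * s ^ 2 := by ring
      _ ≤ _ := by gcongr; linarith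
  · calc (r ^ 2 * s) ^ 3 = r ^ 2 * r * (r ^ 3 * s ^ 3) := by ring
      _ ≤ r ^ 2 * r * (1 * (1 + t ^ 4 + s ^ 4)) := by
        gcongr
        · exact pow_le_one₀ hr.le hr1
        · linarith
      _ = _ := by ring
  · calc (r ^ 2 * s) ^ 4 = (r ^ 2) ^ 4 * s ^ 4 := by ring
      _ ≤ _ := by gcongr; linarith

/-- The square of a quantity `x` of the order `√μ` after a contraction step `b` that is exact up to
`K μ (S + H ^ 2)`: the error is of the order `μ ^ 2 * √μ`, which is negligible against the noise
variance of the order `μ ^ 2`. -/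
lemma abs_sq_sub_drift_le {μ H S x b q K : ℝ} (hμ : 0 < μ) (hμ1 : μ ≤ 1)
    (hH : 0 ≤ H) (hS : 0 ≤ S) (hK : 0 ≤ K) (hx : |x| ≤ H) (hq0 : 0 ≤ q) (hq1 : q * μ ≤ 1)
    (hb : |b - (1 - q * μ) * x| ≤ K * μ * (S + H ^ 2)) :
    |b ^ 2 - (1 - 2 * q * μ) * x ^ 2| ≤
      (q ^ 2 + 4 * K + 4 * K ^ 2) * (μ ^ 2 * √μ) * (1 + H ^ 4 / μ ^ 2 + S ^ 4 / μ ^ 4) := by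
  obtain ⟨h1, h2, h3, h4, h5, -, -⟩ := scaled_bounds hμ hμ1 hH hS
  set B := 1 + H ^ 4 / μ ^ 2 + S ^ 4 / μ ^ 4 with hB
  have hB0 : 0 ≤ B := by positivity
  set R := b - (1 - q * μ) * x with hR
  have hbR : b = (1 - q * μ) * x + R := by rw [hR]; ring
  have hsq : √μ ≤ 1 := Real.sqrt_le_one.2 hμ1
  have hμs : μ ≤ √μ := by
    nlinarith [Real.sq_sqrt hμ.le, Real.sqrt_nonneg μ]
  have e1 : |b ^ 2 - (1 - 2 * q * μ) * x ^ 2| ≤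
      q ^ 2 * μ ^ 2 * H ^ 2 + 2 * (H * |R|) + |R| ^ 2 := by
    have : b ^ 2 - (1 - 2 * q * μ) * x ^ 2 =
        q ^ 2 * μ ^ 2 * x ^ 2 + 2 * ((1 - q * μ) * x * R) + R ^ 2 := by rw [hbR]; ring
    rw [this]
    refine (abs_add_three _ _ _).trans ?_
    have hx2 : x ^ 2 ≤ H ^ 2 := by rw [← sq_abs]; gcongr
    have a1 : |q ^ 2 * μ ^ 2 * x ^ 2| ≤ q ^ 2 * μ ^ 2 * H ^ 2 := by
      rw [abs_of_nonneg (by positivity)]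
      gcongr
    have a2 : |2 * ((1 - q * μ) * x * R)| ≤ 2 * (H * |R|) := by
      rw [abs_mul, abs_mul, abs_mul, abs_two, abs_of_nonneg (sub_nonneg.2 hq1)]
      have : (1 - q * μ) * |x| ≤ 1 * H := by
        gcongr
        have := mul_nonneg hq0 hμ.le
        linarith
      rw [one_mul] at this
      gcongr
    have a3 : |R ^ 2| = |R| ^ 2 := abs_pow _ _
    linarith
  have e2 : q ^ 2 * μ ^ 2 * H ^ 2 ≤ q ^ 2 * (μ ^ 2 * √μ) * B := by
    calc q ^ 2 * μ ^ 2 * H ^ 2 ≤ q ^ 2 * μ ^ 2 * (√μ * B) := by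
          gcongr
          exact h3.trans (by gcongr)
      _ = _ := by ring
  have e3 : H * |R| ≤ 2 * K * (μ ^ 2 * √μ) * B := by
    calc H * |R| ≤ H * (K * μ * (S + H ^ 2)) := by gcongr
      _ = K * μ * (H * S + H ^ 3) := by ring
      _ ≤ K * μ * (μ * √μ * B + μ * √μ * B) := by gcongr
      _ = _ := by ring
  have e4 : |R| ^ 2 ≤ 4 * K ^ 2 * (μ ^ 2 * √μ) * B := by
    calc |R| ^ 2 ≤ (K * μ * (S + H ^ 2)) ^ 2 := by gcongr
      _ = K ^ 2 * μ ^ 2 * (S + H ^ 2) ^ 2 := by ring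
      _ ≤ K ^ 2 * μ ^ 2 * (2 * (S ^ 2 + H ^ 4)) := by
          gcongr
          nlinarith [sq_nonneg (S - H ^ 2)]
      _ ≤ K ^ 2 * μ ^ 2 * (2 * (μ ^ 2 * B + μ ^ 2 * B)) := by gcongr
      _ = 4 * K ^ 2 * (μ ^ 2 * μ ^ 2) * B := by ring
      _ ≤ 4 * K ^ 2 * (μ ^ 2 * √μ) * B := by
          gcongr
          calc μ ^ 2 ≤ μ := by nlinarith
            _ ≤ √μ := hμs
  linarith

/-- Expansion of a fourth power with the first-order term kept exactly, since its mean vanishes when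
`n` is centred noise; the second-order terms are distributed by Young's inequality. -/
lemma norm_sub_pow_four_le {E : Type*} [NormedAddCommGroup E] [InnerProductSpace ℝ E] (u n : E)
    {c : ℝ} (hc : 0 < c) :
    ‖u - n‖ ^ 4 ≤ (1 + c) * ‖u‖ ^ 4 - 4 * (‖u‖ ^ 2 * inner ℝ u n) + (16 / c + 3) * ‖n‖ ^ 4 := by
  have h1 : ‖u - n‖ ^ 4 = (‖u‖ ^ 2 - 2 * inner ℝ u n + ‖n‖ ^ 2) ^ 2 := by
    rw [← norm_sub_sq_real]
    ring
  have h2 : inner ℝ u n ^ 2 ≤ ‖u‖ ^ 2 * ‖n‖ ^ 2 := by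
    rw [← mul_pow, ← sq_abs]
    exact pow_le_pow_left₀ (abs_nonneg _) (abs_real_inner_le_norm u n) 2
  have h3 : 8 * (‖u‖ ^ 2 * ‖n‖ ^ 2) ≤ c * ‖u‖ ^ 4 + 16 / c * ‖n‖ ^ 4 := by
    have h4 : c * ‖u‖ ^ 4 + 16 / c * ‖n‖ ^ 4 - 8 * (‖u‖ ^ 2 * ‖n‖ ^ 2) =
        (c * ‖u‖ ^ 2 - 4 * ‖n‖ ^ 2) ^ 2 / c := by
      field_simp
      ring
    have h5 : 0 ≤ (c * ‖u‖ ^ 2 - 4 * ‖n‖ ^ 2) ^ 2 / c := by positivity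
    linarith
  rw [h1]
  nlinarith [sq_nonneg (inner ℝ u n + ‖n‖ ^ 2)]

/-- One step of the diffusion strategy, seen through the centroid error `h` and the disagreement
`S`, with new values `h' = u - n` and `S'`. Here `u` is what the step does in the mean, `n` is
conditionally centred noise, `A` controls the sizes of all gradients, `q₀` is the effective
step-size divided by `μ`, and `μ ^ 2 * Y j` is the approximate variance of the noise in the
eigendirection `e j` of the Hessian matrix. -/
structure NoisyStep (P : Measure Ω) (e : OrthonormalBasis (Fin M) ℝ (Vec M)) (lam : Fin M → ℝ)
    (a ρ K q₀ μ err : ℝ) (Y : Fin M → ℝ) (h h' u n : Ω → Vec M) (S S' A : Ω → ℝ) : Prop where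
  memLp_h : MemLp h 4 P
  memLp_u : MemLp u 4 P
  memLp_n : MemLp n 4 P
  memLp_S : MemLp S 4 P
  memLp_S' : MemLp S' 4 P
  memLp_A : MemLp A 4 P
  S_nonneg : ∀ ω, 0 ≤ S ω
  S'_nonneg : ∀ ω, 0 ≤ S' ω
  eq_sub : ∀ ω, h' ω = u ω - n ω
  S'_le : ∀ ω, S' ω ≤ ρ * S ω + μ * K * A ω
  norm_n_le : ∀ ω, ‖n ω‖ ≤ μ * K * A ω
  norm_u_le : ∀ ω, ‖u ω‖ ≤ (1 - a * μ) * ‖h ω‖ + K * μ * S ω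
  inner_u : ∀ j ω, |inner ℝ (e j) (u ω) - (1 - q₀ * μ * lam j) * inner ℝ (e j) (h ω)| ≤
    K * μ * (S ω + ‖h ω‖ ^ 2)
  moment_A : ∫ ω, A ω ^ 4 ∂P ≤ K * (1 + ∫ ω, ‖h ω‖ ^ 4 ∂P + ∫ ω, S ω ^ 4 ∂P)
  centred : ∫ ω, ‖u ω‖ ^ 2 * inner ℝ (u ω) (n ω) ∂P = 0
  centred_inner : ∀ j, ∫ ω, inner ℝ (e j) (u ω) * inner ℝ (e j) (n ω) ∂P = 0
  variance : ∀ j, |∫ ω, inner ℝ (e j) (n ω) ^ 2 ∂P - μ ^ 2 * Y j| ≤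
    K * μ ^ 2 * err * (1 + (∫ ω, ‖h ω‖ ^ 4 ∂P) / μ ^ 2 + (∫ ω, S ω ^ 4 ∂P) / μ ^ 4)

namespace NoisyStep

variable {P : Measure Ω} {e : OrthonormalBasis (Fin M) ℝ (Vec M)}
  {lam : Fin M → ℝ} {a ρ K q₀ μ err : ℝ} {Y : Fin M → ℝ} {h h' u n : Ω → Vec M} {S S' A : Ω → ℝ}

lemma integral_S'_le (st : NoisyStep P e lam a ρ K q₀ μ err Y h h' u n S S' A)
    (hρ0 : 0 ≤ ρ) (hρ1 : ρ < 1) :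
    ∫ ω, S' ω ^ 4 ∂P ≤ ρ * ∫ ω, S ω ^ 4 ∂P + K ^ 5 / (1 - ρ) ^ 3 * μ ^ 4 *
      (1 + ∫ ω, ‖h ω‖ ^ 4 ∂P + ∫ ω, S ω ^ 4 ∂P) := by
  have h1ρ : 0 < 1 - ρ := by linarith
  have hpt : ∀ ω, S' ω ^ 4 ≤ ρ * S ω ^ 4 + K ^ 4 / (1 - ρ) ^ 3 * μ ^ 4 * A ω ^ 4 := by
    intro ω
    have h1 : S' ω ≤ (1 - (1 - ρ)) * S ω + (1 - ρ) * (μ * K * A ω / (1 - ρ)) := by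
      rw [mul_div_cancel₀ _ h1ρ.ne']
      simpa using st.S'_le ω
    refine (pow_le_pow_left₀ (st.S'_nonneg ω) h1 4).trans
      ((add_mul_pow_four_le h1ρ.le (by linarith)).trans (le_of_eq ?_))
    field_simp
    ring
  have hS := (integrable_pow_four st.memLp_S).const_mul ρ
  have hA := (integrable_pow_four st.memLp_A).const_mul (K ^ 4 / (1 - ρ) ^ 3 * μ ^ 4)
  have h2 := integral_mono (integrable_pow_four st.memLp_S') (hS.add hA) hpt
  simp only [Pi.add_apply] at h2
  rw [integral_add hS hA, integral_const_mul, integral_const_mul] at h2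
  have h3 := mul_le_mul_of_nonneg_left st.moment_A
    (show 0 ≤ K ^ 4 / (1 - ρ) ^ 3 * μ ^ 4 by positivity)
  have h4 : K ^ 4 / (1 - ρ) ^ 3 * μ ^ 4 *
      (K * (1 + ∫ ω, ‖h ω‖ ^ 4 ∂P + ∫ ω, S ω ^ 4 ∂P)) = K ^ 5 / (1 - ρ) ^ 3 * μ ^ 4 *
      (1 + ∫ ω, ‖h ω‖ ^ 4 ∂P + ∫ ω, S ω ^ 4 ∂P) := by ring
  linarith

/-- The recursion of the fourth moment of the centroid error. The noise has size `μ` but is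
weighted by `1 / μ` in Young's inequality, whence the drive `μ ^ 3`. -/
lemma integral_h'_le (st : NoisyStep P e lam a ρ K q₀ μ err Y h h' u n S S' A)
    (ha : 0 < a) (hμ : 0 < μ) (hμ1 : μ ≤ 1) (haμ : a * μ ≤ 1) :
    ∫ ω, ‖h' ω‖ ^ 4 ∂P ≤ (1 - a / 2 * μ) * ∫ ω, ‖h ω‖ ^ 4 ∂P
      + 2 * (a * (K / a) ^ 4) * μ * ∫ ω, S ω ^ 4 ∂P
      + (64 / a + 3) * K ^ 5 * μ ^ 3 * (1 + ∫ ω, ‖h ω‖ ^ 4 ∂P + ∫ ω, S ω ^ 4 ∂P) := by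
  have haμ0 : 0 < a * μ := by positivity
  have hpt : ∀ ω, ‖h' ω‖ ^ 4 ≤ (1 - a / 2 * μ) * ‖h ω‖ ^ 4 + 2 * (a * (K / a) ^ 4) * μ * S ω ^ 4
      + (64 / a + 3) * K ^ 4 * μ ^ 3 * A ω ^ 4 - 4 * (‖u ω‖ ^ 2 * inner ℝ (u ω) (n ω)) := by
    intro ω
    rw [st.eq_sub]
    have h1 := norm_sub_pow_four_le (u ω) (n ω) (show 0 < a * μ / 4 by positivity)
    have h2 : ‖u ω‖ ^ 4 ≤ (1 - a * μ) * ‖h ω‖ ^ 4 + a * μ * (K / a * S ω) ^ 4 := by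
      have h3 : ‖u ω‖ ≤ (1 - a * μ) * ‖h ω‖ + a * μ * (K / a * S ω) := by
        have h4 : a * μ * (K / a * S ω) = K * μ * S ω := by field_simp
        rw [h4]
        exact st.norm_u_le ω
      exact (pow_le_pow_left₀ (norm_nonneg _) h3 4).trans (add_mul_pow_four_le haμ0.le haμ)
    have h5 : (1 + a * μ / 4) * ‖u ω‖ ^ 4 ≤
        (1 - a / 2 * μ) * ‖h ω‖ ^ 4 + 2 * (a * (K / a) ^ 4) * μ * S ω ^ 4 := by
      have h6 := mul_le_mul_of_nonneg_left h2 (show 0 ≤ 1 + a * μ / 4 by positivity)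
      have h7 : (1 + a * μ / 4) * (1 - a * μ) ≤ 1 - a / 2 * μ := by nlinarith
      have h8 : 1 + a * μ / 4 ≤ 2 := by linarith
      have h9 := mul_le_mul_of_nonneg_right h7 (show 0 ≤ ‖h ω‖ ^ 4 by positivity)
      have h10 := mul_le_mul_of_nonneg_right h8
        (show 0 ≤ a * μ * (K / a * S ω) ^ 4 by have := st.S_nonneg ω; positivity)
      linear_combination h6 + h9 + h10
    have h11 : (16 / (a * μ / 4) + 3) * ‖n ω‖ ^ 4 ≤ (64 / a + 3) * K ^ 4 * μ ^ 3 * A ω ^ 4 := by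
      have h12 := pow_le_pow_left₀ (norm_nonneg _) (st.norm_n_le ω) 4
      have h13 : (16 / (a * μ / 4) + 3) * (μ * K * A ω) ^ 4 =
          (64 / a + 3 * μ) * K ^ 4 * μ ^ 3 * A ω ^ 4 := by
        field_simp
        ring
      refine (mul_le_mul_of_nonneg_left h12 (by positivity)).trans (h13.le.trans ?_)
      have : 3 * μ ≤ 3 := by linarith
      gcongr
    linarith
  have hh := integrable_norm_pow_four st.memLp_h
  have hu := integrable_norm_pow_four st.memLp_u
  have hn := integrable_norm_pow_four st.memLp_n
  have hun : Integrable (fun ω => ‖u ω‖ ^ 2 * inner ℝ (u ω) (n ω)) P := by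
    refine Integrable.mono' (hu.add hn) ((st.memLp_u.1.norm.pow 2).mul
      (st.memLp_u.1.inner st.memLp_n.1)) (Eventually.of_forall fun ω => ?_)
    rw [norm_mul, Real.norm_of_nonneg (by positivity : 0 ≤ ‖u ω‖ ^ 2), Real.norm_eq_abs]
    have h1 := mul_le_mul_of_nonneg_left (abs_real_inner_le_norm (u ω) (n ω))
      (by positivity : 0 ≤ ‖u ω‖ ^ 2)
    refine h1.trans ?_
    simp only [Pi.add_apply]
    nlinarith [sq_nonneg (‖u ω‖ ^ 2 - ‖u ω‖ * ‖n ω‖), sq_nonneg (‖u ω‖ ^ 2 - ‖n ω‖ ^ 2),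
      sq_nonneg (‖u ω‖ ^ 2), sq_nonneg (‖n ω‖ ^ 2)]
  have hh' : Integrable (fun ω => ‖h' ω‖ ^ 4) P := by
    have : h' = u - n := funext st.eq_sub
    rw [this]
    exact integrable_norm_pow_four (st.memLp_u.sub st.memLp_n)
  have i1 := hh.const_mul (1 - a / 2 * μ)
  have i2 := (integrable_pow_four st.memLp_S).const_mul (2 * (a * (K / a) ^ 4) * μ)
  have i3 := (integrable_pow_four st.memLp_A).const_mul ((64 / a + 3) * K ^ 4 * μ ^ 3)
  have i4 := hun.const_mul 4
  have h2 := integral_mono hh' (((i1.add i2).add i3).sub i4) hpt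
  rw [integral_sub' ((i1.add i2).add i3) i4, integral_add' (i1.add i2) i3, integral_add' i1 i2,
    integral_const_mul, integral_const_mul, integral_const_mul, integral_const_mul, st.centred]
    at h2
  have h4 := mul_le_mul_of_nonneg_left st.moment_A
    (show 0 ≤ (64 / a + 3) * K ^ 4 * μ ^ 3 by positivity)
  linarith

/-- The recursion of the second moment in an eigendirection: contraction by `1 - 2 q₀ (lam j) μ`,
drive `μ ^ 2 * Y j`, and an error of smaller order as long as the scaled fourth moments stay bounded. -/
lemma abs_integral_inner_sq_le (st : NoisyStep P e lam a ρ K q₀ μ err Y h h' u n S S' A)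
    [IsProbabilityMeasure P] (hμ : 0 < μ) (hμ1 : μ ≤ 1) (hK : 0 ≤ K) (hq : 0 ≤ q₀)
    (herr : √μ ≤ err) (j : Fin M) (hlam : 0 ≤ lam j) (hq1 : q₀ * lam j * μ ≤ 1) :
    |∫ ω, inner ℝ (e j) (h' ω) ^ 2 ∂P - (1 - 2 * (q₀ * lam j) * μ) *
      ∫ ω, inner ℝ (e j) (h ω) ^ 2 ∂P - μ ^ 2 * Y j| ≤
    ((q₀ * lam j) ^ 2 + 5 * K + 4 * K ^ 2) * (μ ^ 2 * err) *
      (1 + (∫ ω, ‖h ω‖ ^ 4 ∂P) / μ ^ 2 + (∫ ω, S ω ^ 4 ∂P) / μ ^ 4) := by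
  have hint : ∀ f : Ω → Vec M, MemLp f 4 P → Integrable (fun ω => inner ℝ (e j) (f ω) ^ 2) P := by
    intro f hf
    have h2 : MemLp f 2 P := hf.mono_exponent (by norm_num)
    exact (h2.const_inner (e j)).integrable_sq
  have hnorm : ∀ v, |inner ℝ (e j) v| ≤ ‖v‖ := fun v => by
    simpa [e.orthonormal.1 j] using abs_real_inner_le_norm (e j) v
  have hprod : Integrable (fun ω => inner ℝ (e j) (u ω) * inner ℝ (e j) (n ω)) P := by
    have h1 : MemLp u 2 P := st.memLp_u.mono_exponent (by norm_num)
    have h2 : MemLp n 2 P := st.memLp_n.mono_exponent (by norm_num)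
    exact (h1.const_inner (e j)).integrable_mul (h2.const_inner (e j))
  have hsplit : ∫ ω, inner ℝ (e j) (h' ω) ^ 2 ∂P =
      ∫ ω, inner ℝ (e j) (u ω) ^ 2 ∂P + ∫ ω, inner ℝ (e j) (n ω) ^ 2 ∂P := by
    have h1 : ∀ ω, inner ℝ (e j) (h' ω) ^ 2 = inner ℝ (e j) (u ω) ^ 2 +
        inner ℝ (e j) (n ω) ^ 2 - 2 * (inner ℝ (e j) (u ω) * inner ℝ (e j) (n ω)) := by
      intro ω
      rw [st.eq_sub, inner_sub_right]
      ring
    simp only [h1]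
    have h2 : Integrable (fun ω => inner ℝ (e j) (u ω) ^ 2 + inner ℝ (e j) (n ω) ^ 2) P :=
      (hint u st.memLp_u).add (hint n st.memLp_n)
    rw [integral_sub h2 (hprod.const_mul 2),
      integral_add (hint u st.memLp_u) (hint n st.memLp_n), integral_const_mul,
      st.centred_inner j]
    ring
  have hdrift : |∫ ω, inner ℝ (e j) (u ω) ^ 2 ∂P - (1 - 2 * (q₀ * lam j) * μ) *
      ∫ ω, inner ℝ (e j) (h ω) ^ 2 ∂P| ≤
      ((q₀ * lam j) ^ 2 + 4 * K + 4 * K ^ 2) * (μ ^ 2 * √μ) *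
      (1 + (∫ ω, ‖h ω‖ ^ 4 ∂P) / μ ^ 2 + (∫ ω, S ω ^ 4 ∂P) / μ ^ 4) := by
    rw [← integral_const_mul, ← integral_sub (hint u st.memLp_u)
      ((hint h st.memLp_h).const_mul _), ← integral_scaled st.memLp_h.norm st.memLp_S μ,
      ← integral_const_mul]
    refine (abs_integral_le_integral_abs).trans (integral_mono_of_nonneg
      (Eventually.of_forall fun _ => abs_nonneg _)
      ((integrable_scaled st.memLp_h.norm st.memLp_S μ).const_mul _)
      (Eventually.of_forall fun ω => ?_))
    refine abs_sq_sub_drift_le hμ hμ1 (norm_nonneg _) (st.S_nonneg ω) hK (hnorm _) (by positivity)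
      hq1 ?_
    have := st.inner_u j ω
    rwa [mul_right_comm q₀ μ] at this
  have hB : 0 ≤ 1 + (∫ ω, ‖h ω‖ ^ 4 ∂P) / μ ^ 2 + (∫ ω, S ω ^ 4 ∂P) / μ ^ 4 := by
    have h1 : 0 ≤ ∫ ω, ‖h ω‖ ^ 4 ∂P := integral_nonneg fun _ => by positivity
    have h2 : 0 ≤ ∫ ω, S ω ^ 4 ∂P := integral_nonneg fun ω => by
      have := st.S_nonneg ω
      positivity
    positivity
  have hdrift' := hdrift.trans (show _ ≤ ((q₀ * lam j) ^ 2 + 4 * K + 4 * K ^ 2) * (μ ^ 2 * err) *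
      (1 + (∫ ω, ‖h ω‖ ^ 4 ∂P) / μ ^ 2 + (∫ ω, S ω ^ 4 ∂P) / μ ^ 4) by gcongr)
  have hvar := st.variance j
  rw [hsplit]
  have habs := abs_add_le (∫ ω, inner ℝ (e j) (u ω) ^ 2 ∂P - (1 - 2 * (q₀ * lam j) * μ) *
      ∫ ω, inner ℝ (e j) (h ω) ^ 2 ∂P) (∫ ω, inner ℝ (e j) (n ω) ^ 2 ∂P - μ ^ 2 * Y j)
  have hre : ∫ ω, inner ℝ (e j) (u ω) ^ 2 ∂P + ∫ ω, inner ℝ (e j) (n ω) ^ 2 ∂P -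
      (1 - 2 * (q₀ * lam j) * μ) * ∫ ω, inner ℝ (e j) (h ω) ^ 2 ∂P - μ ^ 2 * Y j =
      (∫ ω, inner ℝ (e j) (u ω) ^ 2 ∂P - (1 - 2 * (q₀ * lam j) * μ) *
      ∫ ω, inner ℝ (e j) (h ω) ^ 2 ∂P) + (∫ ω, inner ℝ (e j) (n ω) ^ 2 ∂P - μ ^ 2 * Y j) := by
    ring
  rw [hre]
  refine habs.trans ((add_le_add hdrift' hvar).trans (le_of_eq ?_))
  ring

end NoisyStep

end NoisyStep

/-! ### Measurability and moments of the iterates -/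

lemma abs_apply_le_norm {M : ℕ} (v : Vec M) (m : Fin M) : |v m| ≤ ‖v‖ := by
  simpa using PiLp.norm_apply_le v m

lemma memLp_apply {M : ℕ} {Ω : Type*} [MeasurableSpace Ω] {P : Measure Ω}
    {f : Ω → Vec M} {p : ℝ≥0∞} (hf : MemLp f p P) (m : Fin M) :
    MemLp (fun ω => f ω m) p P :=
  hf.mono ((EuclideanSpace.proj (𝕜 := ℝ) m).continuous.comp_aestronglyMeasurable hf.1)
    (Eventually.of_forall fun ω => abs_apply_le_norm (f ω) m)

lemma norm_mask_le {M : ℕ} {c : Fin M → ℝ} {b : ℝ} (hb : 0 ≤ b) (hc : ∀ m, |c m| ≤ b) (v : Vec M) :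
    ‖mask c v‖ ≤ b * ‖v‖ := by
  refine le_of_sq_le_sq ?_ (by positivity)
  rw [mul_pow, EuclideanSpace.real_norm_sq_eq, EuclideanSpace.real_norm_sq_eq, Finset.mul_sum]
  refine Finset.sum_le_sum fun m _ => ?_
  simp only [mask, mul_pow]
  have := hc m
  rw [← sq_abs (c m)]
  gcongr

lemma norm_mask_le_of_zero_or_one {M : ℕ} {c : Fin M → ℝ} (hc : ∀ m, c m = 0 ∨ c m = 1)
    (v : Vec M) : ‖mask c v‖ ≤ ‖v‖ := by
  simpa using norm_mask_le zero_le_one (fun m => by rcases hc m with h | h <;> simp [h]) v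

namespace Model

variable {N M : ℕ} {Ω : Type*}

/-- The intermediate vectors `φ_{k,i}`, at which the approximate gradients are evaluated. -/
noncomputable def combined (D : Model N M Ω) (μ : ℝ) (i : ℕ) (k : Fin N) (ω : Ω) : Vec M :=
  combine D.A₁ (fun l => D.iterate μ i l ω) k

/-- The masked approximate gradients. -/
noncomputable def partialGrad (D : Model N M Ω) (μ : ℝ) (i : ℕ) (k : Fin N) (ω : Ω) : Vec M :=
  mask (fun m => D.ind i k m ω) (D.gradHat i k (D.combined μ i k ω) ω)

lemma iterate_succ (D : Model N M Ω) (μ : ℝ) (i : ℕ) (k : Fin N) (ω : Ω) :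
    D.iterate μ (i + 1) k ω =
      combine D.A₂ (fun l => D.combined μ i l ω - (μ * D.τ l) • D.partialGrad μ i l ω) k := rfl

lemma measurable_iterate_past (D : Model N M Ω) (μ : ℝ) (i : ℕ) (k : Fin N) :
    Measurable[D.past μ i] (D.iterate μ i k) := by
  refine Measurable.of_comap_le (le_trans ?_ le_sup_left)
  exact le_iSup_of_le k (le_iSup_of_le i (le_iSup_of_le le_rfl le_rfl))

lemma measurable_combined_past (D : Model N M Ω) (μ : ℝ) (i : ℕ) (k : Fin N) :
    Measurable[D.past μ i] (D.combined μ i k) := by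
  unfold combined combine
  exact Finset.measurable_fun_sum _ fun l _ =>
    (D.measurable_iterate_past μ i l).const_smul (D.A₁ l k)

/-- The events determined by the past together with the approximate gradients of all agents at the
present time; the present indicators are independent of them. -/
@[reducible] noncomputable def present (D : Model N M Ω) (μ : ℝ) (i : ℕ) :
    MeasurableSpace Ω :=
  D.past μ i ⊔ ⨆ k : Fin N,
    MeasurableSpace.comap (fun ω => D.gradHat i k (D.combined μ i k ω) ω) inferInstance

lemma measurable_ind_iSup (D : Model N M Ω) (i : ℕ) (k : Fin N) (m : Fin M) :
    Measurable[⨆ k : Fin N, ⨆ m : Fin M,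
      MeasurableSpace.comap (D.ind i k m) inferInstance] (D.ind i k m) :=
  Measurable.of_comap_le (le_iSup_of_le k (le_iSup_of_le m le_rfl))

/-- The conditions that hold for one fixed small step-size `μ`, in the case of a common cost `J`
with second-order information as in `QuadraticApprox`. The matrix `G` is the second-order moment of
the gradient noise at the minimizer. -/
structure StandingConditions [MeasurableSpace Ω] (D : Model N M Ω) (P : Measure Ω)
    (J : Vec M → ℝ) (ν δ K : ℝ) (e : OrthonormalBasis (Fin M) ℝ (Vec M)) (lam : Fin M → ℝ)
    (G : Matrix (Fin M) (Fin M) ℝ) (β σ : Fin N → ℝ) (κ γ ε : ℝ)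
    (Glim : Fin N → Matrix (Fin M) (Fin M) ℝ) (μ : ℝ) : Prop where
  network : D.NetworkConditions
  cost_eq : ∀ k, D.J k = J
  approx : QuadraticApprox J D.wo ν δ K e lam
  measurable_init : ∀ k, Measurable (D.w₀ k)
  memLp_init : ∀ k, MemLp (D.w₀ k) 4 P
  measurable_ind : ∀ i k m, Measurable (D.ind i k m)
  measurable_gradHat : ∀ i k, Measurable fun z : Vec M × Ω => D.gradHat i k z.1 z.2
  indicator : D.IndicatorConditions P μ
  noise : D.NoiseConditions P β σ κ γ ε Glim μ
  κ_nonneg : 0 ≤ κ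
  γ_pos : 0 < γ
  γ_le : γ ≤ 4
  ε_pos : 0 < ε
  noise_wo : ∀ i k m n,
    ∫ ω, D.noise i k (fun _ => D.wo) ω m * D.noise i k (fun _ => D.wo) ω n ∂P = G m n

namespace StandingConditions

variable [MeasurableSpace Ω] {D : Model N M Ω} {P : Measure Ω} {J : Vec M → ℝ} {ν δ K : ℝ}
  {e : OrthonormalBasis (Fin M) ℝ (Vec M)} {lam : Fin M → ℝ} {G : Matrix (Fin M) (Fin M) ℝ}
  {β σ : Fin N → ℝ} {κ γ ε : ℝ} {Glim : Fin N → Matrix (Fin M) (Fin M) ℝ} {μ : ℝ}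

lemma continuous_gradient (hD : D.StandingConditions P J ν δ K e lam G β σ κ γ ε Glim μ) :
    Continuous (gradient J) := by
  have h : LipschitzWith δ.toNNReal (gradient J) := LipschitzWith.of_dist_le_mul fun v w => by
    rw [dist_eq_norm, dist_eq_norm, Real.coe_toNNReal _
      (hD.approx.ν_pos.le.trans hD.approx.ν_le_δ)]
    exact hD.approx.lipschitz v w
  exact h.continuous

lemma measurable_gradHat_comp (hD : D.StandingConditions P J ν δ K e lam G β σ κ γ ε Glim μ)
    (i : ℕ) (k : Fin N) {w : Ω → Vec M} (hw : Measurable w) :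
    Measurable fun ω => D.gradHat i k (w ω) ω :=
  (hD.measurable_gradHat i k).comp (hw.prodMk measurable_id)

lemma measurable_iterate (hD : D.StandingConditions P J ν δ K e lam G β σ κ γ ε Glim μ) (i : ℕ) :
    ∀ k, Measurable (D.iterate μ i k) := by
  induction i with
  | zero => exact hD.measurable_init
  | succ i ih =>
    intro k
    have hφ : ∀ l, Measurable (D.combined μ i l) := fun l => by
      unfold combined combine
      exact Finset.measurable_fun_sum _ fun j _ => (ih j).const_smul (D.A₁ j l)
    have hg : ∀ l, Measurable (D.partialGrad μ i l) := fun l => by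
      unfold partialGrad mask
      refine (PiLp.continuous_toLp 2 _).measurable.comp (measurable_pi_lambda _ fun m => ?_)
      exact (hD.measurable_ind i l m).mul
        ((EuclideanSpace.proj m).continuous.measurable.comp (hD.measurable_gradHat_comp i l (hφ l)))
    have : D.iterate μ (i + 1) k = fun ω => ∑ l, D.A₂ l k •
        (D.combined μ i l ω - (μ * D.τ l) • D.partialGrad μ i l ω) := by
      funext ω
      rw [iterate_succ]
      rfl
    rw [this]
    exact Finset.measurable_fun_sum _ fun l _ =>
      ((hφ l).sub ((hg l).const_smul (μ * D.τ l))).const_smul (D.A₂ l k)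

lemma past_le (hD : D.StandingConditions P J ν δ K e lam G β σ κ γ ε Glim μ) (i : ℕ) :
    D.past μ i ≤ ‹MeasurableSpace Ω› := by
  refine sup_le ?_ ?_
  · exact iSup_le fun k => iSup_le fun j => iSup_le fun _ => (hD.measurable_iterate j k).comap_le
  · exact iSup_le fun k => iSup_le fun m => iSup_le fun j => iSup_le fun _ =>
      (hD.measurable_ind j k m).comap_le

lemma present_le (hD : D.StandingConditions P J ν δ K e lam G β σ κ γ ε Glim μ) (i : ℕ) :
    D.present μ i ≤ ‹MeasurableSpace Ω› :=
  sup_le (hD.past_le i) (iSup_le fun k => (hD.measurable_gradHat_comp i k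
    ((D.measurable_combined_past μ i k).mono (hD.past_le i) le_rfl)).comap_le)

lemma measurable_noise_present (hD : D.StandingConditions P J ν δ K e lam G β σ κ γ ε Glim μ)
    (i : ℕ) (k : Fin N) (m : Fin M) :
    Measurable[D.present μ i] fun ω => D.noise i k (D.combined μ i k) ω m := by
  have h1 : Measurable[D.present μ i] fun ω => D.gradHat i k (D.combined μ i k ω) ω :=
    Measurable.of_comap_le (le_trans (le_iSup (fun k : Fin N => MeasurableSpace.comap
      (fun ω => D.gradHat i k (D.combined μ i k ω) ω) inferInstance) k) le_sup_right)
  have h2 : Measurable[D.present μ i] fun ω => gradient J (D.combined μ i k ω) :=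
    hD.continuous_gradient.measurable.comp
      ((D.measurable_combined_past μ i k).mono le_sup_left le_rfl)
  unfold Model.noise
  rw [hD.cost_eq]
  exact (EuclideanSpace.proj (𝕜 := ℝ) m).continuous.measurable.comp (h1.sub h2)

variable [IsProbabilityMeasure P]

lemma memLp_gradient (hD : D.StandingConditions P J ν δ K e lam G β σ κ γ ε Glim μ)
    {w : Ω → Vec M} (hw : MemLp w 4 P) : MemLp (fun ω => gradient J (w ω)) 4 P := by
  have h1 : MemLp (fun ω => w ω - D.wo) 4 P := hw.sub (memLp_const _)
  refine h1.of_le_mul (c := δ) (hD.continuous_gradient.comp_aestronglyMeasurable hw.1)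
    (Eventually.of_forall fun ω => ?_)
  simpa [hD.approx.gradient_eq_zero] using hD.approx.lipschitz (w ω) D.wo

lemma memLp_gradHat (hD : D.StandingConditions P J ν δ K e lam G β σ κ γ ε Glim μ)
    {i : ℕ} {k : Fin N} {w : Ω → Vec M} (hw : D.IsIterate P μ i w) :
    MemLp (fun ω => D.gradHat i k (w ω) ω) 4 P := by
  have h1 := (hD.noise.memLp i k w hw).add (hD.memLp_gradient hw.2)
  have h2 : (D.noise i k w + fun ω => gradient J (w ω)) = fun ω => D.gradHat i k (w ω) ω := by
    funext ω
    simp [Model.noise, hD.cost_eq]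
  rwa [h2] at h1

lemma memLp_iterate (hD : D.StandingConditions P J ν δ K e lam G β σ κ γ ε Glim μ) (i : ℕ) :
    ∀ k, MemLp (D.iterate μ i k) 4 P := by
  induction i with
  | zero => exact hD.memLp_init
  | succ i ih =>
    intro k
    have hφ : ∀ l, MemLp (D.combined μ i l) 4 P := fun l => by
      unfold combined combine
      exact memLp_finsetSum _ fun j _ => (ih j).const_smul (D.A₁ j l)
    have hφi : ∀ l, D.IsIterate P μ i (D.combined μ i l) := fun l =>
      ⟨D.measurable_combined_past μ i l, hφ l⟩
    have hg : ∀ l, MemLp (D.partialGrad μ i l) 4 P := fun l => by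
      refine (hD.memLp_gradHat (hφi l) (k := l)).mono ?_ (Eventually.of_forall fun ω =>
        norm_mask_le_of_zero_or_one (fun m => hD.indicator.zero_or_one i l m ω) _)
      unfold partialGrad mask
      refine Measurable.aestronglyMeasurable ?_
      refine (PiLp.continuous_toLp 2 _).measurable.comp (measurable_pi_lambda _ fun m => ?_)
      exact (hD.measurable_ind i l m).mul ((EuclideanSpace.proj m).continuous.measurable.comp
        (hD.measurable_gradHat_comp i l ((D.measurable_combined_past μ i l).mono
          (hD.past_le i) le_rfl)))
    have : D.iterate μ (i + 1) k = fun ω => ∑ l, D.A₂ l k •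
        (D.combined μ i l ω - (μ * D.τ l) • D.partialGrad μ i l ω) := by
      funext ω
      rw [iterate_succ]
      rfl
    rw [this]
    exact memLp_finsetSum _ fun l _ =>
      ((hφ l).sub ((hg l).const_smul (μ * D.τ l))).const_smul (D.A₂ l k)

lemma isIterate_combined (hD : D.StandingConditions P J ν δ K e lam G β σ κ γ ε Glim μ)
    (i : ℕ) (k : Fin N) : D.IsIterate P μ i (D.combined μ i k) := by
  refine ⟨D.measurable_combined_past μ i k, ?_⟩
  unfold combined combine
  exact memLp_finsetSum _ fun j _ => (hD.memLp_iterate i j).const_smul (D.A₁ j k)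

lemma memLp_partialGrad (hD : D.StandingConditions P J ν δ K e lam G β σ κ γ ε Glim μ) (i : ℕ)
    (l : Fin N) : MemLp (D.partialGrad μ i l) 4 P := by
  refine (hD.memLp_gradHat (hD.isIterate_combined i l) (k := l)).mono ?_
    (Eventually.of_forall fun ω =>
      norm_mask_le_of_zero_or_one (fun m => hD.indicator.zero_or_one i l m ω) _)
  unfold partialGrad mask
  refine Measurable.aestronglyMeasurable ?_
  refine (PiLp.continuous_toLp 2 _).measurable.comp (measurable_pi_lambda _ fun m => ?_)
  exact (hD.measurable_ind i l m).mul ((EuclideanSpace.proj m).continuous.measurable.comp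
    (hD.measurable_gradHat_comp i l ((D.measurable_combined_past μ i l).mono
      (hD.past_le i) le_rfl)))

/-! ### Independence of the indicators and moments of the gradient noise -/

/-- The noise is orthogonal to all quantities that are determined by the past. -/
lemma integral_mul_noise_eq_zero
    (hD : D.StandingConditions P J ν δ K e lam G β σ κ γ ε Glim μ) {i : ℕ} {k : Fin N}
    {w : Ω → Vec M} (hw : D.IsIterate P μ i w) {Z : Ω → ℝ} (hZ : Measurable[D.past μ i] Z)
    (m : Fin M) (hint : Integrable (fun ω => Z ω * D.noise i k w ω m) P) :
    ∫ ω, Z ω * D.noise i k w ω m ∂P = 0 := by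
  have hnoise : Integrable (D.noise i k w) P :=
    (hD.noise.memLp i k w hw).integrable (by norm_num)
  have hm : Integrable (fun ω => D.noise i k w ω m) P :=
    (memLp_apply (hD.noise.memLp i k w hw) m).integrable (by norm_num)
  have h1 : P[fun ω => D.noise i k w ω m | D.past μ i] =ᵐ[P] 0 := by
    have h2 := (EuclideanSpace.proj (𝕜 := ℝ) m).comp_condExp_comm hnoise (m := D.past μ i)
    filter_upwards [h2, hD.noise.mean_zero i k w hw] with ω h2 h3
    have h4 : P[fun ω => D.noise i k w ω m | D.past μ i] ω =
      (EuclideanSpace.proj (𝕜 := ℝ) m) (P[D.noise i k w | D.past μ i] ω) := h2.symm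
    rw [h4, h3]
    simp
  have h2 := condExp_mul_of_stronglyMeasurable_left (m := D.past μ i) (μ := P) (f := Z)
    (g := fun ω => D.noise i k w ω m) hZ.stronglyMeasurable hint hm
  have h3 := integral_condExp (μ := P) (hD.past_le i) (f := Z * fun ω => D.noise i k w ω m)
  change _ = ∫ ω, Z ω * D.noise i k w ω m ∂P at h3
  rw [← h3, integral_congr_ae h2]
  have h4 : (Z * P[fun ω => D.noise i k w ω m | D.past μ i]) =ᵐ[P] 0 := by
    filter_upwards [h1] with ω h1
    simp [h1]
  rw [integral_congr_ae h4]
  simp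

lemma integral_noise_mul_noise_eq_zero
    (hD : D.StandingConditions P J ν δ K e lam G β σ κ γ ε Glim μ) {i : ℕ} {k l : Fin N}
    (hkl : k ≠ l) {w w' : Ω → Vec M} (hw : D.IsIterate P μ i w) (hw' : D.IsIterate P μ i w')
    (m n : Fin M) : ∫ ω, D.noise i k w ω m * D.noise i l w' ω n ∂P = 0 := by
  rw [← integral_condExp (μ := P) (hD.past_le i),
    integral_congr_ae (hD.noise.uncorrelated i k l hkl w w' hw hw' m n)]
  simp

lemma integral_ind (hD : D.StandingConditions P J ν δ K e lam G β σ κ γ ε Glim μ) (i : ℕ)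
    (k : Fin N) (m : Fin M) : ∫ ω, D.ind i k m ω ∂P = 1 - D.r k := by
  have hs : MeasurableSet {ω | D.ind i k m ω = 0} :=
    hD.measurable_ind i k m (measurableSet_singleton 0)
  have h1 : ∀ ω, D.ind i k m ω = 1 - {ω | D.ind i k m ω = 0}.indicator (fun _ => (1 : ℝ)) ω := by
    intro ω
    rcases hD.indicator.zero_or_one i k m ω with h | h <;> simp [Set.indicator, h]
  calc ∫ ω, D.ind i k m ω ∂P
      = ∫ ω, (1 - {ω | D.ind i k m ω = 0}.indicator (fun _ => (1 : ℝ)) ω) ∂P :=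
        integral_congr_ae (Eventually.of_forall h1)
    _ = 1 - D.r k := by
      rw [integral_sub (integrable_const _) ((integrable_const _).indicator hs),
        integral_indicator_const _ hs, measureReal_def, hD.indicator.prob_zero,
        ENNReal.toReal_ofReal (hD.network.missing_nonneg k)]
      simp

/-- Distinct entries are masked independently, and an indicator is equal to its own square. -/
lemma integral_ind_mul_ind (hD : D.StandingConditions P J ν δ K e lam G β σ κ γ ε Glim μ) (i : ℕ)
    (k : Fin N) (m n : Fin M) :
    ∫ ω, D.ind i k m ω * D.ind i k n ω ∂P = if m = n then 1 - D.r k else (1 - D.r k) ^ 2 := by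
  split_ifs with h
  · subst h
    rw [← hD.integral_ind i k m]
    refine integral_congr_ae (Eventually.of_forall fun ω => ?_)
    rcases hD.indicator.zero_or_one i k m ω with h | h <;> simp [h]
  · have hind := (hD.indicator.indep i).indepFun (show ((k, m) : Fin N × Fin M) ≠ (k, n) by
      simpa using h)
    rw [hind.integral_fun_mul_eq_mul_integral (hD.measurable_ind i k m).aestronglyMeasurable
      (hD.measurable_ind i k n).aestronglyMeasurable, hD.integral_ind, hD.integral_ind, sq]

/-- Functions of the present indicators are independent of everything else up to the present. -/
lemma integral_indicators_mul
    (hD : D.StandingConditions P J ν δ K e lam G β σ κ γ ε Glim μ) {i : ℕ} {I Z : Ω → ℝ}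
    (hI : Measurable[⨆ k : Fin N, ⨆ m : Fin M,
      MeasurableSpace.comap (D.ind i k m) inferInstance] I)
    (hZ : Measurable[D.present μ i] Z) :
    ∫ ω, I ω * Z ω ∂P = (∫ ω, I ω ∂P) * ∫ ω, Z ω ∂P := by
  have h1 := hD.indicator.indep_past i (D.combined μ i) fun k => hD.isIterate_combined i k
  have h2 : IndepFun I Z P := by
    rw [IndepFun_iff_Indep]
    exact indep_of_indep_of_le h1 hI.comap_le hZ.comap_le
  have hle : (⨆ k : Fin N, ⨆ m : Fin M, MeasurableSpace.comap (D.ind i k m) inferInstance) ≤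
      ‹MeasurableSpace Ω› := iSup_le fun k => iSup_le fun m => (hD.measurable_ind i k m).comap_le
  exact h2.integral_fun_mul_eq_mul_integral (hI.mono hle le_rfl).aestronglyMeasurable
    (hZ.mono (hD.present_le i) le_rfl).aestronglyMeasurable

lemma integral_ind_mul (hD : D.StandingConditions P J ν δ K e lam G β σ κ γ ε Glim μ) {i : ℕ}
    (k : Fin N) (m : Fin M) {Z : Ω → ℝ} (hZ : Measurable[D.present μ i] Z) :
    ∫ ω, D.ind i k m ω * Z ω ∂P = (1 - D.r k) * ∫ ω, Z ω ∂P := by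
  rw [hD.integral_indicators_mul (measurable_ind_iSup D i k m) hZ, hD.integral_ind]

/-- The masked approximate gradient is, in the mean and given the past, the true gradient scaled by
the probability that an entry is available. -/
lemma integral_mul_partialGrad
    (hD : D.StandingConditions P J ν δ K e lam G β σ κ γ ε Glim μ) {i : ℕ} (k : Fin N) (m : Fin M)
    {Z : Ω → ℝ} (hZ : Measurable[D.past μ i] Z)
    (hint : Integrable (fun ω => Z ω * D.noise i k (D.combined μ i k) ω m) P)
    (hint' : Integrable (fun ω => Z ω * gradient J (D.combined μ i k ω) m) P) :
    ∫ ω, Z ω * D.partialGrad μ i k ω m ∂P =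
      ∫ ω, Z ω * ((1 - D.r k) * gradient J (D.combined μ i k ω) m) ∂P := by
  have hgrad : Measurable[D.past μ i] fun ω => gradient J (D.combined μ i k ω) m :=
    (EuclideanSpace.proj (𝕜 := ℝ) m).continuous.measurable.comp
      (hD.continuous_gradient.measurable.comp (D.measurable_combined_past μ i k))
  have h1 : ∀ ω, Z ω * D.partialGrad μ i k ω m = D.ind i k m ω *
      (Z ω * D.noise i k (D.combined μ i k) ω m + Z ω * gradient J (D.combined μ i k ω) m) := by
    intro ω
    simp only [partialGrad, mask, Model.noise, hD.cost_eq, PiLp.sub_apply]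
    ring
  simp only [h1]
  rw [hD.integral_ind_mul, integral_add hint hint',
    hD.integral_mul_noise_eq_zero (hD.isIterate_combined i k) hZ m hint, zero_add,
    ← integral_const_mul]
  · refine integral_congr_ae (Eventually.of_forall fun ω => ?_)
    simp only
    ring
  · have hZ' : Measurable[D.present μ i] Z := hZ.mono le_sup_left le_rfl
    exact (hZ'.mul (hD.measurable_noise_present i k m)).add
      (hZ'.mul (hgrad.mono le_sup_left le_rfl))

lemma integral_noise_pow_four_le
    (hD : D.StandingConditions P J ν δ K e lam G β σ κ γ ε Glim μ) {i : ℕ} {k : Fin N}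
    {w : Ω → Vec M} (hw : D.IsIterate P μ i w) :
    ∫ ω, ‖D.noise i k w ω‖ ^ 4 ∂P ≤ β k ^ 4 * ∫ ω, ‖w ω‖ ^ 4 ∂P + σ k ^ 4 := by
  have hi := (integrable_norm_pow_four hw.2).const_mul (β k ^ 4)
  rw [← integral_condExp (μ := P) (hD.past_le i)]
  refine (integral_mono_ae integrable_condExp (hi.add (integrable_const (σ k ^ 4)))
    (hD.noise.fourth_moment i k w hw)).trans (le_of_eq ?_)
  rw [integral_add' hi (integrable_const _), integral_const_mul]
  simp

end StandingConditions

end Model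

/-! ### The covariance of the gradient noise near the minimizer -/

lemma abs_entry_le_matNorm {M : ℕ} (B : Matrix (Fin M) (Fin M) ℝ) (m n : Fin M) :
    |B m n| ≤ matNorm B := by
  have h1 := (Matrix.toEuclideanCLM (n := Fin M) (𝕜 := ℝ) B).le_opNorm (EuclideanSpace.single n 1)
  have h2 := abs_apply_le_norm
    (Matrix.toEuclideanCLM (n := Fin M) (𝕜 := ℝ) B (EuclideanSpace.single n 1)) m
  rw [Matrix.ofLp_toEuclideanCLM] at h2
  simp only [PiLp.ofLp_single, Matrix.mulVec_single_one, Matrix.col_apply] at h2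
  simpa [matNorm] using h2.trans h1

lemma add_add_pow_four_le (a b c : ℝ) :
    (a + b + c) ^ 4 ≤ 27 * (a ^ 4 + b ^ 4 + c ^ 4) := by
  have h1 : (a + b + c) ^ 2 ≤ 3 * (a ^ 2 + b ^ 2 + c ^ 2) := by
    nlinarith [sq_nonneg (a - b), sq_nonneg (a - c), sq_nonneg (b - c)]
  have h2 : (a ^ 2 + b ^ 2 + c ^ 2) ^ 2 ≤ 3 * (a ^ 4 + b ^ 4 + c ^ 4) := by
    nlinarith [sq_nonneg (a ^ 2 - b ^ 2), sq_nonneg (a ^ 2 - c ^ 2), sq_nonneg (b ^ 2 - c ^ 2)]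
  calc (a + b + c) ^ 4 = ((a + b + c) ^ 2) ^ 2 := by ring
    _ ≤ (3 * (a ^ 2 + b ^ 2 + c ^ 2)) ^ 2 := by gcongr
    _ = 9 * (a ^ 2 + b ^ 2 + c ^ 2) ^ 2 := by ring
    _ ≤ _ := by linarith

lemma add_pow_four_le (a b : ℝ) :
    (a + b) ^ 4 ≤ 8 * (a ^ 4 + b ^ 4) := by
  have h1 : (a + b) ^ 2 ≤ 2 * (a ^ 2 + b ^ 2) := by nlinarith [sq_nonneg (a - b)]
  calc (a + b) ^ 4 = ((a + b) ^ 2) ^ 2 := by ring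
    _ ≤ (2 * (a ^ 2 + b ^ 2)) ^ 2 := by gcongr
    _ = 4 * (a ^ 2 + b ^ 2) ^ 2 := by ring
    _ ≤ _ := by nlinarith [sq_nonneg (a ^ 2 - b ^ 2)]

/-- A power with exponent in `(0, 4]` of a quantity of the order `√μ`. -/
lemma rpow_le_scaled {μ H S z γ : ℝ} (hμ : 0 < μ) (hμ1 : μ ≤ 1) (hz : 0 ≤ z) (hzHS : z ≤ H + S)
    (hγ : 0 < γ) (hγ4 : γ ≤ 4) :
    z ^ γ ≤ 8 * √μ ^ γ * (1 + H ^ 4 / μ ^ 2 + S ^ 4 / μ ^ 4) := by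
  have hr : 0 < √μ := Real.sqrt_pos.2 hμ
  have hr4 : √μ ^ 4 = μ ^ 2 := by
    rw [show √μ ^ 4 = (√μ ^ 2) ^ 2 by ring, Real.sq_sqrt hμ.le]
  have h1 : z ^ γ = √μ ^ γ * (z / √μ) ^ γ := by
    rw [← Real.mul_rpow hr.le (by positivity), mul_div_cancel₀ _ hr.ne']
  have h2 : (z / √μ) ^ γ ≤ 1 + (z / √μ) ^ 4 := by
    have h0 : 0 ≤ z / √μ := by positivity
    rcases le_total (z / √μ) 1 with h | h
    · have := Real.rpow_le_one h0 h hγ.le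
      have : 0 ≤ (z / √μ) ^ 4 := by positivity
      linarith
    · have h3 := Real.rpow_le_rpow_of_exponent_le h hγ4
      have h4 : (z / √μ) ^ (4 : ℝ) = (z / √μ) ^ 4 := by exact_mod_cast Real.rpow_natCast _ 4
      rw [h4] at h3
      linarith
  have h3 : (z / √μ) ^ 4 ≤ 8 * (H ^ 4 / μ ^ 2 + S ^ 4 / μ ^ 4) := by
    rw [div_pow, hr4]
    have h4 : z ^ 4 ≤ 8 * (H ^ 4 + S ^ 4) :=
      (pow_le_pow_left₀ hz hzHS 4).trans (add_pow_four_le _ _)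
    calc z ^ 4 / μ ^ 2 ≤ 8 * (H ^ 4 + S ^ 4) / μ ^ 2 := by gcongr
      _ = 8 * (H ^ 4 / μ ^ 2 + S ^ 4 / μ ^ 2) := by ring
      _ ≤ _ := by
        have : μ ^ 4 ≤ μ ^ 2 := pow_le_pow_of_le_one hμ.le hμ1 (by norm_num)
        gcongr
  rw [h1]
  have h5 : 0 ≤ √μ ^ γ := by positivity
  calc √μ ^ γ * (z / √μ) ^ γ ≤ √μ ^ γ * (8 * (1 + H ^ 4 / μ ^ 2 + S ^ 4 / μ ^ 4)) := by
        gcongr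
        linarith
    _ = _ := by ring

namespace Model.StandingConditions

variable {N M : ℕ} {Ω : Type*} [MeasurableSpace Ω] {D : Model N M Ω} {P : Measure Ω}
  {J : Vec M → ℝ} {ν δ K : ℝ}
  {e : OrthonormalBasis (Fin M) ℝ (Vec M)} {lam : Fin M → ℝ} {G : Matrix (Fin M) (Fin M) ℝ}
  {β σ : Fin N → ℝ} {κ γ ε : ℝ} {Glim : Fin N → Matrix (Fin M) (Fin M) ℝ} {μ : ℝ}
  [IsProbabilityMeasure P]

lemma integral_noise_pow_four_le_of_near
    (hD : D.StandingConditions P J ν δ K e lam G β σ κ γ ε Glim μ) {i : ℕ} {k : Fin N}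
    {w : Ω → Vec M} (hw : D.IsIterate P μ i w) {H S : Ω → ℝ} (hH : MemLp H 4 P) (hS : MemLp S 4 P)
    (hH0 : ∀ ω, 0 ≤ H ω) (hS0 : ∀ ω, 0 ≤ S ω) (hle : ∀ ω, ‖w ω - D.wo‖ ≤ H ω + S ω) :
    ∫ ω, ‖D.noise i k w ω‖ ^ 4 ∂P ≤ (27 * β k ^ 4 * (1 + ‖D.wo‖ ^ 4) + σ k ^ 4) *
      (1 + ∫ ω, H ω ^ 4 ∂P + ∫ ω, S ω ^ 4 ∂P) := by
  have hHi := integrable_pow_four hH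
  have hSi := integrable_pow_four hS
  have h1 : ∫ ω, ‖w ω‖ ^ 4 ∂P ≤
      27 * (‖D.wo‖ ^ 4 + ∫ ω, H ω ^ 4 ∂P + ∫ ω, S ω ^ 4 ∂P) := by
    have h2 : ∀ ω, ‖w ω‖ ^ 4 ≤ 27 * ((‖D.wo‖ ^ 4 + H ω ^ 4) + S ω ^ 4) := by
      intro ω
      have h3 : ‖w ω‖ ≤ ‖D.wo‖ + H ω + S ω := by
        have h4 := norm_add_le D.wo (w ω - D.wo)
        rw [add_sub_cancel] at h4
        linarith [hle ω]
      exact (pow_le_pow_left₀ (norm_nonneg _) h3 4).trans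
        (add_add_pow_four_le _ _ _)
    have i1 : Integrable (fun ω => ‖D.wo‖ ^ 4 + H ω ^ 4) P := (integrable_const _).add hHi
    refine (integral_mono (integrable_norm_pow_four hw.2) ((i1.add hSi).const_mul 27) h2).trans
      (le_of_eq ?_)
    rw [integral_const_mul, integral_add' i1 hSi, integral_add (integrable_const _) hHi]
    simp
  have h2 := hD.integral_noise_pow_four_le hw (k := k)
  have hx : 0 ≤ ∫ ω, H ω ^ 4 ∂P := integral_nonneg fun ω => by have := hH0 ω; positivity
  have hy : 0 ≤ ∫ ω, S ω ^ 4 ∂P := integral_nonneg fun ω => by have := hS0 ω; positivity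
  set x := ∫ ω, H ω ^ 4 ∂P
  set y := ∫ ω, S ω ^ 4 ∂P
  have hb : 0 ≤ β k ^ 4 := by positivity
  have hs : 0 ≤ σ k ^ 4 := by positivity
  have hwo : 0 ≤ ‖D.wo‖ ^ 4 := by positivity
  have h3 := mul_le_mul_of_nonneg_left h1 hb
  have h4 : 0 ≤ β k ^ 4 * (‖D.wo‖ ^ 4 * (x + y)) := by positivity
  have h5 : 0 ≤ σ k ^ 4 * (x + y) := by positivity
  linarith

/-- The covariance of the gradient noise at the points where the agents evaluate it differs from
the covariance at the minimizer by little. Where such a point is within distance `ε` of the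
minimizer this is the smoothness of the conditional covariance; the remaining event has a
probability of the order `μ²`, and the fourth moments of the noise are bounded. -/
lemma abs_integral_noise_sub_le
    (hD : D.StandingConditions P J ν δ K e lam G β σ κ γ ε Glim μ) (hμ : 0 < μ) (hμ1 : μ ≤ 1)
    {i : ℕ} {k : Fin N} {w : Ω → Vec M} (hw : D.IsIterate P μ i w) {H S : Ω → ℝ}
    (hH : MemLp H 4 P) (hS : MemLp S 4 P)
    (hH0 : ∀ ω, 0 ≤ H ω) (hS0 : ∀ ω, 0 ≤ S ω) (hle : ∀ ω, ‖w ω - D.wo‖ ≤ H ω + S ω)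
    (m n : Fin M) :
    |∫ ω, D.noise i k w ω m * D.noise i k w ω n ∂P - G m n| ≤
      (8 * κ + 16 / ε ^ 4 + (27 * β k ^ 4 * (1 + ‖D.wo‖ ^ 4) + σ k ^ 4)) * (√μ + √μ ^ γ) *
      (1 + (∫ ω, H ω ^ 4 ∂P) / μ ^ 2 + (∫ ω, S ω ^ 4 ∂P) / μ ^ 4) := by
  have hHi := integrable_pow_four hH
  have hSi := integrable_pow_four hS
  have hκ := hD.κ_nonneg
  have hε := hD.ε_pos
  have hx : 0 ≤ ∫ ω, H ω ^ 4 ∂P := integral_nonneg fun ω => by have := hH0 ω; positivity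
  have hy : 0 ≤ ∫ ω, S ω ^ 4 ∂P := integral_nonneg fun ω => by have := hS0 ω; positivity
  have hBi := integrable_scaled hH hS μ
  have hBint := integral_scaled hH hS μ
  set x := ∫ ω, H ω ^ 4 ∂P with hxdef
  set y := ∫ ω, S ω ^ 4 ∂P with hydef
  set B := 1 + x / μ ^ 2 + y / μ ^ 4 with hB
  set Ks := 27 * β k ^ 4 * (1 + ‖D.wo‖ ^ 4) + σ k ^ 4 with hKs
  have hKs0 : 0 ≤ Ks := by
    have hb : 0 ≤ β k ^ 4 := by positivity
    have hs : 0 ≤ σ k ^ 4 := by positivity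
    positivity
  have hB0 : 0 ≤ B := by positivity
  have hxyB : 1 + x + y ≤ B := one_add_le_scaled hμ hμ1 hx hy
  -- the smoothness condition admits only deviations bounded by `ε`, so the deviation is truncated
  classical
  set h : Ω → Vec M := fun ω => if ‖w ω - D.wo‖ ≤ ε then w ω - D.wo else 0 with hh
  have hhm : Measurable[D.past μ i] h := by
    have hf : Measurable fun v : Vec M => if ‖v - D.wo‖ ≤ ε then v - D.wo else 0 :=
      Measurable.ite ((measurable_id.sub measurable_const).norm measurableSet_Iic)
        (measurable_id.sub measurable_const) measurable_const
    exact hf.comp hw.1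
  have hhε : ∀ ω, ‖h ω‖ ≤ ε := by
    intro ω
    simp only [hh]
    split_ifs with h1
    · exact h1
    · simpa using hε.le
  have hhw : ∀ ω, ‖h ω‖ ≤ ‖w ω - D.wo‖ := by
    intro ω
    simp only [hh]
    split_ifs <;> simp
  have hhm' : Measurable h := hhm.mono (hD.past_le i) le_rfl
  set w' : Ω → Vec M := fun ω => D.wo + h ω with hw'def
  have hw' : D.IsIterate P μ i w' := by
    refine ⟨hhm.const_add D.wo, MemLp.of_bound (measurable_const.add hhm').aestronglyMeasurable
      (‖D.wo‖ + ε) (Eventually.of_forall fun ω => ?_)⟩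
    exact (norm_add_le _ _).trans (add_le_add le_rfl (hhε ω))
  have hw'le : ∀ ω, ‖w' ω - D.wo‖ ≤ H ω + S ω := by
    intro ω
    simp only [hw'def, add_sub_cancel_left]
    exact (hhw ω).trans (hle ω)
  have hprod : ∀ {v : Ω → Vec M}, D.IsIterate P μ i v →
      Integrable (fun ω => D.noise i k v ω m * D.noise i k v ω n) P := by
    intro v hv
    have h1 := hD.noise.memLp i k v hv
    have h2 : MemLp (D.noise i k v) 2 P := h1.mono_exponent (by norm_num)
    exact (memLp_apply h2 m).integrable_mul (memLp_apply h2 n)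
  -- near the minimizer
  have hnear : |∫ ω, D.noise i k w' ω m * D.noise i k w' ω n ∂P - G m n| ≤
      8 * κ * √μ ^ γ * B := by
    have hc : ∀ᵐ ω ∂P, |D.noiseCov P μ i k w' ω m n - D.noiseCov P μ i k (fun _ => D.wo) ω m n| ≤
        8 * κ * √μ ^ γ * (1 + H ω ^ 4 / μ ^ 2 + S ω ^ 4 / μ ^ 4) := by
      filter_upwards [hD.noise.cov_smooth i k h hhm hhε] with ω hω
      have h1 := (abs_entry_le_matNorm _ m n).trans hω
      rw [Matrix.sub_apply] at h1
      refine h1.trans ?_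
      have h2 := mul_le_mul_of_nonneg_left (rpow_le_scaled hμ hμ1 (norm_nonneg _)
        ((hhw ω).trans (hle ω)) hD.γ_pos hD.γ_le) hκ
      linarith
    have e1 : ∫ ω, D.noise i k w' ω m * D.noise i k w' ω n ∂P =
        ∫ ω, D.noiseCov P μ i k w' ω m n ∂P := (integral_condExp (hD.past_le i)).symm
    have e2 : G m n = ∫ ω, D.noiseCov P μ i k (fun _ => D.wo) ω m n ∂P := by
      rw [← hD.noise_wo i k m n]
      exact (integral_condExp (hD.past_le i)).symm
    have j1 : Integrable (fun ω => D.noiseCov P μ i k w' ω m n) P := integrable_condExp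
    have j2 : Integrable (fun ω => D.noiseCov P μ i k (fun _ => D.wo) ω m n) P :=
      integrable_condExp
    rw [e1, e2, ← integral_sub j1 j2, ← hBint, ← integral_const_mul]
    exact abs_integral_le_integral_abs.trans
      (integral_mono_ae (j1.sub j2).abs (hBi.const_mul _) hc)
  -- the contribution of the event that the point is far from the minimizer
  have hfar : |∫ ω, D.noise i k w ω m * D.noise i k w ω n ∂P -
      ∫ ω, D.noise i k w' ω m * D.noise i k w' ω n ∂P| ≤ (16 / ε ^ 4 + Ks) * μ * B := by
    have hpt : ∀ ω, |D.noise i k w ω m * D.noise i k w ω n -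
        D.noise i k w' ω m * D.noise i k w' ω n| ≤
        8 / ε ^ 4 * μ * (1 + H ω ^ 4 / μ ^ 2 + S ω ^ 4 / μ ^ 4) + (μ / 2 * ‖D.noise i k w ω‖ ^ 4 +
          μ / 2 * ‖D.noise i k w' ω‖ ^ 4) := by
      intro ω
      have hBω : 0 ≤ 1 + H ω ^ 4 / μ ^ 2 + S ω ^ 4 / μ ^ 4 := by
        have := hH0 ω
        have := hS0 ω
        positivity
      by_cases hcase : ‖w ω - D.wo‖ ≤ ε
      · have h1 : w' ω = w ω := by simp [hw'def, hh, hcase]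
        have h2 : D.noise i k w' ω = D.noise i k w ω := by simp [Model.noise, h1]
        rw [h2, sub_self, abs_zero]
        positivity
      · -- Young's inequality with weight `μ`; the constant `1 / (2 μ)` is harmless, because it is
        -- only needed where `H + S` exceeds `ε`
        have hprodle : ∀ v : Vec M, |v m * v n| ≤ 1 / (2 * μ) + μ / 2 * ‖v‖ ^ 4 := by
          intro v
          have h1 : |v m * v n| ≤ ‖v‖ ^ 2 := by
            rw [abs_mul, sq]
            exact mul_le_mul (abs_apply_le_norm v m) (abs_apply_le_norm v n) (abs_nonneg _)
              (norm_nonneg _)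
          have h2 : 1 / (2 * μ) + μ / 2 * ‖v‖ ^ 4 - ‖v‖ ^ 2 = (1 - μ * ‖v‖ ^ 2) ^ 2 / (2 * μ) := by
            field_simp
            ring
          have h3 : 0 ≤ (1 - μ * ‖v‖ ^ 2) ^ 2 / (2 * μ) := by positivity
          linarith
        have h1 := hprodle (D.noise i k w ω)
        have h2 := hprodle (D.noise i k w' ω)
        have h3 := abs_sub (D.noise i k w ω m * D.noise i k w ω n)
          (D.noise i k w' ω m * D.noise i k w' ω n)
        have h4 : 1 / μ ≤ 8 / ε ^ 4 * μ * (1 + H ω ^ 4 / μ ^ 2 + S ω ^ 4 / μ ^ 4) := by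
          have h5 : ε ^ 4 ≤ 8 * (H ω ^ 4 + S ω ^ 4) :=
            (pow_le_pow_left₀ hε.le ((not_le.1 hcase).le.trans (hle ω)) 4).trans
              (add_pow_four_le _ _)
          have h6 : (H ω ^ 4 + S ω ^ 4) / μ ^ 2 ≤ 1 + H ω ^ 4 / μ ^ 2 + S ω ^ 4 / μ ^ 4 := by
            have h7 : S ω ^ 4 / μ ^ 2 ≤ S ω ^ 4 / μ ^ 4 := by
              have : μ ^ 4 ≤ μ ^ 2 := pow_le_pow_of_le_one hμ.le hμ1 (by norm_num)
              have := hS0 ω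
              gcongr
            rw [add_div]
            linarith
          calc 1 / μ = ε ^ 4 / ε ^ 4 * μ / μ ^ 2 := by field_simp
            _ ≤ 8 * (H ω ^ 4 + S ω ^ 4) / ε ^ 4 * μ / μ ^ 2 := by gcongr
            _ = 8 / ε ^ 4 * μ * ((H ω ^ 4 + S ω ^ 4) / μ ^ 2) := by ring
            _ ≤ _ := by gcongr
        have h8 : 1 / μ = 1 / (2 * μ) + 1 / (2 * μ) := by field_simp; norm_num
        linarith
    have i1 := hBi.const_mul (8 / ε ^ 4 * μ)
    have i2 := (integrable_norm_pow_four (hD.noise.memLp i k w hw)).const_mul (μ / 2)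
    have i3 := (integrable_norm_pow_four (hD.noise.memLp i k w' hw')).const_mul (μ / 2)
    rw [← integral_sub (hprod hw) (hprod hw')]
    refine (abs_integral_le_integral_abs.trans (integral_mono ((hprod hw).sub (hprod hw')).abs
      (i1.add (i2.add i3)) hpt)).trans ?_
    rw [integral_add' i1 (i2.add i3), integral_add' i2 i3, integral_const_mul, integral_const_mul,
      integral_const_mul, hBint]
    have h1 := (hD.integral_noise_pow_four_le_of_near (k := k) hw hH hS hH0 hS0 hle).trans
      (mul_le_mul_of_nonneg_left hxyB hKs0)
    have h2 := (hD.integral_noise_pow_four_le_of_near (k := k) hw' hH hS hH0 hS0 hw'le).trans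
      (mul_le_mul_of_nonneg_left hxyB hKs0)
    have h3 := mul_le_mul_of_nonneg_left h1 (half_pos hμ).le
    have h4 := mul_le_mul_of_nonneg_left h2 (half_pos hμ).le
    have h5 : 0 ≤ 8 / ε ^ 4 * μ * B := by positivity
    calc _ ≤ 8 / ε ^ 4 * μ * B + (μ / 2 * (Ks * B) + μ / 2 * (Ks * B)) := by gcongr
      _ ≤ _ := by
        have h6 : 16 / ε ^ 4 * μ * B = 8 / ε ^ 4 * μ * B + 8 / ε ^ 4 * μ * B := by ring
        linarith
  have hμs : μ ≤ √μ := by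
    have : √μ ≤ 1 := Real.sqrt_le_one.2 hμ1
    nlinarith [Real.sq_sqrt hμ.le, Real.sqrt_nonneg μ]
  have htri := abs_sub_le (∫ ω, D.noise i k w ω m * D.noise i k w ω n ∂P)
    (∫ ω, D.noise i k w' ω m * D.noise i k w' ω n ∂P) (G m n)
  refine htri.trans ((add_le_add hfar hnear).trans ?_)
  have hg : 0 ≤ √μ ^ γ := by positivity
  have h1 : (16 / ε ^ 4 + Ks) * μ * B ≤ (16 / ε ^ 4 + Ks) * √μ * B := by gcongr
  have h2 : 0 ≤ 8 * κ * √μ * B := by positivity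
  have h3 : 0 ≤ (16 / ε ^ 4 + Ks) * √μ ^ γ * B := by positivity
  linarith

end Model.StandingConditions

namespace Model

variable {N M : ℕ} {Ω : Type*}

/-! ### The recursion of the centroid -/

/-- The weight with which the gradient of agent `l` enters the update of the centroid, divided by
the largest step-size. -/
noncomputable def relWeight (D : Model N M Ω) (l : Fin N) : ℝ := D.τ l * (D.A₂ *ᵥ D.p) l

/-- The effective step-size of the centroid, divided by the largest step-size. -/
noncomputable def meanStep (D : Model N M Ω) : ℝ := ∑ l, D.relWeight l * (1 - D.r l)

/-- The variance, in direction `v` and in units of the squared step-size, of the noise that the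
masked gradients inject into the centroid, when `G` is the covariance of the gradient noise. -/
noncomputable def noiseVariance (D : Model N M Ω) (G : Matrix (Fin M) (Fin M) ℝ) (v : Vec M) : ℝ :=
  ∑ l, D.relWeight l ^ 2 * ∑ m, ∑ n,
    (if m = n then 1 - D.r l else (1 - D.r l) ^ 2) * (v m * v n * G m n)

/-- The deviation of the centroid of the agents' iterates from the minimizer. -/
noncomputable def centroidError (D : Model N M Ω) (μ : ℝ) (i : ℕ) (ω : Ω) : Vec M :=
  centroid D.p (fun l => D.iterate μ i l ω) - D.wo

/-- The disagreement seminorm of the agents' iterates. -/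
noncomputable def spread (D : Model N M Ω) (c : ℕ) (μ : ℝ) (i : ℕ) (ω : Ω) : ℝ :=
  disagreementNorm (D.A₁ * D.A₂) D.p c (fun l => D.iterate μ i l ω)

/-- The conditional mean, given the past, of the next centroid error. -/
noncomputable def meanUpdate (D : Model N M Ω) (J : Vec M → ℝ) (μ : ℝ) (i : ℕ) (ω : Ω) : Vec M :=
  D.centroidError μ i ω -
    μ • ∑ l, (D.relWeight l * (1 - D.r l)) • gradient J (D.combined μ i l ω)

/-- The noise in the update of the centroid. -/
noncomputable def updateNoise (D : Model N M Ω) (J : Vec M → ℝ) (μ : ℝ) (i : ℕ) (ω : Ω) : Vec M :=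
  μ • ∑ l, D.relWeight l •
    (D.partialGrad μ i l ω - (1 - D.r l) • gradient J (D.combined μ i l ω))

/-- A scalar that controls the sizes of all gradients and of all gradient noises. -/
noncomputable def gradSize (D : Model N M Ω) (μ : ℝ) (i : ℕ) (ω : Ω) : ℝ :=
  ∑ l, (‖D.noise i l (D.combined μ i l) ω‖ + ‖D.combined μ i l ω - D.wo‖)

lemma gradSize_nonneg (D : Model N M Ω) (μ : ℝ) (i : ℕ) (ω : Ω) : 0 ≤ D.gradSize μ i ω :=
  Finset.sum_nonneg fun _ _ => add_nonneg (norm_nonneg _) (norm_nonneg _)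

lemma spread_nonneg (D : Model N M Ω) (c : ℕ) (μ : ℝ) (i : ℕ) (ω : Ω) : 0 ≤ D.spread c μ i ω :=
  disagreementNorm_nonneg _ _ _ _

lemma norm_noise_add_le_gradSize (D : Model N M Ω) (μ : ℝ) (i : ℕ) (l : Fin N) (ω : Ω) :
    ‖D.noise i l (D.combined μ i l) ω‖ + ‖D.combined μ i l ω - D.wo‖ ≤ D.gradSize μ i ω :=
  Finset.single_le_sum
    (f := fun l => ‖D.noise i l (D.combined μ i l) ω‖ + ‖D.combined μ i l ω - D.wo‖)
    (fun _ _ => add_nonneg (norm_nonneg _) (norm_nonneg _)) (Finset.mem_univ l)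

namespace NetworkConditions

variable {D : Model N M Ω}

lemma combination_mem (hD : D.NetworkConditions) : D.A₁ * D.A₂ ∈ Matrix.colStochastic ℝ (Fin N) :=
  mul_mem hD.stochastic₁ hD.stochastic₂

lemma p_nonneg (hD : D.NetworkConditions) (k : Fin N) : 0 ≤ D.p k :=
  perron_nonneg hD.combination_mem hD.primitive hD.perron hD.perron_sum k

lemma mulVec_nonneg (hD : D.NetworkConditions) (l : Fin N) : 0 ≤ (D.A₂ *ᵥ D.p) l := by
  simp only [Matrix.mulVec, dotProduct]
  exact Finset.sum_nonneg fun j _ =>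
    mul_nonneg (Matrix.nonneg_of_mem_colStochastic hD.stochastic₂) (hD.p_nonneg j)

lemma sum_mulVec (hD : D.NetworkConditions) : ∑ l, (D.A₂ *ᵥ D.p) l = 1 := by
  simp only [Matrix.mulVec, dotProduct]
  rw [Finset.sum_comm, ← hD.perron_sum]
  refine Finset.sum_congr rfl fun j _ => ?_
  rw [← Finset.sum_mul, Matrix.sum_col_of_mem_colStochastic hD.stochastic₂, one_mul]

lemma relWeight_nonneg (hD : D.NetworkConditions) (l : Fin N) : 0 ≤ D.relWeight l :=
  mul_nonneg (hD.step_pos l).le (hD.mulVec_nonneg l)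

lemma sum_relWeight_le (hD : D.NetworkConditions) : ∑ l, D.relWeight l ≤ 1 := by
  rw [← hD.sum_mulVec]
  exact Finset.sum_le_sum fun l _ => mul_le_of_le_one_left (hD.mulVec_nonneg l) (hD.step_le l)

lemma relWeight_le (hD : D.NetworkConditions) (l : Fin N) : D.relWeight l ≤ 1 :=
  (Finset.single_le_sum (fun l _ => hD.relWeight_nonneg l) (Finset.mem_univ l)).trans
    hD.sum_relWeight_le

lemma exists_relWeight_pos (hD : D.NetworkConditions) : ∃ l, 0 < D.relWeight l := by
  by_contra! h
  have h1 : ∀ l, (D.A₂ *ᵥ D.p) l = 0 := fun l => by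
    have h2 := le_antisymm (h l) (hD.relWeight_nonneg l)
    exact (mul_eq_zero.1 h2).resolve_left (hD.step_pos l).ne'
  have := hD.sum_mulVec
  simp [h1] at this

/-- A sum with the relative weights is at most the largest term. -/
lemma sum_relWeight_mul_le (hD : D.NetworkConditions)
    {f : Fin N → ℝ} {b : ℝ} (hb : 0 ≤ b) (hf : ∀ l, f l ≤ b) : ∑ l, D.relWeight l * f l ≤ b := by
  calc ∑ l, D.relWeight l * f l ≤ ∑ l, D.relWeight l * b :=
        Finset.sum_le_sum fun l _ => mul_le_mul_of_nonneg_left (hf l) (hD.relWeight_nonneg l)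
    _ = (∑ l, D.relWeight l) * b := by rw [Finset.sum_mul]
    _ ≤ b := mul_le_of_le_one_left hb hD.sum_relWeight_le

lemma norm_sum_relWeight_smul_le (hD : D.NetworkConditions) {f : Fin N → Vec M} {b : ℝ}
    (hb : 0 ≤ b) (hf : ∀ l, ‖f l‖ ≤ b) : ‖∑ l, D.relWeight l • f l‖ ≤ b := by
  refine (norm_sum_le _ _).trans (le_trans (le_of_eq ?_) (hD.sum_relWeight_mul_le hb hf))
  exact Finset.sum_congr rfl fun l _ => by
    rw [norm_smul, Real.norm_of_nonneg (hD.relWeight_nonneg l)]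

lemma meanStep_pos (hD : D.NetworkConditions) : 0 < D.meanStep := by
  obtain ⟨l, hl⟩ := hD.exists_relWeight_pos
  refine Finset.sum_pos' (fun l _ => mul_nonneg (hD.relWeight_nonneg l)
    (sub_nonneg.2 (hD.missing_lt l).le)) ⟨l, Finset.mem_univ l, mul_pos hl ?_⟩
  exact sub_pos.2 (hD.missing_lt l)

lemma meanStep_le (hD : D.NetworkConditions) : D.meanStep ≤ 1 := by
  refine le_trans (Finset.sum_le_sum fun l _ => ?_) hD.sum_relWeight_le
  exact mul_le_of_le_one_right (hD.relWeight_nonneg l) (by linarith [hD.missing_nonneg l])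

/-- The combination steps do not move the centroid, because `p` is the Perron vector of `A₁ * A₂`;
the second combination matrix turns the weights of the gradients into those of `A₂ p`. -/
lemma centroidError_succ (hD : D.NetworkConditions) (μ : ℝ) (i : ℕ) (ω : Ω) :
    D.centroidError μ (i + 1) ω = D.centroidError μ i ω -
      μ • ∑ l, D.relWeight l • D.partialGrad μ i l ω := by
  have h1 : (fun l => D.iterate μ (i + 1) l ω) = combine D.A₂
      ((fun l => D.combined μ i l ω) - fun l => (μ * D.τ l) • D.partialGrad μ i l ω) := rfl
  have h2 : (fun l => D.combined μ i l ω) = combine D.A₁ fun l => D.iterate μ i l ω := rfl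
  simp only [centroidError]
  rw [h1, centroid_combine, centroid_sub, h2, centroid_combine, Matrix.mulVec_mulVec, hD.perron]
  simp only [centroid, Finset.smul_sum, smul_smul, relWeight]
  have h3 : ∀ l, (D.A₂ *ᵥ D.p) l * (μ * D.τ l) = μ * (D.τ l * (D.A₂ *ᵥ D.p) l) := fun l => by ring
  simp only [h3]
  abel

lemma centroidError_succ_eq (hD : D.NetworkConditions) (J : Vec M → ℝ) (μ : ℝ) (i : ℕ) (ω : Ω) :
    D.centroidError μ (i + 1) ω = D.meanUpdate J μ i ω - D.updateNoise J μ i ω := by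
  rw [hD.centroidError_succ, meanUpdate, updateNoise]
  have h1 : ∑ l, D.relWeight l •
      (D.partialGrad μ i l ω - (1 - D.r l) • gradient J (D.combined μ i l ω)) =
      ∑ l, D.relWeight l • D.partialGrad μ i l ω -
      ∑ l, (D.relWeight l * (1 - D.r l)) • gradient J (D.combined μ i l ω) := by
    simp only [smul_sub, Finset.sum_sub_distrib, smul_smul]
  rw [h1, smul_sub]
  abel

lemma norm_combined_sub_centroid_le (hD : D.NetworkConditions) {c : ℕ}
    (hc : ∀ v : Fin N → Vec M, ‖disagreement D.p v‖ ≤ disagreementNorm (D.A₁ * D.A₂) D.p c v)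
    (μ : ℝ) (i : ℕ) (l : Fin N) (ω : Ω) :
    ‖D.combined μ i l ω - (D.wo + D.centroidError μ i ω)‖ ≤ D.spread c μ i ω := by
  have h1 : D.combined μ i l ω - (D.wo + D.centroidError μ i ω) =
      combine D.A₁ (disagreement D.p fun l => D.iterate μ i l ω) l := by
    have h2 : disagreement D.p (fun l => D.iterate μ i l ω) = (fun l => D.iterate μ i l ω) -
      fun _ => centroid D.p (fun l => D.iterate μ i l ω) := rfl
    rw [h2, combine_sub, combine_const hD.stochastic₁]
    simp [combined, centroidError]
  rw [h1]
  exact (norm_le_pi_norm _ l).trans ((norm_combine_le hD.stochastic₁ _).trans (hc _))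

lemma norm_iterate_sub_centroid_le {c : ℕ}
    (hc : ∀ v : Fin N → Vec M, ‖disagreement D.p v‖ ≤ disagreementNorm (D.A₁ * D.A₂) D.p c v)
    (μ : ℝ) (i : ℕ) (l : Fin N) (ω : Ω) :
    ‖D.iterate μ i l ω - (D.wo + D.centroidError μ i ω)‖ ≤ D.spread c μ i ω := by
  have h1 : D.iterate μ i l ω - (D.wo + D.centroidError μ i ω) =
      disagreement D.p (fun l => D.iterate μ i l ω) l := by
    simp [disagreement, centroidError]
  rw [h1]
  exact (norm_le_pi_norm _ l).trans (hc _)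

lemma norm_combined_sub_le (hD : D.NetworkConditions) {c : ℕ}
    (hc : ∀ v : Fin N → Vec M, ‖disagreement D.p v‖ ≤ disagreementNorm (D.A₁ * D.A₂) D.p c v)
    (μ : ℝ) (i : ℕ) (l : Fin N) (ω : Ω) :
    ‖D.combined μ i l ω - D.wo‖ ≤ ‖D.centroidError μ i ω‖ + D.spread c μ i ω := by
  have h1 := hD.norm_combined_sub_centroid_le hc μ i l ω
  have h2 := norm_add_le (D.combined μ i l ω - (D.wo + D.centroidError μ i ω))
    (D.centroidError μ i ω)
  have h3 : D.combined μ i l ω - (D.wo + D.centroidError μ i ω) + D.centroidError μ i ω =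
    D.combined μ i l ω - D.wo := by abel
  rw [h3] at h2
  linarith

end NetworkConditions

namespace StandingConditions

variable [MeasurableSpace Ω] {D : Model N M Ω} {P : Measure Ω}
  {J : Vec M → ℝ} {ν δ K : ℝ}
  {e : OrthonormalBasis (Fin M) ℝ (Vec M)} {lam : Fin M → ℝ} {G : Matrix (Fin M) (Fin M) ℝ}
  {β σ : Fin N → ℝ} {κ γ ε : ℝ} {Glim : Fin N → Matrix (Fin M) (Fin M) ℝ} {μ : ℝ}

lemma norm_gradient_le (hD : D.StandingConditions P J ν δ K e lam G β σ κ γ ε Glim μ) (v : Vec M) :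
    ‖gradient J v‖ ≤ δ * ‖v - D.wo‖ := by
  simpa [hD.approx.gradient_eq_zero] using hD.approx.lipschitz v D.wo

lemma norm_partialGrad_le (hD : D.StandingConditions P J ν δ K e lam G β σ κ γ ε Glim μ) (i : ℕ)
    (l : Fin N) (ω : Ω) : ‖D.partialGrad μ i l ω‖ ≤ (1 + δ) * D.gradSize μ i ω := by
  have hδ : 0 ≤ δ := hD.approx.ν_pos.le.trans hD.approx.ν_le_δ
  have h1 : ‖D.partialGrad μ i l ω‖ ≤ ‖D.gradHat i l (D.combined μ i l ω) ω‖ :=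
    norm_mask_le_of_zero_or_one (fun m => hD.indicator.zero_or_one i l m ω) _
  have h2 : D.gradHat i l (D.combined μ i l ω) ω =
      D.noise i l (D.combined μ i l) ω + gradient J (D.combined μ i l ω) := by
    simp [Model.noise, hD.cost_eq]
  have h3 := norm_add_le (D.noise i l (D.combined μ i l) ω) (gradient J (D.combined μ i l ω))
  rw [← h2] at h3
  have h4 := hD.norm_gradient_le (D.combined μ i l ω)
  have h5 := D.norm_noise_add_le_gradSize μ i l ω
  have h6 := mul_le_mul_of_nonneg_left h5 hδ
  have h7 : 0 ≤ δ * ‖D.noise i l (D.combined μ i l) ω‖ := by positivity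
  linarith [norm_nonneg (D.combined μ i l ω - D.wo)]

lemma spread_succ_le (hD : D.StandingConditions P J ν δ K e lam G β σ κ γ ε Glim μ) (hμ : 0 ≤ μ)
    {c : ℕ} {ρ : ℝ} (hρ : ∀ v : Fin N → Vec M, disagreementNorm (D.A₁ * D.A₂) D.p c
      (combine (D.A₁ * D.A₂) v) ≤ ρ * disagreementNorm (D.A₁ * D.A₂) D.p c v) (i : ℕ) (ω : Ω) :
    D.spread c μ (i + 1) ω ≤ ρ * D.spread c μ i ω + μ * (2 * c * (1 + δ)) * D.gradSize μ i ω := by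
  have hδ : 0 ≤ δ := hD.approx.ν_pos.le.trans hD.approx.ν_le_δ
  have hA := D.gradSize_nonneg μ i ω
  have hN := hD.network
  have h1 : (fun l => D.iterate μ (i + 1) l ω) = combine (D.A₁ * D.A₂) (fun l => D.iterate μ i l ω)
      - combine D.A₂ (fun l => (μ * D.τ l) • D.partialGrad μ i l ω) := by
    rw [← combine_combine, ← combine_sub]
    rfl
  have h2 : ‖fun l => (μ * D.τ l) • D.partialGrad μ i l ω‖ ≤ μ * ((1 + δ) * D.gradSize μ i ω) := by
    refine (pi_norm_le_iff_of_nonneg (by positivity)).2 fun l => ?_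
    rw [norm_smul, Real.norm_of_nonneg (mul_nonneg hμ (hN.step_pos l).le)]
    have h3 : μ * D.τ l ≤ μ := mul_le_of_le_one_right hμ (hN.step_le l)
    exact mul_le_mul h3 (hD.norm_partialGrad_le i l ω) (norm_nonneg _) hμ
  simp only [spread]
  rw [h1]
  refine (disagreementNorm_sub_le _ _ _ _ _).trans (add_le_add (hρ _) ?_)
  refine (disagreementNorm_le hN.combination_mem hN.p_nonneg hN.perron_sum c _).trans ?_
  calc 2 * (c : ℝ) * ‖combine D.A₂ fun l => (μ * D.τ l) • D.partialGrad μ i l ω‖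
      ≤ 2 * c * (μ * ((1 + δ) * D.gradSize μ i ω)) := by
        gcongr
        exact (norm_combine_le hN.stochastic₂ _).trans h2
    _ = _ := by ring

lemma norm_updateNoise_le (hD : D.StandingConditions P J ν δ K e lam G β σ κ γ ε Glim μ)
    (hμ : 0 ≤ μ) (i : ℕ) (ω : Ω) :
    ‖D.updateNoise J μ i ω‖ ≤ μ * (1 + 2 * δ) * D.gradSize μ i ω := by
  have hδ : 0 ≤ δ := hD.approx.ν_pos.le.trans hD.approx.ν_le_δ
  have hA := D.gradSize_nonneg μ i ω
  rw [updateNoise, norm_smul, Real.norm_of_nonneg hμ, mul_assoc]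
  refine mul_le_mul_of_nonneg_left (hD.network.norm_sum_relWeight_smul_le (by positivity)
    fun l => ?_) hμ
  have h1 := norm_sub_le (D.partialGrad μ i l ω) ((1 - D.r l) • gradient J (D.combined μ i l ω))
  have h2 := hD.norm_partialGrad_le i l ω
  have h3 : ‖(1 - D.r l) • gradient J (D.combined μ i l ω)‖ ≤ δ * D.gradSize μ i ω := by
    rw [norm_smul, Real.norm_of_nonneg (sub_nonneg.2 (hD.network.missing_lt l).le)]
    have h4 : 1 - D.r l ≤ 1 := by linarith [hD.network.missing_nonneg l]
    refine (mul_le_of_le_one_left (norm_nonneg _) h4).trans ((hD.norm_gradient_le _).trans ?_)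
    gcongr
    exact (le_add_of_nonneg_left (norm_nonneg _)).trans (D.norm_noise_add_le_gradSize μ i l ω)
  linarith

/-- The mean update differs from a gradient step at the centroid only by the disagreement. -/
lemma norm_meanUpdate_sub_le (hD : D.StandingConditions P J ν δ K e lam G β σ κ γ ε Glim μ)
    (hμ : 0 ≤ μ) {c : ℕ}
    (hc : ∀ v : Fin N → Vec M, ‖disagreement D.p v‖ ≤ disagreementNorm (D.A₁ * D.A₂) D.p c v)
    (i : ℕ) (ω : Ω) :
    ‖D.meanUpdate J μ i ω - (D.centroidError μ i ω -
      (D.meanStep * μ) • gradient J (D.wo + D.centroidError μ i ω))‖ ≤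
      δ * μ * D.spread c μ i ω := by
  have hδ : 0 ≤ δ := hD.approx.ν_pos.le.trans hD.approx.ν_le_δ
  have h1 : D.meanUpdate J μ i ω - (D.centroidError μ i ω -
      (D.meanStep * μ) • gradient J (D.wo + D.centroidError μ i ω)) =
      -(μ • ∑ l, D.relWeight l • ((1 - D.r l) • (gradient J (D.combined μ i l ω) -
        gradient J (D.wo + D.centroidError μ i ω)))) := by
    have h2 : (D.meanStep * μ) • gradient J (D.wo + D.centroidError μ i ω) =
        μ • ∑ l, D.relWeight l • ((1 - D.r l) • gradient J (D.wo + D.centroidError μ i ω)) := by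
      simp only [smul_smul]
      rw [← Finset.sum_smul, smul_smul, mul_comm]
      rfl
    rw [h2, meanUpdate]
    simp only [smul_sub, Finset.sum_sub_distrib, smul_smul]
    abel
  rw [h1, norm_neg, norm_smul, Real.norm_of_nonneg hμ]
  have hs := D.spread_nonneg c μ i ω
  have h3 : ‖∑ l, D.relWeight l • ((1 - D.r l) • (gradient J (D.combined μ i l ω) -
        gradient J (D.wo + D.centroidError μ i ω)))‖ ≤ δ * D.spread c μ i ω := by
    refine hD.network.norm_sum_relWeight_smul_le (by positivity) fun l => ?_
    rw [norm_smul, Real.norm_of_nonneg (sub_nonneg.2 (hD.network.missing_lt l).le)]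
    have h4 : 1 - D.r l ≤ 1 := by linarith [hD.network.missing_nonneg l]
    refine (mul_le_of_le_one_left (norm_nonneg _) h4).trans ((hD.approx.lipschitz _ _).trans ?_)
    gcongr
    exact hD.network.norm_combined_sub_centroid_le hc μ i l ω
  calc μ * _ ≤ μ * (δ * D.spread c μ i ω) := mul_le_mul_of_nonneg_left h3 hμ
    _ = _ := by ring

/-- A gradient step with a small step-size contracts, by strong monotonicity of the gradient. -/
lemma norm_meanUpdate_le (hD : D.StandingConditions P J ν δ K e lam G β σ κ γ ε Glim μ)
    (hμ : 0 ≤ μ) {c : ℕ}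
    (hc : ∀ v : Fin N → Vec M, ‖disagreement D.p v‖ ≤ disagreementNorm (D.A₁ * D.A₂) D.p c v)
    (hsmall : μ * δ ^ 2 ≤ ν) (hsmall' : μ * ν ≤ 2) (i : ℕ) (ω : Ω) :
    ‖D.meanUpdate J μ i ω‖ ≤ (1 - D.meanStep * ν / 2 * μ) * ‖D.centroidError μ i ω‖ +
      δ * μ * D.spread c μ i ω := by
  set h := D.centroidError μ i ω with hh
  set g := gradient J (D.wo + h) with hg
  have hq0 := hD.network.meanStep_pos
  have hq1 := hD.network.meanStep_le
  have hν := hD.approx.ν_pos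
  set q := D.meanStep * μ with hq
  have hq0' : 0 ≤ q := by positivity
  have hqμ : q ≤ μ := mul_le_of_le_one_left hμ hq1
  have h1 : ‖h - q • g‖ ≤ (1 - D.meanStep * ν / 2 * μ) * ‖h‖ := by
    have h2 : D.meanStep * ν / 2 * μ = q * ν / 2 := by rw [hq]; ring
    have h3 : q * ν ≤ 2 := (mul_le_mul_of_nonneg_right hqμ hν.le).trans hsmall'
    rw [h2]
    refine le_of_sq_le_sq ?_ (mul_nonneg (by linarith) (norm_nonneg _))
    have h4 : ‖h - q • g‖ ^ 2 = ‖h‖ ^ 2 - 2 * (q * inner ℝ h g) + q ^ 2 * ‖g‖ ^ 2 := by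
      rw [norm_sub_sq_real, inner_smul_right, norm_smul, mul_pow, Real.norm_eq_abs, sq_abs]
    have h5 := mul_le_mul_of_nonneg_left (hD.approx.monotone h) hq0'
    have h6 : ‖g‖ ^ 2 ≤ (δ * ‖h‖) ^ 2 := by
      have := hD.norm_gradient_le (D.wo + h)
      rw [add_sub_cancel_left] at this
      exact pow_le_pow_left₀ (norm_nonneg _) this 2
    have h7 := mul_le_mul_of_nonneg_left h6 (sq_nonneg q)
    have h8 : q * (q * δ ^ 2) ≤ q * ν := mul_le_mul_of_nonneg_left
      ((mul_le_mul_of_nonneg_right hqμ (sq_nonneg δ)).trans hsmall) hq0'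
    have h9 := mul_le_mul_of_nonneg_right h8 (sq_nonneg ‖h‖)
    rw [h4]
    nlinarith [sq_nonneg (q * ν / 2 * ‖h‖)]
  have h2 := hD.norm_meanUpdate_sub_le hμ hc i ω
  have h3 := norm_add_le (D.meanUpdate J μ i ω - (h - q • g)) (h - q • g)
  rw [sub_add_cancel] at h3
  linarith

lemma abs_inner_meanUpdate_sub_le
    (hD : D.StandingConditions P J ν δ K e lam G β σ κ γ ε Glim μ) (hμ : 0 ≤ μ) {c : ℕ}
    (hc : ∀ v : Fin N → Vec M, ‖disagreement D.p v‖ ≤ disagreementNorm (D.A₁ * D.A₂) D.p c v)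
    (i : ℕ) (j : Fin M) (ω : Ω) :
    |inner ℝ (e j) (D.meanUpdate J μ i ω) -
      (1 - D.meanStep * μ * lam j) * inner ℝ (e j) (D.centroidError μ i ω)| ≤
      (K + δ) * μ * (D.spread c μ i ω + ‖D.centroidError μ i ω‖ ^ 2) := by
  set h := D.centroidError μ i ω with hh
  set g := gradient J (D.wo + h) with hg
  have hδ : 0 ≤ δ := hD.approx.ν_pos.le.trans hD.approx.ν_le_δ
  have hq0 := hD.network.meanStep_pos
  have hK := hD.approx.K_nonneg
  have h1 : inner ℝ (e j) (D.meanUpdate J μ i ω) - (1 - D.meanStep * μ * lam j) * inner ℝ (e j) h =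
      inner ℝ (e j) (D.meanUpdate J μ i ω - (h - (D.meanStep * μ) • g)) -
      D.meanStep * μ * (inner ℝ (e j) g - lam j * inner ℝ (e j) h) := by
    simp only [inner_sub_right, inner_smul_right]
    ring
  rw [h1]
  have h2 : |inner ℝ (e j) (D.meanUpdate J μ i ω - (h - (D.meanStep * μ) • g))| ≤
      δ * μ * D.spread c μ i ω := by
    refine (abs_real_inner_le_norm _ _).trans ?_
    rw [e.orthonormal.1 j, one_mul]
    exact hD.norm_meanUpdate_sub_le hμ hc i ω
  have h3 : |D.meanStep * μ * (inner ℝ (e j) g - lam j * inner ℝ (e j) h)| ≤ μ * (K * ‖h‖ ^ 2) := by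
    rw [abs_mul, abs_of_nonneg (by positivity)]
    have h4 : D.meanStep * μ ≤ μ := mul_le_of_le_one_left hμ hD.network.meanStep_le
    exact mul_le_mul h4 (hD.approx.gradient_approx j h) (abs_nonneg _) hμ
  have h4 := abs_sub (inner ℝ (e j) (D.meanUpdate J μ i ω - (h - (D.meanStep * μ) • g)))
    (D.meanStep * μ * (inner ℝ (e j) g - lam j * inner ℝ (e j) h))
  have h5 : 0 ≤ K * μ * D.spread c μ i ω := by
    have := D.spread_nonneg c μ i ω
    positivity
  have h6 : 0 ≤ δ * μ * ‖h‖ ^ 2 := by positivity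
  linarith

end StandingConditions

end Model

lemma abs_sub_mul_le_of_le {z z' Y C W m r t B : ℝ} (hm : 0 ≤ m) (hW : 0 ≤ W) (ht : 0 ≤ t)
    (hB : 0 ≤ B) (hz : |z - m * z'| ≤ W * m * r * B) (hz' : |z' - Y| ≤ C * (r + t) * B) :
    |z - m * Y| ≤ (C + W) * m * (r + t) * B := by
  have htri := abs_sub_le z (m * z') (m * Y)
  rw [← mul_sub, abs_mul, abs_of_nonneg hm] at htri
  have h2 := mul_le_mul_of_nonneg_left hz' hm
  have h3 : 0 ≤ W * m * t * B := by positivity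
  linarith

namespace Model

variable {N M : ℕ} {Ω : Type*}

/-! ### The noise in the update of the centroid -/

lemma measurable_centroidError_past (D : Model N M Ω) (μ : ℝ) (i : ℕ) :
    Measurable[D.past μ i] (D.centroidError μ i) := by
  have h1 : Measurable[D.past μ i] fun ω => ∑ l, D.p l • D.iterate μ i l ω :=
    Finset.measurable_fun_sum _ fun l _ => (D.measurable_iterate_past μ i l).const_smul (D.p l)
  exact h1.sub measurable_const

/-- The weighted sum of the masked gradient noises. -/
noncomputable def maskedNoise (D : Model N M Ω) (μ : ℝ) (i : ℕ) (ω : Ω) : Vec M :=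
  ∑ l, D.relWeight l • mask (fun m => D.ind i l m ω) (D.noise i l (D.combined μ i l) ω)

/-- The part of the update noise that is caused by the randomness of the masks alone, which act on
the true gradients. -/
noncomputable def maskFluctuation (D : Model N M Ω) (J : Vec M → ℝ) (μ : ℝ) (i : ℕ) (ω : Ω) :
    Vec M :=
  ∑ l, D.relWeight l •
    mask (fun m => D.ind i l m ω - (1 - D.r l)) (gradient J (D.combined μ i l ω))

lemma inner_maskedNoise (D : Model N M Ω) (μ : ℝ) (i : ℕ) (v : Vec M) (ω : Ω) :
    inner ℝ v (D.maskedNoise μ i ω) = ∑ l, ∑ m, D.relWeight l * v m *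
      (D.ind i l m ω * D.noise i l (D.combined μ i l) ω m) := by
  simp only [maskedNoise, inner_sum, inner_smul_right, PiLp.inner_apply, mask, RCLike.inner_apply,
    conj_trivial, Finset.mul_sum]
  refine Finset.sum_congr rfl fun l _ => Finset.sum_congr rfl fun m _ => ?_
  ring

namespace StandingConditions

variable [MeasurableSpace Ω] {D : Model N M Ω} {P : Measure Ω}
  {J : Vec M → ℝ} {ν δ K : ℝ}
  {e : OrthonormalBasis (Fin M) ℝ (Vec M)} {lam : Fin M → ℝ} {G : Matrix (Fin M) (Fin M) ℝ}
  {β σ : Fin N → ℝ} {κ γ ε : ℝ} {Glim : Fin N → Matrix (Fin M) (Fin M) ℝ} {μ : ℝ}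

lemma measurable_meanUpdate_past
    (hD : D.StandingConditions P J ν δ K e lam G β σ κ γ ε Glim μ) (i : ℕ) :
    Measurable[D.past μ i] (D.meanUpdate J μ i) := by
  have h1 : Measurable[D.past μ i]
      fun ω => ∑ l, (D.relWeight l * (1 - D.r l)) • gradient J (D.combined μ i l ω) :=
    Finset.measurable_fun_sum _ fun l _ => (hD.continuous_gradient.measurable.comp
      (D.measurable_combined_past μ i l)).const_smul (D.relWeight l * (1 - D.r l))
  exact (D.measurable_centroidError_past μ i).sub (h1.const_smul μ)

lemma norm_maskedNoise_le (hD : D.StandingConditions P J ν δ K e lam G β σ κ γ ε Glim μ) (i : ℕ)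
    (ω : Ω) : ‖D.maskedNoise μ i ω‖ ≤ D.gradSize μ i ω :=
  hD.network.norm_sum_relWeight_smul_le (D.gradSize_nonneg μ i ω) fun l =>
    (norm_mask_le_of_zero_or_one (fun m => hD.indicator.zero_or_one i l m ω) _).trans
      ((le_add_of_nonneg_right (norm_nonneg _)).trans (D.norm_noise_add_le_gradSize μ i l ω))

lemma norm_maskFluctuation_le (hD : D.StandingConditions P J ν δ K e lam G β σ κ γ ε Glim μ)
    {c : ℕ}
    (hc : ∀ v : Fin N → Vec M, ‖disagreement D.p v‖ ≤ disagreementNorm (D.A₁ * D.A₂) D.p c v)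
    (i : ℕ) (ω : Ω) :
    ‖D.maskFluctuation J μ i ω‖ ≤ δ * (‖D.centroidError μ i ω‖ + D.spread c μ i ω) := by
  have hδ : 0 ≤ δ := hD.approx.ν_pos.le.trans hD.approx.ν_le_δ
  have hs := D.spread_nonneg c μ i ω
  refine hD.network.norm_sum_relWeight_smul_le (by positivity) fun l => ?_
  have h1 : ∀ m, |D.ind i l m ω - (1 - D.r l)| ≤ 1 := fun m => by
    have h2 := hD.network.missing_nonneg l
    have h3 := hD.network.missing_lt l
    rw [abs_le]
    rcases hD.indicator.zero_or_one i l m ω with h | h <;> rw [h] <;> constructor <;> linarith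
  refine (norm_mask_le zero_le_one h1 _).trans ?_
  rw [one_mul]
  refine (hD.norm_gradient_le _).trans ?_
  gcongr
  exact hD.network.norm_combined_sub_le hc μ i l ω

/-- Decomposition of the update noise into masked gradient noise and fluctuation of the masks. -/
lemma updateNoise_eq (hD : D.StandingConditions P J ν δ K e lam G β σ κ γ ε Glim μ) (i : ℕ)
    (ω : Ω) :
    D.updateNoise J μ i ω = μ • (D.maskedNoise μ i ω + D.maskFluctuation J μ i ω) := by
  simp only [updateNoise, maskedNoise, maskFluctuation, ← Finset.sum_add_distrib, ← smul_add]
  congr 1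
  refine Finset.sum_congr rfl fun l _ => ?_
  congr 1
  ext m
  simp only [partialGrad, mask, Model.noise, hD.cost_eq, PiLp.sub_apply, PiLp.add_apply,
    PiLp.smul_apply, smul_eq_mul]
  ring

variable [IsProbabilityMeasure P]

lemma memLp_centroidError (hD : D.StandingConditions P J ν δ K e lam G β σ κ γ ε Glim μ) (i : ℕ) :
    MemLp (D.centroidError μ i) 4 P := by
  have h1 : MemLp (fun ω => ∑ l, D.p l • D.iterate μ i l ω) 4 P :=
    memLp_finsetSum _ fun l _ => (hD.memLp_iterate i l).const_smul (D.p l)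
  exact h1.sub (memLp_const _)

lemma memLp_meanUpdate (hD : D.StandingConditions P J ν δ K e lam G β σ κ γ ε Glim μ) (i : ℕ) :
    MemLp (D.meanUpdate J μ i) 4 P := by
  have h1 : MemLp
      (fun ω => ∑ l, (D.relWeight l * (1 - D.r l)) • gradient J (D.combined μ i l ω)) 4 P :=
    memLp_finsetSum _ fun l _ => (hD.memLp_gradient (hD.isIterate_combined i l).2).const_smul
      (D.relWeight l * (1 - D.r l))
  exact (hD.memLp_centroidError i).sub (h1.const_smul μ)

lemma memLp_updateNoise (hD : D.StandingConditions P J ν δ K e lam G β σ κ γ ε Glim μ) (i : ℕ) :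
    MemLp (D.updateNoise J μ i) 4 P := by
  have h1 : MemLp (fun ω => ∑ l, D.relWeight l •
      (D.partialGrad μ i l ω - (1 - D.r l) • gradient J (D.combined μ i l ω))) 4 P :=
    memLp_finsetSum _ fun l _ => ((hD.memLp_partialGrad i l).sub
      ((hD.memLp_gradient (hD.isIterate_combined i l).2).const_smul (1 - D.r l))).const_smul
      (D.relWeight l)
  exact h1.const_smul μ

lemma memLp_gradSize (hD : D.StandingConditions P J ν δ K e lam G β σ κ γ ε Glim μ) (i : ℕ) :
    MemLp (D.gradSize μ i) 4 P :=
  memLp_finsetSum _ fun l _ =>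
    (hD.noise.memLp i l _ (hD.isIterate_combined i l)).norm.add
      ((hD.isIterate_combined i l).2.sub (memLp_const D.wo)).norm

lemma memLp_spread (hD : D.StandingConditions P J ν δ K e lam G β σ κ γ ε Glim μ) (c i : ℕ) :
    MemLp (D.spread c μ i) 4 P := by
  have hcomb : ∀ (A : Matrix (Fin N) (Fin N) ℝ) (l : Fin N),
      MemLp (fun ω => combine A (fun l => D.iterate μ i l ω) l) 4 P := fun A l =>
    memLp_finsetSum _ fun j _ => (hD.memLp_iterate i j).const_smul (A j l)
  have hcent : ∀ A : Matrix (Fin N) (Fin N) ℝ,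
      MemLp (fun ω => centroid D.p (combine A fun l => D.iterate μ i l ω)) 4 P := fun A =>
    memLp_finsetSum _ fun j _ => (hcomb A j).const_smul (D.p j)
  have hdis : ∀ A : Matrix (Fin N) (Fin N) ℝ,
      MemLp (fun ω => disagreement D.p (combine A fun l => D.iterate μ i l ω)) 4 P := fun A =>
    memLp_pi_iff.2 fun k => (hcomb A k).sub (hcent A)
  unfold spread disagreementNorm
  exact memLp_finsetSum _ fun n _ => (hdis ((D.A₁ * D.A₂) ^ n)).norm

/-- The update noise is orthogonal to every random vector that is determined by the past. -/
lemma integral_inner_updateNoise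
    (hD : D.StandingConditions P J ν δ K e lam G β σ κ γ ε Glim μ) (i : ℕ) {V : Ω → Vec M}
    (hV : Measurable[D.past μ i] V)
    (hint : ∀ m (f : Ω → ℝ), MemLp f 4 P → Integrable (fun ω => V ω m * f ω) P) :
    ∫ ω, inner ℝ (V ω) (D.updateNoise J μ i ω) ∂P = 0 := by
  have hVm : ∀ m, Measurable[D.past μ i] fun ω => V ω m := fun m =>
    (EuclideanSpace.proj (𝕜 := ℝ) m).continuous.measurable.comp hV
  have h1 : ∀ ω, inner ℝ (V ω) (D.updateNoise J μ i ω) =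
      ∑ m, ∑ l, μ * D.relWeight l * (V ω m * D.partialGrad μ i l ω m -
        V ω m * ((1 - D.r l) * gradient J (D.combined μ i l ω) m)) := by
    intro ω
    simp only [PiLp.inner_apply, updateNoise, PiLp.smul_apply, WithLp.ofLp_sum, Finset.sum_apply,
      PiLp.sub_apply, smul_eq_mul, RCLike.inner_apply, conj_trivial, Finset.mul_sum,
      Finset.sum_mul]
    refine Finset.sum_congr rfl fun m _ => Finset.sum_congr rfl fun l _ => ?_
    ring
  have hp : ∀ m l, Integrable (fun ω => V ω m * D.partialGrad μ i l ω m) P := fun m l =>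
    hint m _ (memLp_apply (hD.memLp_partialGrad i l) m)
  have hg : ∀ m l,
      Integrable (fun ω => V ω m * ((1 - D.r l) * gradient J (D.combined μ i l ω) m)) P :=
    fun m l => hint m _ ((memLp_apply (hD.memLp_gradient (hD.isIterate_combined i l).2)
      m).const_mul (1 - D.r l))
  have hpg : ∀ m l, Integrable (fun ω => μ * D.relWeight l * (V ω m * D.partialGrad μ i l ω m -
      V ω m * ((1 - D.r l) * gradient J (D.combined μ i l ω) m))) P := fun m l =>
    ((hp m l).sub (hg m l)).const_mul (μ * D.relWeight l)
  simp only [h1]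
  rw [integral_finsetSum _ fun m _ => integrable_finsetSum _ fun l _ => hpg m l]
  refine Finset.sum_eq_zero fun m _ => ?_
  rw [integral_finsetSum _ fun l _ => hpg m l]
  refine Finset.sum_eq_zero fun l _ => ?_
  rw [integral_const_mul, integral_sub (hp m l) (hg m l),
    hD.integral_mul_partialGrad l m (hVm m)
      (hint m _ (memLp_apply (hD.noise.memLp i l _ (hD.isIterate_combined i l)) m))
      (hint m _ (memLp_apply (hD.memLp_gradient (hD.isIterate_combined i l).2) m)),
    sub_self, mul_zero]

lemma integral_gradSize_pow_four_le
    (hD : D.StandingConditions P J ν δ K e lam G β σ κ γ ε Glim μ) {c : ℕ}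
    (hc : ∀ v : Fin N → Vec M, ‖disagreement D.p v‖ ≤ disagreementNorm (D.A₁ * D.A₂) D.p c v)
    (i : ℕ) :
    ∫ ω, D.gradSize μ i ω ^ 4 ∂P ≤
      (8 * N ^ 3 * ∑ l, (27 * β l ^ 4 * (1 + ‖D.wo‖ ^ 4) + σ l ^ 4 + 8)) *
      (1 + ∫ ω, ‖D.centroidError μ i ω‖ ^ 4 ∂P + ∫ ω, D.spread c μ i ω ^ 4 ∂P) := by
  have hHi := integrable_norm_pow_four (hD.memLp_centroidError i)
  have hSi := integrable_pow_four (hD.memLp_spread c i)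
  have hsi := fun l =>
    integrable_norm_pow_four (hD.noise.memLp i l _ (hD.isIterate_combined i l))
  set x := ∫ ω, ‖D.centroidError μ i ω‖ ^ 4 ∂P with hx
  set y := ∫ ω, D.spread c μ i ω ^ 4 ∂P with hy
  have hpt : ∀ ω, D.gradSize μ i ω ^ 4 ≤ ∑ l, 8 * (N : ℝ) ^ 3 *
      (‖D.noise i l (D.combined μ i l) ω‖ ^ 4 +
        8 * (‖D.centroidError μ i ω‖ ^ 4 + D.spread c μ i ω ^ 4)) := by
    intro ω
    rw [← Finset.mul_sum]
    have h1 := pow_sum_le_card_mul_sum_pow (s := Finset.univ)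
      (f := fun l => ‖D.noise i l (D.combined μ i l) ω‖ + ‖D.combined μ i l ω - D.wo‖)
      (fun l _ => add_nonneg (norm_nonneg _) (norm_nonneg _)) 3
    rw [Finset.card_univ, Fintype.card_fin] at h1
    refine h1.trans ?_
    rw [mul_comm (8 : ℝ), mul_assoc, Finset.mul_sum _ _ (8 : ℝ)]
    refine mul_le_mul_of_nonneg_left (Finset.sum_le_sum fun l _ => ?_) (by positivity)
    refine (add_pow_four_le _ _).trans ?_
    have h2 := pow_le_pow_left₀ (norm_nonneg _) (hD.network.norm_combined_sub_le hc μ i l ω) 4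
    have h3 := add_pow_four_le ‖D.centroidError μ i ω‖ (D.spread c μ i ω)
    linarith
  have i0 : Integrable (fun ω =>
      8 * (‖D.centroidError μ i ω‖ ^ 4 + D.spread c μ i ω ^ 4)) P := (hHi.add hSi).const_mul 8
  have i1 : ∀ l, Integrable (fun ω => 8 * (N : ℝ) ^ 3 *
      (‖D.noise i l (D.combined μ i l) ω‖ ^ 4 +
        8 * (‖D.centroidError μ i ω‖ ^ 4 + D.spread c μ i ω ^ 4))) P := fun l =>
    ((hsi l).add i0).const_mul _
  refine (integral_mono (integrable_pow_four (hD.memLp_gradSize i))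
    (integrable_finsetSum _ fun l _ => i1 l) hpt).trans ?_
  rw [integral_finsetSum _ fun l _ => i1 l, Finset.mul_sum, Finset.sum_mul]
  refine Finset.sum_le_sum fun l _ => ?_
  rw [integral_const_mul, integral_add (hsi l) i0, integral_const_mul, integral_add hHi hSi]
  have h1 := hD.integral_noise_pow_four_le_of_near (k := l) (hD.isIterate_combined i l)
    (hD.memLp_centroidError i).norm (hD.memLp_spread c i) (fun ω => norm_nonneg _)
    (fun ω => D.spread_nonneg c μ i ω) fun ω => hD.network.norm_combined_sub_le hc μ i l ω
  rw [mul_assoc (8 * (N : ℝ) ^ 3)]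
  refine mul_le_mul_of_nonneg_left ?_ (by positivity)
  rw [← hx, ← hy] at h1 ⊢
  linarith

/-- Cross terms between the noise of different agents vanish, and the indicators of an agent enter
only through their second moments. -/
lemma integral_sq_maskedNoise
    (hD : D.StandingConditions P J ν δ K e lam G β σ κ γ ε Glim μ) (i : ℕ) (v : Vec M) :
    ∫ ω, (∑ l, ∑ m, D.relWeight l * v m *
      (D.ind i l m ω * D.noise i l (D.combined μ i l) ω m)) ^ 2 ∂P =
    ∑ l, D.relWeight l ^ 2 * ∑ m, ∑ n, (if m = n then 1 - D.r l else (1 - D.r l) ^ 2) *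
      (v m * v n *
        ∫ ω, D.noise i l (D.combined μ i l) ω m * D.noise i l (D.combined μ i l) ω n ∂P) := by
  set s : Fin N → Fin M → Ω → ℝ := fun l m ω => D.noise i l (D.combined μ i l) ω m with hs
  have hmem : ∀ l m, MemLp (fun ω => D.ind i l m ω * s l m ω) 2 P := by
    intro l m
    have h1 : MemLp (s l m) 2 P := (memLp_apply (hD.noise.memLp i l _
      (hD.isIterate_combined i l)) m).mono_exponent (by norm_num)
    refine h1.mono ((hD.measurable_ind i l m).aestronglyMeasurable.mul h1.1)
      (Eventually.of_forall fun ω => ?_)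
    rcases hD.indicator.zero_or_one i l m ω with h | h <;> simp [h]
  have hprod : ∀ l m k n, ∫ ω, (D.ind i l m ω * s l m ω) * (D.ind i k n ω * s k n ω) ∂P =
      (∫ ω, D.ind i l m ω * D.ind i k n ω ∂P) * ∫ ω, s l m ω * s k n ω ∂P := by
    intro l m k n
    rw [← hD.integral_indicators_mul (i := i) (I := fun ω => D.ind i l m ω * D.ind i k n ω)
      (Z := fun ω => s l m ω * s k n ω)
      ((measurable_ind_iSup D i l m).mul (measurable_ind_iSup D i k n))
      ((hD.measurable_noise_present i l m).mul (hD.measurable_noise_present i k n))]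
    refine integral_congr_ae (Eventually.of_forall fun ω => ?_)
    simp only
    ring
  have hexp : ∀ ω, (∑ l, ∑ m, D.relWeight l * v m * (D.ind i l m ω * s l m ω)) ^ 2 =
      ∑ l, ∑ k, ∑ m, ∑ n, D.relWeight l * v m * (D.relWeight k * v n) *
        ((D.ind i l m ω * s l m ω) * (D.ind i k n ω * s k n ω)) := by
    intro ω
    rw [sq, Finset.sum_mul_sum]
    refine Finset.sum_congr rfl fun l _ => Finset.sum_congr rfl fun k _ => ?_
    rw [Finset.sum_mul_sum]
    refine Finset.sum_congr rfl fun m _ => Finset.sum_congr rfl fun n _ => ?_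
    ring
  have hint : ∀ l k m n, Integrable (fun ω => D.relWeight l * v m * (D.relWeight k * v n) *
        ((D.ind i l m ω * s l m ω) * (D.ind i k n ω * s k n ω))) P := fun l k m n =>
    ((hmem l m).integrable_mul (hmem k n)).const_mul _
  have hexp' : ∫ ω, (∑ l, ∑ m, D.relWeight l * v m * (D.ind i l m ω * s l m ω)) ^ 2 ∂P =
      ∑ l, ∑ k, ∑ m, ∑ n, D.relWeight l * v m * (D.relWeight k * v n) *
        ((∫ ω, D.ind i l m ω * D.ind i k n ω ∂P) * ∫ ω, s l m ω * s k n ω ∂P) := by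
    simp only [hexp]
    rw [integral_finsetSum _ fun l _ => integrable_finsetSum _ fun k _ =>
      integrable_finsetSum _ fun m _ => integrable_finsetSum _ fun n _ => hint l k m n]
    refine Finset.sum_congr rfl fun l _ => ?_
    rw [integral_finsetSum _ fun k _ => integrable_finsetSum _ fun m _ =>
      integrable_finsetSum _ fun n _ => hint l k m n]
    refine Finset.sum_congr rfl fun k _ => ?_
    rw [integral_finsetSum _ fun m _ => integrable_finsetSum _ fun n _ => hint l k m n]
    refine Finset.sum_congr rfl fun m _ => ?_
    rw [integral_finsetSum _ fun n _ => hint l k m n]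
    refine Finset.sum_congr rfl fun n _ => ?_
    rw [integral_const_mul, hprod]
  rw [hexp']
  refine Finset.sum_congr rfl fun l _ => ?_
  rw [Finset.sum_eq_single l]
  · rw [Finset.mul_sum]
    refine Finset.sum_congr rfl fun m _ => ?_
    rw [Finset.mul_sum]
    refine Finset.sum_congr rfl fun n _ => ?_
    rw [hD.integral_ind_mul_ind]
    ring
  · intro k _ hkl
    refine Finset.sum_eq_zero fun m _ => Finset.sum_eq_zero fun n _ => ?_
    rw [hD.integral_noise_mul_noise_eq_zero hkl.symm (hD.isIterate_combined i l)
      (hD.isIterate_combined i k), mul_zero, mul_zero]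
  · simp

lemma memLp_inner_maskedNoise (hD : D.StandingConditions P J ν δ K e lam G β σ κ γ ε Glim μ)
    (i : ℕ) (v : Vec M) : MemLp (fun ω => inner ℝ v (D.maskedNoise μ i ω)) 2 P := by
  have h1 : MemLp (fun ω => ∑ l, ∑ m, D.relWeight l * v m *
      (D.ind i l m ω * D.noise i l (D.combined μ i l) ω m)) 4 P := by
    refine memLp_finsetSum _ fun l _ => memLp_finsetSum _ fun m _ => MemLp.const_mul ?_ _
    have h2 := memLp_apply (hD.noise.memLp i l _ (hD.isIterate_combined i l)) m
    refine h2.mono ((hD.measurable_ind i l m).aestronglyMeasurable.mul h2.1)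
      (Eventually.of_forall fun ω => ?_)
    rcases hD.indicator.zero_or_one i l m ω with h | h <;> simp [h]
  simp only [inner_maskedNoise]
  exact h1.mono_exponent (by norm_num)

lemma abs_integral_sq_maskedNoise_sub_le
    (hD : D.StandingConditions P J ν δ K e lam G β σ κ γ ε Glim μ) (hμ : 0 < μ) (hμ1 : μ ≤ 1)
    {c : ℕ}
    (hc : ∀ v : Fin N → Vec M, ‖disagreement D.p v‖ ≤ disagreementNorm (D.A₁ * D.A₂) D.p c v)
    (i : ℕ) {v : Vec M} (hv : ‖v‖ = 1) :
    |∫ ω, inner ℝ v (D.maskedNoise μ i ω) ^ 2 ∂P - D.noiseVariance G v| ≤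
      (∑ l, (M : ℝ) ^ 2 *
        (8 * κ + 16 / ε ^ 4 + (27 * β l ^ 4 * (1 + ‖D.wo‖ ^ 4) + σ l ^ 4))) * (√μ + √μ ^ γ) *
      (1 + (∫ ω, ‖D.centroidError μ i ω‖ ^ 4 ∂P) / μ ^ 2 +
        (∫ ω, D.spread c μ i ω ^ 4 ∂P) / μ ^ 4) := by
  have hN := hD.network
  have hvm : ∀ m, |v m| ≤ 1 := fun m => (abs_apply_le_norm v m).trans hv.le
  simp only [inner_maskedNoise]
  rw [hD.integral_sq_maskedNoise i v, noiseVariance, ← Finset.sum_sub_distrib, Finset.sum_mul,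
    Finset.sum_mul]
  refine (Finset.abs_sum_le_sum_abs _ _).trans (Finset.sum_le_sum fun l _ => ?_)
  rw [← mul_sub, ← Finset.sum_sub_distrib, abs_mul, abs_of_nonneg (sq_nonneg _)]
  have hw : D.relWeight l ^ 2 ≤ 1 := pow_le_one₀ (hN.relWeight_nonneg l) (hN.relWeight_le l)
  refine (mul_le_of_le_one_left (abs_nonneg _) hw).trans ?_
  refine (Finset.abs_sum_le_sum_abs _ _).trans ?_
  have hone : ∀ m n, |(if m = n then 1 - D.r l else (1 - D.r l) ^ 2) * (v m * v n *
      ∫ ω, D.noise i l (D.combined μ i l) ω m * D.noise i l (D.combined μ i l) ω n ∂P) -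
      (if m = n then 1 - D.r l else (1 - D.r l) ^ 2) * (v m * v n * G m n)| ≤
      (8 * κ + 16 / ε ^ 4 + (27 * β l ^ 4 * (1 + ‖D.wo‖ ^ 4) + σ l ^ 4)) * (√μ + √μ ^ γ) *
      (1 + (∫ ω, ‖D.centroidError μ i ω‖ ^ 4 ∂P) / μ ^ 2 +
        (∫ ω, D.spread c μ i ω ^ 4 ∂P) / μ ^ 4) := by
    intro m n
    have h1 := hD.abs_integral_noise_sub_le (k := l) hμ hμ1 (hD.isIterate_combined i l)
      (hD.memLp_centroidError i).norm (hD.memLp_spread c i) (fun ω => norm_nonneg _)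
      (fun ω => D.spread_nonneg c μ i ω) (fun ω => hN.norm_combined_sub_le hc μ i l ω) m n
    rw [← mul_sub, ← mul_sub, abs_mul, abs_mul, abs_mul]
    have h2 : |if m = n then 1 - D.r l else (1 - D.r l) ^ 2| ≤ 1 := by
      have h3 : 0 ≤ 1 - D.r l := sub_nonneg.2 (hN.missing_lt l).le
      have h4 : 1 - D.r l ≤ 1 := by linarith [hN.missing_nonneg l]
      split_ifs
      · rwa [abs_of_nonneg h3]
      · rw [abs_of_nonneg (sq_nonneg _)]
        exact pow_le_one₀ h3 h4
    refine (mul_le_of_le_one_left (by positivity) h2).trans ?_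
    exact (mul_le_of_le_one_left (abs_nonneg _)
      (mul_le_one₀ (hvm m) (abs_nonneg _) (hvm n))).trans h1
  set b : ℝ := (8 * κ + 16 / ε ^ 4 + (27 * β l ^ 4 * (1 + ‖D.wo‖ ^ 4) + σ l ^ 4)) *
    (√μ + √μ ^ γ) * (1 + (∫ ω, ‖D.centroidError μ i ω‖ ^ 4 ∂P) / μ ^ 2 +
      (∫ ω, D.spread c μ i ω ^ 4 ∂P) / μ ^ 4) with hb
  calc _ ≤ ∑ _m : Fin M, ∑ _n : Fin M, b := Finset.sum_le_sum fun m _ => by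
        rw [← Finset.sum_sub_distrib]
        exact (Finset.abs_sum_le_sum_abs _ _).trans (Finset.sum_le_sum fun n _ => hone m n)
    _ = _ := by
        simp only [Finset.sum_const, Finset.card_univ, Fintype.card_fin, nsmul_eq_mul, hb]
        ring

/-- Perturbation of a square: `a` of the size `A` is perturbed by `b` of the size
`δ (H + S)`, where `H` and `S` are of the orders `√μ` and `μ`. -/
lemma abs_add_sq_sub_sq_le {μ H S A a b δ : ℝ} (hμ : 0 < μ) (hμ1 : μ ≤ 1) (hδ : 0 ≤ δ)
    (hH : 0 ≤ H) (hS : 0 ≤ S) (ha : |a| ≤ A) (hb : |b| ≤ δ * (H + S)) :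
    |(a + b) ^ 2 - a ^ 2| ≤ δ * √μ * (1 + A ^ 4) + (4 * δ * √μ + 4 * δ ^ 2 * √μ) *
      (1 + H ^ 4 / μ ^ 2 + S ^ 4 / μ ^ 4) := by
  have hA : 0 ≤ A := (abs_nonneg a).trans ha
  have hr : 0 < √μ := Real.sqrt_pos.2 hμ
  have hrr : √μ * √μ = μ := Real.mul_self_sqrt hμ.le
  have hr1 : √μ ≤ 1 := Real.sqrt_le_one.2 hμ1
  obtain ⟨-, -, hH2, -, hS2, -, -⟩ := scaled_bounds hμ hμ1 hH hS
  set B := 1 + H ^ 4 / μ ^ 2 + S ^ 4 / μ ^ 4 with hB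
  have hB0 : 0 ≤ B := by positivity
  set W := H + S with hW
  have hW0 : 0 ≤ W := by positivity
  have hW2 : W ^ 2 ≤ 4 * μ * B := by
    have h1 : W ^ 2 ≤ 2 * (H ^ 2 + S ^ 2) := by
      rw [hW]
      nlinarith [sq_nonneg (H - S)]
    have h2 : μ ^ 2 * B ≤ μ * B := by
      gcongr
      nlinarith
    linarith
  have hAW : 2 * (A * W) ≤ √μ * (1 + A ^ 4) + 4 * √μ * B := by
    have h1 : 2 * (A * W) ≤ √μ * A ^ 2 + W ^ 2 / √μ := by
      have h2 : √μ * A ^ 2 + W ^ 2 / √μ - 2 * (A * W) = (√μ * A - W) ^ 2 / √μ := by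
        field_simp
        ring
      have h3 : 0 ≤ (√μ * A - W) ^ 2 / √μ := by positivity
      linarith
    have h4 : W ^ 2 / √μ ≤ 4 * √μ * B := by
      rw [div_le_iff₀ hr]
      calc W ^ 2 ≤ 4 * μ * B := hW2
        _ = 4 * (√μ * √μ) * B := by rw [hrr]
        _ = _ := by ring
    have h5 : A ^ 2 ≤ 1 + A ^ 4 := by
      nlinarith [sq_nonneg (A ^ 2 - 1), sq_nonneg (A ^ 2)]
    have h6 := mul_le_mul_of_nonneg_left h5 hr.le
    linarith
  have h1 : (a + b) ^ 2 - a ^ 2 = 2 * (a * b) + b ^ 2 := by ring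
  rw [h1]
  refine (abs_add_le _ _).trans ?_
  rw [abs_mul, abs_mul, abs_two, abs_pow]
  have h4 : |a| * |b| ≤ A * (δ * W) := mul_le_mul ha hb (abs_nonneg _) hA
  have h5 : |b| ^ 2 ≤ (δ * W) ^ 2 := by gcongr
  have h6 : δ ^ 2 * W ^ 2 ≤ δ ^ 2 * (4 * √μ * B) := by
    gcongr
    refine hW2.trans ?_
    have : μ ≤ √μ := by nlinarith
    gcongr
  have h7 := mul_le_mul_of_nonneg_left hAW hδ
  linarith

/-- The fluctuation of the masks does not contribute to the variance of the update noise to leading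
order, since the true gradients are small. -/
lemma abs_integral_sq_updateNoise_sub_maskedNoise_le
    (hD : D.StandingConditions P J ν δ K e lam G β σ κ γ ε Glim μ) (hμ : 0 < μ) (hμ1 : μ ≤ 1)
    {c : ℕ}
    (hc : ∀ v : Fin N → Vec M, ‖disagreement D.p v‖ ≤ disagreementNorm (D.A₁ * D.A₂) D.p c v)
    (i : ℕ) {v : Vec M} (hv : ‖v‖ = 1) {KA : ℝ} (hKA : 0 ≤ KA)
    (hA : ∫ ω, D.gradSize μ i ω ^ 4 ∂P ≤
      KA * (1 + ∫ ω, ‖D.centroidError μ i ω‖ ^ 4 ∂P + ∫ ω, D.spread c μ i ω ^ 4 ∂P)) :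
    |∫ ω, inner ℝ v (D.updateNoise J μ i ω) ^ 2 ∂P -
      μ ^ 2 * ∫ ω, inner ℝ v (D.maskedNoise μ i ω) ^ 2 ∂P| ≤
      (δ * (5 + KA) + 4 * δ ^ 2) * μ ^ 2 * √μ *
      (1 + (∫ ω, ‖D.centroidError μ i ω‖ ^ 4 ∂P) / μ ^ 2 +
        (∫ ω, D.spread c μ i ω ^ 4 ∂P) / μ ^ 4) := by
  have hδ : 0 ≤ δ := hD.approx.ν_pos.le.trans hD.approx.ν_le_δ
  have hHm := (hD.memLp_centroidError i).norm
  have hSm := hD.memLp_spread c i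
  have hAi := integrable_pow_four (hD.memLp_gradSize i)
  have hx : 0 ≤ ∫ ω, ‖D.centroidError μ i ω‖ ^ 4 ∂P := integral_nonneg fun ω => by positivity
  have hy : 0 ≤ ∫ ω, D.spread c μ i ω ^ 4 ∂P := integral_nonneg fun ω => by
    have := D.spread_nonneg c μ i ω
    positivity
  have hxyB := one_add_le_scaled hμ hμ1 hx hy
  have hBi := integrable_scaled hHm hSm μ
  have hBint := integral_scaled hHm hSm μ
  have habs : ∀ w : Vec M, |inner ℝ v w| ≤ ‖w‖ := fun w => by
    simpa [hv] using abs_real_inner_le_norm v w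
  have hnm : Integrable (fun ω => inner ℝ v (D.updateNoise J μ i ω) ^ 2) P :=
    (((hD.memLp_updateNoise i).const_inner v).mono_exponent (by norm_num)).integrable_sq
  have hmm := (hD.memLp_inner_maskedNoise i v).integrable_sq.const_mul (μ ^ 2)
  have hpt : ∀ ω, |inner ℝ v (D.updateNoise J μ i ω) ^ 2 -
      μ ^ 2 * inner ℝ v (D.maskedNoise μ i ω) ^ 2| ≤
      μ ^ 2 * (δ * √μ) * (1 + D.gradSize μ i ω ^ 4) +
      μ ^ 2 * (4 * δ * √μ + 4 * δ ^ 2 * √μ) *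
        (1 + ‖D.centroidError μ i ω‖ ^ 4 / μ ^ 2 + D.spread c μ i ω ^ 4 / μ ^ 4) := by
    intro ω
    have h1 := abs_add_sq_sub_sq_le hμ hμ1 hδ (norm_nonneg (D.centroidError μ i ω))
      (D.spread_nonneg c μ i ω) ((habs _).trans (hD.norm_maskedNoise_le i ω))
      ((habs _).trans (hD.norm_maskFluctuation_le hc i ω))
    rw [hD.updateNoise_eq, inner_smul_right, inner_add_right, mul_pow, ← mul_sub, abs_mul,
      abs_of_nonneg (sq_nonneg μ)]
    have h2 := mul_le_mul_of_nonneg_left h1 (sq_nonneg μ)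
    linarith
  have i1 : Integrable (fun ω => μ ^ 2 * (δ * √μ) * (1 + D.gradSize μ i ω ^ 4)) P :=
    ((integrable_const _).add hAi).const_mul _
  have i2 := hBi.const_mul (μ ^ 2 * (4 * δ * √μ + 4 * δ ^ 2 * √μ))
  rw [← integral_const_mul, ← integral_sub hnm hmm]
  refine (abs_integral_le_integral_abs.trans (integral_mono (hnm.sub hmm).abs
    (i1.add i2) hpt)).trans ?_
  rw [integral_add' i1 i2, integral_const_mul, integral_const_mul, hBint,
    integral_add (integrable_const _) hAi]
  simp only [integral_const, probReal_univ, smul_eq_mul, mul_one]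
  set x := ∫ ω, ‖D.centroidError μ i ω‖ ^ 4 ∂P
  set y := ∫ ω, D.spread c μ i ω ^ 4 ∂P
  set B := 1 + x / μ ^ 2 + y / μ ^ 4
  have h1 : 1 + ∫ ω, D.gradSize μ i ω ^ 4 ∂P ≤ (1 + KA) * B := by
    have h2 := mul_le_mul_of_nonneg_left hxyB hKA
    linarith
  have h3 := mul_le_mul_of_nonneg_left h1 (show 0 ≤ μ ^ 2 * (δ * √μ) by positivity)
  linarith

lemma abs_integral_sq_updateNoise_sub_le
    (hD : D.StandingConditions P J ν δ K e lam G β σ κ γ ε Glim μ) (hμ : 0 < μ) (hμ1 : μ ≤ 1)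
    {c : ℕ}
    (hc : ∀ v : Fin N → Vec M, ‖disagreement D.p v‖ ≤ disagreementNorm (D.A₁ * D.A₂) D.p c v)
    (i : ℕ) {v : Vec M} (hv : ‖v‖ = 1) {KA : ℝ} (hKA : 0 ≤ KA)
    (hA : ∫ ω, D.gradSize μ i ω ^ 4 ∂P ≤
      KA * (1 + ∫ ω, ‖D.centroidError μ i ω‖ ^ 4 ∂P + ∫ ω, D.spread c μ i ω ^ 4 ∂P)) :
    |∫ ω, inner ℝ v (D.updateNoise J μ i ω) ^ 2 ∂P - μ ^ 2 * D.noiseVariance G v| ≤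
      ((∑ l, (M : ℝ) ^ 2 *
        (8 * κ + 16 / ε ^ 4 + (27 * β l ^ 4 * (1 + ‖D.wo‖ ^ 4) + σ l ^ 4))) +
        (δ * (5 + KA) + 4 * δ ^ 2)) * μ ^ 2 * (√μ + √μ ^ γ) *
      (1 + (∫ ω, ‖D.centroidError μ i ω‖ ^ 4 ∂P) / μ ^ 2 +
        (∫ ω, D.spread c μ i ω ^ 4 ∂P) / μ ^ 4) := by
  have hδ : 0 ≤ δ := hD.approx.ν_pos.le.trans hD.approx.ν_le_δ
  have hrest := hD.abs_integral_sq_updateNoise_sub_maskedNoise_le hμ hμ1 hc i hv hKA hA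
  have hmain := hD.abs_integral_sq_maskedNoise_sub_le hμ hμ1 hc i hv
  have hx : 0 ≤ ∫ ω, ‖D.centroidError μ i ω‖ ^ 4 ∂P := integral_nonneg fun ω => by positivity
  have hy : 0 ≤ ∫ ω, D.spread c μ i ω ^ 4 ∂P := integral_nonneg fun ω => by
    have := D.spread_nonneg c μ i ω
    positivity
  have hB : 0 ≤ 1 + (∫ ω, ‖D.centroidError μ i ω‖ ^ 4 ∂P) / μ ^ 2 +
      (∫ ω, D.spread c μ i ω ^ 4 ∂P) / μ ^ 4 :=
    add_nonneg (add_nonneg zero_le_one (div_nonneg hx (sq_nonneg μ)))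
      (div_nonneg hy (by positivity))
  exact abs_sub_mul_le_of_le (sq_nonneg μ) (by positivity) (by positivity) hB hrest hmain

/-- The constant of `StandingConditions.noisyStep`. -/
noncomputable def stepConstant (D : Model N M Ω) (δ K κ ε : ℝ) (β σ : Fin N → ℝ) (c : ℕ) : ℝ :=
  2 * c * (1 + δ) + (1 + 2 * δ) + (K + δ) +
    8 * N ^ 3 * (∑ l, (27 * β l ^ 4 * (1 + ‖D.wo‖ ^ 4) + σ l ^ 4 + 8)) +
    ((∑ l, (M : ℝ) ^ 2 * (8 * κ + 16 / ε ^ 4 + (27 * β l ^ 4 * (1 + ‖D.wo‖ ^ 4) + σ l ^ 4))) +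
      (δ * (5 + 8 * N ^ 3 * ∑ l, (27 * β l ^ 4 * (1 + ‖D.wo‖ ^ 4) + σ l ^ 4 + 8)) + 4 * δ ^ 2))

/-- One time step of the diffusion strategy satisfies the hypotheses of the moment recursions, with
constants that depend neither on the time nor on the step-size. -/
lemma noisyStep (hD : D.StandingConditions P J ν δ K e lam G β σ κ γ ε Glim μ)
    (hμ : 0 < μ) (hμ1 : μ ≤ 1) (hsmall : μ * δ ^ 2 ≤ ν) (hsmall' : μ * ν ≤ 2) {c : ℕ} {ρ : ℝ}
    (hc : ∀ v : Fin N → Vec M, ‖disagreement D.p v‖ ≤ disagreementNorm (D.A₁ * D.A₂) D.p c v)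
    (hρ : ∀ v : Fin N → Vec M, disagreementNorm (D.A₁ * D.A₂) D.p c
      (combine (D.A₁ * D.A₂) v) ≤ ρ * disagreementNorm (D.A₁ * D.A₂) D.p c v) (i : ℕ) :
    NoisyStep P e lam (D.meanStep * ν / 2) ρ (stepConstant D δ K κ ε β σ c) D.meanStep μ
      (√μ + √μ ^ γ) (fun j => D.noiseVariance G (e j)) (D.centroidError μ i)
      (D.centroidError μ (i + 1)) (D.meanUpdate J μ i) (D.updateNoise J μ i)
      (D.spread c μ i) (D.spread c μ (i + 1)) (D.gradSize μ i) := by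
  have hδ : 0 ≤ δ := hD.approx.ν_pos.le.trans hD.approx.ν_le_δ
  have hK := hD.approx.K_nonneg
  have hκ := hD.κ_nonneg
  have hε := hD.ε_pos
  have hum := hD.memLp_meanUpdate i
  have hnm := hD.memLp_updateNoise i
  have hA := hD.integral_gradSize_pow_four_le hc i
  have hvar := fun j => hD.abs_integral_sq_updateNoise_sub_le hμ hμ1 hc i (e.orthonormal.1 j)
    (KA := 8 * N ^ 3 * ∑ l, (27 * β l ^ 4 * (1 + ‖D.wo‖ ^ 4) + σ l ^ 4 + 8))
    (by positivity) hA
  have hx : 0 ≤ ∫ ω, ‖D.centroidError μ i ω‖ ^ 4 ∂P := integral_nonneg fun ω => by positivity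
  have hy : 0 ≤ ∫ ω, D.spread c μ i ω ^ 4 ∂P := integral_nonneg fun ω => by
    have := D.spread_nonneg c μ i ω
    positivity
  have hS := fun ω => D.spread_nonneg c μ i ω
  have hG := fun ω => D.gradSize_nonneg μ i ω
  have hKA : 0 ≤ 8 * (N : ℝ) ^ 3 * ∑ l, (27 * β l ^ 4 * (1 + ‖D.wo‖ ^ 4) + σ l ^ 4 + 8) := by
    positivity
  have hV : 0 ≤ ∑ l, (M : ℝ) ^ 2 *
    (8 * κ + 16 / ε ^ 4 + (27 * β l ^ 4 * (1 + ‖D.wo‖ ^ 4) + σ l ^ 4)) := by positivity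
  have hconst : stepConstant D δ K κ ε β σ c = 2 * c * (1 + δ) + (1 + 2 * δ) + (K + δ) +
    8 * N ^ 3 * (∑ l, (27 * β l ^ 4 * (1 + ‖D.wo‖ ^ 4) + σ l ^ 4 + 8)) +
    ((∑ l, (M : ℝ) ^ 2 * (8 * κ + 16 / ε ^ 4 + (27 * β l ^ 4 * (1 + ‖D.wo‖ ^ 4) + σ l ^ 4))) +
      (δ * (5 + 8 * N ^ 3 * ∑ l, (27 * β l ^ 4 * (1 + ‖D.wo‖ ^ 4) + σ l ^ 4 + 8)) + 4 * δ ^ 2)) :=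
    rfl
  generalize stepConstant D δ K κ ε β σ c = C at *
  generalize 8 * (N : ℝ) ^ 3 * ∑ l, (27 * β l ^ 4 * (1 + ‖D.wo‖ ^ 4) + σ l ^ 4 + 8) = KA at *
  generalize ∑ l, (M : ℝ) ^ 2 *
    (8 * κ + 16 / ε ^ 4 + (27 * β l ^ 4 * (1 + ‖D.wo‖ ^ 4) + σ l ^ 4)) = V at *
  have hW : 0 ≤ δ * (5 + KA) + 4 * δ ^ 2 := by positivity
  have hcδ : 0 ≤ 2 * c * (1 + δ) := by positivity
  have hC1 : 2 * c * (1 + δ) ≤ C := by linarith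
  have hC2 : 1 + 2 * δ ≤ C := by linarith
  have hC3 : K + δ ≤ C := by linarith
  have hC4 : KA ≤ C := by linarith
  have hC5 : V + (δ * (5 + KA) + 4 * δ ^ 2) ≤ C := by linarith
  refine
    { memLp_h := hD.memLp_centroidError i
      memLp_u := hum
      memLp_n := hnm
      memLp_S := hD.memLp_spread c i
      memLp_S' := hD.memLp_spread c (i + 1)
      memLp_A := hD.memLp_gradSize i
      S_nonneg := hS
      S'_nonneg := fun ω => D.spread_nonneg c μ (i + 1) ω
      eq_sub := fun ω => hD.network.centroidError_succ_eq J μ i ω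
      S'_le := fun ω => (hD.spread_succ_le hμ.le hρ i ω).trans (by gcongr; exact hG ω)
      norm_n_le := fun ω => (hD.norm_updateNoise_le hμ.le i ω).trans (by gcongr; exact hG ω)
      norm_u_le := fun ω => (hD.norm_meanUpdate_le hμ.le hc hsmall hsmall' i ω).trans (by
        gcongr
        · exact hS ω
        · linarith)
      inner_u := fun j ω => (hD.abs_inner_meanUpdate_sub_le hμ.le hc i j ω).trans (by
        have := hS ω
        gcongr)
      moment_A := hA.trans (by gcongr)
      centred := ?_
      centred_inner := fun j => ?_
      variance := fun j => (hvar j).trans (by gcongr) }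
  · have hu := hD.measurable_meanUpdate_past i
    have hU : Measurable[D.past μ i] fun ω => ‖D.meanUpdate J μ i ω‖ ^ 2 • D.meanUpdate J μ i ω :=
      (show Measurable fun v : Vec M => ‖v‖ ^ 2 • v by fun_prop).comp hu
    have h1 := hD.integral_inner_updateNoise i (V := fun ω => ‖D.meanUpdate J μ i ω‖ ^ 2 •
      D.meanUpdate J μ i ω) hU fun m f hf => ?_
    · simpa only [real_inner_smul_left] using h1
    · refine ((integrable_norm_pow_four hum).add (integrable_pow_four hf)).mono'
        (((hum.1.norm.pow 2).mul (memLp_apply hum m).1).mul hf.1)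
        (Eventually.of_forall fun ω => ?_)
      simp only [PiLp.smul_apply, smul_eq_mul, Pi.add_apply, norm_mul, norm_pow,
        Real.norm_eq_abs]
      have h2 := abs_apply_le_norm (D.meanUpdate J μ i ω) m
      have h3 : f ω ^ 4 = |f ω| ^ 4 := (Even.pow_abs (by decide) _).symm
      rw [h3, abs_norm]
      generalize ‖D.meanUpdate J μ i ω‖ = U at *
      have hU : 0 ≤ U := (abs_nonneg _).trans h2
      refine (mul_le_mul_of_nonneg_right (mul_le_mul_of_nonneg_left h2 (sq_nonneg U))
        (abs_nonneg _)).trans ?_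
      generalize |f ω| = F
      nlinarith [sq_nonneg (U * (U - F)), sq_nonneg (U ^ 2 - F ^ 2), sq_nonneg (U * F)]
  · have h1 := hD.integral_inner_updateNoise i (V := fun ω =>
      inner ℝ (e j) (D.meanUpdate J μ i ω) • e j) ?_ fun m f hf => ?_
    · simpa only [real_inner_smul_left] using h1
    · have hu := hD.measurable_meanUpdate_past i
      exact (show Measurable fun v : Vec M => inner ℝ (e j) v • e j by fun_prop).comp hu
    · have h2 : MemLp (fun ω => inner ℝ (e j) (D.meanUpdate J μ i ω)) 2 P :=
        (hum.const_inner (e j)).mono_exponent (by norm_num)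
      have h3 := (h2.integrable_mul (hf.mono_exponent (by norm_num : (2 : ℝ≥0∞) ≤ 4))).mul_const
        (e j m)
      refine h3.congr (Eventually.of_forall fun ω => ?_)
      simp only [Pi.mul_apply, PiLp.smul_apply, smul_eq_mul]
      ring

end StandingConditions

end Model

/-! ### The iterated limit over time and step-size -/

/-- A limit in time that is uniform enough in the step-size: the filter `l.curry l'` makes time go
to infinity first. -/
lemma tendsto_limsup_of_tendsto_curry {α β : Type*} {l : Filter α} {l' : Filter β} [l'.NeBot]
    {f : α → β → ℝ≥0∞} {L : ℝ≥0∞}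
    (h : Tendsto (fun z : α × β => f z.1 z.2) (l.curry l') (𝓝 L)) :
    Tendsto (fun a => limsup (f a) l') l (𝓝 L) := by
  refine tendsto_order.2 ⟨fun b hb => ?_, fun b hb => ?_⟩
  · obtain ⟨b', hb, hb'⟩ := exists_between hb
    filter_upwards [eventually_curry_iff.1 (h.eventually (lt_mem_nhds hb'))] with a ha
    exact hb.trans_le (le_limsup_of_frequently_le' (ha.mono fun _ h => h.le).frequently)
  · obtain ⟨b', hb', hb⟩ := exists_between hb
    filter_upwards [eventually_curry_iff.1 (h.eventually (gt_mem_nhds hb'))] with a ha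
    exact (limsup_le_of_le (h := ha.mono fun _ h => h.le)).trans_lt hb

lemma tendsto_fst_curry {α β : Type*} {l : Filter α} {l' : Filter β} :
    Tendsto Prod.fst (l.curry l') l :=
  tendsto_fst.mono_left curry_le_prod

instance curry_neBot {α β : Type*} {l : Filter α} {l' : Filter β} [l.NeBot] [l'.NeBot] :
    (l.curry l').NeBot := by
  refine ⟨fun h => ?_⟩
  have h1 : ∀ᶠ _ in l.curry l', False := by simp [h]
  rw [eventually_curry_iff] at h1
  simp only [eventually_const] at h1

lemma tendsto_sqrt_add_sqrt_rpow {γ : ℝ} (hγ : 0 < γ) :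
    Tendsto (fun μ : ℝ => √μ + √μ ^ γ) (𝓝[>] 0) (𝓝 0) := by
  have h1 : Tendsto (fun μ : ℝ => √μ) (𝓝[>] 0) (𝓝 0) := by
    simpa using (Real.continuous_sqrt.tendsto 0).mono_left nhdsWithin_le_nhds
  have h2 : Tendsto (fun μ : ℝ => √μ ^ γ) (𝓝[>] 0) (𝓝 0) := by
    simpa [Real.zero_rpow hγ.ne'] using h1.rpow_const (p := γ) (Or.inr hγ.le)
  simpa using h1.add h2

lemma abs_add_sq_sub_sq_le_scaled {μ H S x d : ℝ} (hμ : 0 < μ) (hμ1 : μ ≤ 1) (hx : |x| ≤ H)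
    (hd : |d| ≤ S) :
    |(x + d) ^ 2 - x ^ 2| ≤ 3 * (μ * √μ) * (1 + H ^ 4 / μ ^ 2 + S ^ 4 / μ ^ 4) := by
  have hH : 0 ≤ H := (abs_nonneg x).trans hx
  have hS : 0 ≤ S := (abs_nonneg d).trans hd
  obtain ⟨h1, -, -, -, h2, -, -⟩ := scaled_bounds hμ hμ1 hH hS
  have hr1 : √μ ≤ 1 := Real.sqrt_le_one.2 hμ1
  have hrr : √μ * √μ = μ := Real.mul_self_sqrt hμ.le
  have h3 : (x + d) ^ 2 - x ^ 2 = 2 * (x * d) + d ^ 2 := by ring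
  rw [h3]
  refine (abs_add_le _ _).trans ?_
  rw [abs_mul, abs_mul, abs_two, abs_pow]
  have h4 : |x| * |d| ≤ H * S := mul_le_mul hx hd (abs_nonneg d) hH
  have h5 : |d| ^ 2 ≤ S ^ 2 := by gcongr
  have h6 : μ ^ 2 ≤ μ * √μ := by
    rw [sq]
    gcongr
    nlinarith [Real.sqrt_nonneg μ]
  have h7 := mul_le_mul_of_nonneg_right h6
    (show 0 ≤ 1 + H ^ 4 / μ ^ 2 + S ^ 4 / μ ^ 4 by positivity)
  linarith

lemma pow_three_le_scaled {μ H S z : ℝ} (hμ : 0 < μ) (hμ1 : μ ≤ 1) (hH : 0 ≤ H) (hS : 0 ≤ S)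
    (hz : 0 ≤ z) (hzHS : z ≤ H + S) :
    z ^ 3 ≤ 8 * (μ * √μ) * (1 + H ^ 4 / μ ^ 2 + S ^ 4 / μ ^ 4) := by
  obtain ⟨-, h1, -, -, -, h2, -⟩ := scaled_bounds hμ hμ1 hH hS
  have h3 : (H + S) ^ 3 ≤ 4 * (H ^ 3 + S ^ 3) := by
    nlinarith [mul_nonneg (add_nonneg hH hS) (sq_nonneg (H - S))]
  linarith [pow_le_pow_left₀ hz hzHS 3]

namespace Model

variable {N M : ℕ} {Ω : Type*} {D : Model N M Ω} {J : Vec M → ℝ}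

lemma aggregateCost_eq (hN : D.NetworkConditions) (hJ : ∀ k, D.J k = J) {μ : ℝ} (hμ : 0 < μ)
    (w : Vec M) : D.aggregateCost μ w = J w := by
  have hq : ∀ k, D.q μ k = μ * D.relWeight k := fun k => by simp [q, relWeight, mul_assoc]
  obtain ⟨l, hl⟩ := hN.exists_relWeight_pos
  have hpos : 0 < ∑ k, D.q μ k := by
    simp only [hq]
    exact Finset.sum_pos' (fun k _ => mul_nonneg hμ.le (hN.relWeight_nonneg k))
      ⟨l, Finset.mem_univ l, mul_pos hμ hl⟩
  simp only [aggregateCost, hJ, ← Finset.sum_mul]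
  field_simp

variable [MeasurableSpace Ω] {P : Measure Ω} {ν δ K : ℝ}
  {e : OrthonormalBasis (Fin M) ℝ (Vec M)} {lam : Fin M → ℝ} {G : Matrix (Fin M) (Fin M) ℝ}
  {β σ : Fin N → ℝ} {κ γ ε : ℝ} {Glim : Fin N → Matrix (Fin M) (Fin M) ℝ}

/-- The fourth moments of the centroid error and of the disagreement, in units of `μ ^ 2` and
`μ ^ 4`, increased by one. -/
noncomputable def scaledMoment (D : Model N M Ω) (P : Measure Ω) (c : ℕ) (μ : ℝ) (i : ℕ) : ℝ :=
  1 + (∫ ω, ‖D.centroidError μ i ω‖ ^ 4 ∂P) / μ ^ 2 + (∫ ω, D.spread c μ i ω ^ 4 ∂P) / μ ^ 4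

lemma eventually_small {ν : ℝ} (hν : 0 < ν) (δ : ℝ) :
    ∀ᶠ μ : ℝ in 𝓝[>] 0, 0 < μ ∧ μ ≤ 1 ∧ μ * δ ^ 2 ≤ ν ∧ μ * ν ≤ 2 ∧ δ * μ ≤ 1 := by
  have hlt : ∀ {s b : ℝ}, 0 < b → ∀ᶠ μ : ℝ in 𝓝[>] 0, μ * s ≤ b := fun {s b} hb => by
    have h : Tendsto (fun μ : ℝ => μ * s) (𝓝 0) (𝓝 (0 * s)) := Continuous.tendsto (by fun_prop) 0
    rw [zero_mul] at h
    exact eventually_nhdsWithin_of_eventually_nhds (h.eventually (ge_mem_nhds hb))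
  filter_upwards [self_mem_nhdsWithin, hlt (s := 1) one_pos, hlt (s := δ ^ 2) hν,
    hlt (s := ν) two_pos, hlt (s := δ) one_pos] with μ h1 h2 h3 h4 h5
  exact ⟨h1, by simpa using h2, h3, h4, by rwa [mul_comm]⟩

lemma StandingConditions.stepConstant_nonneg {μ : ℝ}
    (hD : D.StandingConditions P J ν δ K e lam G β σ κ γ ε Glim μ) (c : ℕ) :
    0 ≤ StandingConditions.stepConstant D δ K κ ε β σ c := by
  have hδ : 0 ≤ δ := hD.approx.ν_pos.le.trans hD.approx.ν_le_δ
  have hK := hD.approx.K_nonneg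
  have hκ := hD.κ_nonneg
  have hε := hD.ε_pos
  unfold StandingConditions.stepConstant
  positivity

variable [IsProbabilityMeasure P]

/-- For small step-sizes the centroid error is eventually of the order `√μ` in the fourth mean, and
the disagreement is of the order `μ`. -/
lemma exists_scaledMoment_le
    (hD : ∀ᶠ μ in 𝓝[>] (0 : ℝ), D.StandingConditions P J ν δ K e lam G β σ κ γ ε Glim μ)
    {c : ℕ} {ρ : ℝ} (hρ0 : 0 ≤ ρ) (hρ1 : ρ < 1)
    (hc : ∀ v : Fin N → Vec M, ‖disagreement D.p v‖ ≤ disagreementNorm (D.A₁ * D.A₂) D.p c v)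
    (hρ : ∀ v : Fin N → Vec M, disagreementNorm (D.A₁ * D.A₂) D.p c
      (combine (D.A₁ * D.A₂) v) ≤ ρ * disagreementNorm (D.A₁ * D.A₂) D.p c v) :
    ∃ B : ℝ, ∀ᶠ μ in 𝓝[>] (0 : ℝ), ∀ᶠ i in atTop, D.scaledMoment P c μ i ≤ B := by
  obtain ⟨_, hD₀⟩ := hD.exists
  have hν := hD₀.approx.ν_pos
  have hq := hD₀.network.meanStep_pos
  have hq1 := hD₀.network.meanStep_le
  set a := D.meanStep * ν / 2 with ha
  have ha0 : 0 < a := by positivity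
  set K' := StandingConditions.stepConstant D δ K κ ε β σ c with hK'
  set C := |K' ^ 5 / (1 - ρ) ^ 3| + |2 * (a * (K' / a) ^ 4)| + |(64 / a + 3) * K' ^ 5| + 1 with hC
  have hC0 : 0 < C := by positivity
  obtain ⟨C', hC'⟩ := exists_fourth_moment_bound (b := a / 2) (by positivity) hρ0 hρ1 hC0
  refine ⟨1 + C' + C', ?_⟩
  filter_upwards [hC', hD, eventually_small hν δ] with μ hμ hDμ ⟨hμ0, hμ1, hsmall, hsmall', _⟩
  have hx : ∀ i, 0 ≤ ∫ ω, ‖D.centroidError μ i ω‖ ^ 4 ∂P := fun i =>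
    integral_nonneg fun ω => by positivity
  have hy : ∀ i, 0 ≤ ∫ ω, D.spread c μ i ω ^ 4 ∂P := fun i =>
    integral_nonneg fun ω => pow_nonneg (D.spread_nonneg c μ i ω) 4
  have hst := fun i => hDμ.noisyStep hμ0 hμ1 hsmall hsmall' hc hρ i
  have haμ : a * μ ≤ 1 := by
    have : a * μ = D.meanStep * (μ * ν / 2) := by rw [ha]; ring
    rw [this]
    exact mul_le_one₀ hq1 (by positivity) (by linarith)
  have hA1 := abs_nonneg (K' ^ 5 / (1 - ρ) ^ 3)
  have hA2 := abs_nonneg (2 * (a * (K' / a) ^ 4))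
  have hA3 := abs_nonneg ((64 / a + 3) * K' ^ 5)
  have h1 : K' ^ 5 / (1 - ρ) ^ 3 ≤ C := (le_abs_self _).trans (by linarith)
  have h2 : 2 * (a * (K' / a) ^ 4) ≤ C := (le_abs_self _).trans (by linarith)
  have h3 : (64 / a + 3) * K' ^ 5 ≤ C := (le_abs_self _).trans (by linarith)
  have hlim := hμ _ _ hx hy
    (fun i => ((hst i).integral_S'_le hρ0 hρ1).trans (by
      have := hx i
      have := hy i
      gcongr))
    (fun i => ((hst i).integral_h'_le ha0 hμ0 hμ1 haμ).trans (by
      have := hx i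
      have := hy i
      gcongr))
  filter_upwards [hlim] with i hi
  have h4 : (∫ ω, ‖D.centroidError μ i ω‖ ^ 4 ∂P) / μ ^ 2 ≤ C' :=
    (div_le_iff₀ (by positivity)).2 hi.1
  have h5 : (∫ ω, D.spread c μ i ω ^ 4 ∂P) / μ ^ 4 ≤ C' := (div_le_iff₀ (by positivity)).2 hi.2
  exact add_le_add (add_le_add le_rfl h4) h5

/-- The second moment of the centroid error in each eigendirection of the Hessian matrix. -/
lemma tendsto_integral_inner_centroidError
    (hD : ∀ᶠ μ in 𝓝[>] (0 : ℝ), D.StandingConditions P J ν δ K e lam G β σ κ γ ε Glim μ)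
    {c : ℕ} {ρ B : ℝ}
    (hc : ∀ v : Fin N → Vec M, ‖disagreement D.p v‖ ≤ disagreementNorm (D.A₁ * D.A₂) D.p c v)
    (hρ : ∀ v : Fin N → Vec M, disagreementNorm (D.A₁ * D.A₂) D.p c
      (combine (D.A₁ * D.A₂) v) ≤ ρ * disagreementNorm (D.A₁ * D.A₂) D.p c v)
    (hB : ∀ᶠ μ in 𝓝[>] (0 : ℝ), ∀ᶠ i in atTop, D.scaledMoment P c μ i ≤ B) (j : Fin M) :
    Tendsto (fun z : ℝ × ℕ =>
      (∫ ω, inner ℝ (e j) (D.centroidError z.1 z.2 ω) ^ 2 ∂P) / z.1) ((𝓝[>] 0).curry atTop)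
      (𝓝 (D.noiseVariance G (e j) / (2 * (D.meanStep * lam j)))) := by
  obtain ⟨_, hD₀⟩ := hD.exists
  have hν := hD₀.approx.ν_pos
  have hlam : 0 < lam j := hν.trans_le (hD₀.approx.le_lam j)
  have hq := hD₀.network.meanStep_pos
  have hK := hD₀.stepConstant_nonneg c
  set K' := StandingConditions.stepConstant D δ K κ ε β σ c with hK'
  refine Metric.tendsto_nhds.2 fun η hη => eventually_curry_iff.2 ?_
  have hC : 0 ≤ (D.meanStep * lam j) ^ 2 + 5 * K' + 4 * K' ^ 2 := by positivity
  have herr : Tendsto (fun μ : ℝ => ((D.meanStep * lam j) ^ 2 + 5 * K' + 4 * K' ^ 2) * B *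
      (√μ + √μ ^ γ)) (𝓝[>] 0) (𝓝 0) := by
    simpa using (tendsto_sqrt_add_sqrt_rpow hD₀.γ_pos).const_mul
      (((D.meanStep * lam j) ^ 2 + 5 * K' + 4 * K' ^ 2) * B)
  have hmain := eventually_abs_div_sub_le
    (z := fun μ i => ∫ ω, inner ℝ (e j) (D.centroidError μ i ω) ^ 2 ∂P)
    (c := 2 * (D.meanStep * lam j)) (Y := D.noiseVariance G (e j)) (by positivity) herr ?_
    (half_pos hη)
  · filter_upwards [hmain] with μ hμ
    filter_upwards [hμ] with i hi
    rw [Real.dist_eq]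
    exact hi.trans_lt (half_lt_self hη)
  · filter_upwards [hB, hD, eventually_small hν δ] with μ hμ hDμ ⟨hμ0, hμ1, hsmall, hsmall', hδμ⟩
    filter_upwards [hμ] with i hi
    have h1 : D.meanStep * lam j * μ ≤ 1 := by
      rw [mul_assoc]
      refine mul_le_one₀ hD₀.network.meanStep_le (by positivity) (le_trans ?_ hδμ)
      exact mul_le_mul_of_nonneg_right (hD₀.approx.lam_le j) hμ0.le
    have h2 := (hDμ.noisyStep hμ0 hμ1 hsmall hsmall' hc hρ i).abs_integral_inner_sq_le hμ0 hμ1 hK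
      hq.le (le_add_of_nonneg_right (by positivity)) j hlam.le h1
    refine h2.trans ?_
    calc _ ≤ ((D.meanStep * lam j) ^ 2 + 5 * K' + 4 * K' ^ 2) * (μ ^ 2 * (√μ + √μ ^ γ)) * B :=
          mul_le_mul_of_nonneg_left hi (by positivity)
      _ = _ := by ring

/-! ### Performance of an agent -/

lemma StandingConditions.integrable_norm_pow_three {μ : ℝ}
    (hD : D.StandingConditions P J ν δ K e lam G β σ κ γ ε Glim μ) (i : ℕ) (k : Fin N) :
    Integrable (fun ω => ‖D.iterate μ i k ω - D.wo‖ ^ 3) P := by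
  have h1 : MemLp (fun ω => D.iterate μ i k ω - D.wo) 3 P :=
    ((hD.memLp_iterate i k).sub (memLp_const D.wo)).mono_exponent (by norm_num)
  simpa using h1.integrable_norm_pow (by norm_num)

lemma StandingConditions.integrable_inner_sq {μ : ℝ}
    (hD : D.StandingConditions P J ν δ K e lam G β σ κ γ ε Glim μ) (i : ℕ) (k : Fin N)
    (j : Fin M) : Integrable (fun ω => inner ℝ (e j) (D.iterate μ i k ω - D.wo) ^ 2) P :=
  ((((hD.memLp_iterate i k).sub (memLp_const D.wo)).const_inner (e j)).mono_exponent
    (by norm_num)).integrable_sq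

/-- The agents inherit the second moments of the centroid error, because their distance to the
centroid is of the order `μ`. -/
lemma tendsto_integral_inner_iterate
    (hD : ∀ᶠ μ in 𝓝[>] (0 : ℝ), D.StandingConditions P J ν δ K e lam G β σ κ γ ε Glim μ)
    {c : ℕ} {ρ B : ℝ}
    (hc : ∀ v : Fin N → Vec M, ‖disagreement D.p v‖ ≤ disagreementNorm (D.A₁ * D.A₂) D.p c v)
    (hρ : ∀ v : Fin N → Vec M, disagreementNorm (D.A₁ * D.A₂) D.p c
      (combine (D.A₁ * D.A₂) v) ≤ ρ * disagreementNorm (D.A₁ * D.A₂) D.p c v)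
    (hB : ∀ᶠ μ in 𝓝[>] (0 : ℝ), ∀ᶠ i in atTop, D.scaledMoment P c μ i ≤ B) (k : Fin N)
    (j : Fin M) :
    Tendsto (fun z : ℝ × ℕ =>
      (∫ ω, inner ℝ (e j) (D.iterate z.1 z.2 k ω - D.wo) ^ 2 ∂P) / z.1) ((𝓝[>] 0).curry atTop)
      (𝓝 (D.noiseVariance G (e j) / (2 * (D.meanStep * lam j)))) := by
  obtain ⟨_, hD₀⟩ := hD.exists
  have hν := hD₀.approx.ν_pos
  refine (tendsto_integral_inner_centroidError hD hc hρ hB j).congr_dist ?_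
  have hzero : Tendsto (fun z : ℝ × ℕ => 3 * √z.1 * B) ((𝓝[>] 0).curry atTop) (𝓝 0) := by
    have h1 : Tendsto (fun μ : ℝ => 3 * √μ * B) (𝓝[>] 0) (𝓝 0) := by
      have h2 : Continuous fun μ : ℝ => 3 * √μ * B := by fun_prop
      simpa using (h2.tendsto 0).mono_left nhdsWithin_le_nhds
    exact h1.comp tendsto_fst_curry
  refine squeeze_zero' (Eventually.of_forall fun z => dist_nonneg) ?_ hzero
  refine eventually_curry_iff.2 ?_
  filter_upwards [hB, hD, eventually_small hν δ] with μ hμ hDμ ⟨hμ0, hμ1, _, _, _⟩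
  filter_upwards [hμ] with i hi
  have hH := (hDμ.memLp_centroidError i).norm
  have hS := hDμ.memLp_spread c i
  have i1 : Integrable (fun ω => inner ℝ (e j) (D.centroidError μ i ω) ^ 2) P :=
    (((hDμ.memLp_centroidError i).const_inner (e j)).mono_exponent (by norm_num)).integrable_sq
  have i2 := hDμ.integrable_inner_sq i k j
  have hpt : ∀ ω, |inner ℝ (e j) (D.iterate μ i k ω - D.wo) ^ 2 -
      inner ℝ (e j) (D.centroidError μ i ω) ^ 2| ≤ 3 * (μ * √μ) *
      (1 + ‖D.centroidError μ i ω‖ ^ 4 / μ ^ 2 + D.spread c μ i ω ^ 4 / μ ^ 4) := by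
    intro ω
    have h1 : inner ℝ (e j) (D.iterate μ i k ω - D.wo) = inner ℝ (e j) (D.centroidError μ i ω) +
        inner ℝ (e j) (D.iterate μ i k ω - (D.wo + D.centroidError μ i ω)) := by
      rw [← inner_add_right]
      congr 1
      abel
    have habs : ∀ w : Vec M, |inner ℝ (e j) w| ≤ ‖w‖ := fun w => by
      simpa [e.orthonormal.1 j] using abs_real_inner_le_norm (e j) w
    rw [h1]
    exact abs_add_sq_sub_sq_le_scaled hμ0 hμ1 (habs _)
      ((habs _).trans (NetworkConditions.norm_iterate_sub_centroid_le hc μ i k ω))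
  rw [dist_comm, Real.dist_eq, ← sub_div, abs_div, abs_of_pos hμ0, div_le_iff₀ hμ0,
    ← integral_sub i2 i1]
  refine (abs_integral_le_integral_abs.trans (integral_mono (i2.sub i1).abs
    ((integrable_scaled hH hS μ).const_mul _) hpt)).trans ?_
  rw [integral_const_mul, integral_scaled hH hS]
  calc _ ≤ 3 * (μ * √μ) * B := mul_le_mul_of_nonneg_left hi (by positivity)
    _ = _ := by ring

lemma tendsto_integral_norm_sq
    (hD : ∀ᶠ μ in 𝓝[>] (0 : ℝ), D.StandingConditions P J ν δ K e lam G β σ κ γ ε Glim μ)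
    {k : Fin N} {L : Fin M → ℝ}
    (hL : ∀ j, Tendsto (fun z : ℝ × ℕ =>
      (∫ ω, inner ℝ (e j) (D.iterate z.1 z.2 k ω - D.wo) ^ 2 ∂P) / z.1) ((𝓝[>] 0).curry atTop)
      (𝓝 (L j))) :
    Tendsto (fun z : ℝ × ℕ => (∫ ω, ‖D.wo - D.iterate z.1 z.2 k ω‖ ^ 2 ∂P) / z.1)
      ((𝓝[>] 0).curry atTop) (𝓝 (∑ j, L j)) := by
  refine (tendsto_finsetSum _ fun j _ => hL j).congr' (eventually_curry_iff.2 ?_)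
  filter_upwards [hD] with μ hDμ
  refine Eventually.of_forall fun i => ?_
  have h1 : ∀ ω, ‖D.wo - D.iterate μ i k ω‖ ^ 2 =
      ∑ j, inner ℝ (e j) (D.iterate μ i k ω - D.wo) ^ 2 := fun ω => by
    rw [norm_sub_rev, ← e.sum_sq_inner_right]
  simp only [h1]
  rw [integral_finsetSum _ fun j _ => hDμ.integrable_inner_sq i k j, Finset.sum_div]

lemma StandingConditions.integrable_excess {μ : ℝ}
    (hD : D.StandingConditions P J ν δ K e lam G β σ κ γ ε Glim μ) (i : ℕ) (k : Fin N) :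
    Integrable (fun ω => J (D.iterate μ i k ω) - J D.wo) P := by
  have h1 := (integrable_finsetSum Finset.univ fun j _ =>
    (hD.integrable_inner_sq i k j).const_mul (lam j)).const_mul (1 / 2)
  have h2 : Integrable (fun ω => J (D.iterate μ i k ω) - J D.wo -
      1 / 2 * ∑ j, lam j * inner ℝ (e j) (D.iterate μ i k ω - D.wo) ^ 2) P := by
    refine ((hD.integrable_norm_pow_three i k).const_mul K).mono' ?_
      (Eventually.of_forall fun ω => ?_)
    · have h3 : Continuous fun w : Vec M => J w - J D.wo -
          1 / 2 * ∑ j, lam j * inner ℝ (e j) (w - D.wo) ^ 2 := by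
        have := hD.approx.differentiable.continuous
        fun_prop
      exact h3.comp_aestronglyMeasurable (hD.memLp_iterate i k).1
    · have h3 := hD.approx.cost_approx (D.iterate μ i k ω - D.wo)
      rwa [add_sub_cancel] at h3
  refine (h2.add h1).congr (Eventually.of_forall fun ω => ?_)
  simp

/-- The excess cost is half the Hessian form up to a cubic remainder, which is of the order
`μ * √μ`. -/
lemma tendsto_integral_excess
    (hD : ∀ᶠ μ in 𝓝[>] (0 : ℝ), D.StandingConditions P J ν δ K e lam G β σ κ γ ε Glim μ)
    {c : ℕ} {B : ℝ}
    (hc : ∀ v : Fin N → Vec M, ‖disagreement D.p v‖ ≤ disagreementNorm (D.A₁ * D.A₂) D.p c v)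
    (hB : ∀ᶠ μ in 𝓝[>] (0 : ℝ), ∀ᶠ i in atTop, D.scaledMoment P c μ i ≤ B)
    {k : Fin N} {L : Fin M → ℝ}
    (hL : ∀ j, Tendsto (fun z : ℝ × ℕ =>
      (∫ ω, inner ℝ (e j) (D.iterate z.1 z.2 k ω - D.wo) ^ 2 ∂P) / z.1) ((𝓝[>] 0).curry atTop)
      (𝓝 (L j))) :
    Tendsto (fun z : ℝ × ℕ => (∫ ω, (J (D.iterate z.1 z.2 k ω) - J D.wo) ∂P) / z.1)
      ((𝓝[>] 0).curry atTop) (𝓝 (1 / 2 * ∑ j, lam j * L j)) := by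
  obtain ⟨_, hD₀⟩ := hD.exists
  have hν := hD₀.approx.ν_pos
  have hK := hD₀.approx.K_nonneg
  refine ((tendsto_finsetSum Finset.univ fun j _ => (hL j).const_mul (lam j)).const_mul
    (1 / 2)).congr_dist ?_
  have hzero : Tendsto (fun z : ℝ × ℕ => K * 8 * √z.1 * B) ((𝓝[>] 0).curry atTop) (𝓝 0) := by
    have h1 : Tendsto (fun μ : ℝ => K * 8 * √μ * B) (𝓝[>] 0) (𝓝 0) := by
      have h2 : Continuous fun μ : ℝ => K * 8 * √μ * B := by fun_prop
      simpa using (h2.tendsto 0).mono_left nhdsWithin_le_nhds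
    exact h1.comp tendsto_fst_curry
  refine squeeze_zero' (Eventually.of_forall fun z => dist_nonneg) ?_ hzero
  refine eventually_curry_iff.2 ?_
  filter_upwards [hB, hD, eventually_small hν δ] with μ hμ hDμ ⟨hμ0, hμ1, _, _, _⟩
  filter_upwards [hμ] with i hi
  have hH := (hDμ.memLp_centroidError i).norm
  have hS := hDμ.memLp_spread c i
  have hq := fun j => (hDμ.integrable_inner_sq i k j).const_mul (lam j)
  have i1 := (integrable_finsetSum Finset.univ fun j _ => hq j).const_mul (1 / 2)
  have i2 := hDμ.integrable_excess i k
  have h1 : 1 / 2 * ∑ j, lam j *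
      ((∫ ω, inner ℝ (e j) (D.iterate μ i k ω - D.wo) ^ 2 ∂P) / μ) =
      (∫ ω, 1 / 2 * ∑ j, lam j * inner ℝ (e j) (D.iterate μ i k ω - D.wo) ^ 2 ∂P) / μ := by
    rw [integral_const_mul, integral_finsetSum _ fun j _ => hq j, mul_div_assoc, Finset.sum_div]
    simp only [integral_const_mul, mul_div_assoc]
  have hpt : ∀ ω, |J (D.iterate μ i k ω) - J D.wo -
      1 / 2 * ∑ j, lam j * inner ℝ (e j) (D.iterate μ i k ω - D.wo) ^ 2| ≤ K * 8 * (μ * √μ) *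
      (1 + ‖D.centroidError μ i ω‖ ^ 4 / μ ^ 2 + D.spread c μ i ω ^ 4 / μ ^ 4) := by
    intro ω
    have h2 := hDμ.approx.cost_approx (D.iterate μ i k ω - D.wo)
    rw [add_sub_cancel] at h2
    have h3 : ‖D.iterate μ i k ω - D.wo‖ ≤ ‖D.centroidError μ i ω‖ + D.spread c μ i ω := by
      have h4 := norm_add_le (D.centroidError μ i ω)
        (D.iterate μ i k ω - (D.wo + D.centroidError μ i ω))
      have h5 : D.centroidError μ i ω + (D.iterate μ i k ω - (D.wo + D.centroidError μ i ω)) =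
        D.iterate μ i k ω - D.wo := by abel
      rw [h5] at h4
      linarith [NetworkConditions.norm_iterate_sub_centroid_le hc μ i k ω]
    have h4 := mul_le_mul_of_nonneg_left (pow_three_le_scaled hμ0 hμ1
      (norm_nonneg (D.centroidError μ i ω)) (D.spread_nonneg c μ i ω) (norm_nonneg _) h3) hK
    linarith
  rw [h1, dist_comm, Real.dist_eq, ← sub_div, abs_div, abs_of_pos hμ0, div_le_iff₀ hμ0,
    ← integral_sub i2 i1]
  refine (abs_integral_le_integral_abs.trans (integral_mono (i2.sub i1).abs
    ((integrable_scaled hH hS μ).const_mul _) hpt)).trans ?_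
  rw [integral_const_mul, integral_scaled hH hS]
  calc _ ≤ K * 8 * (μ * √μ) * B := mul_le_mul_of_nonneg_left hi (by positivity)
    _ = _ := by ring

/-- Mean-square-deviation and excess-risk of every agent: all agents follow the centroid, whose
error has, in the eigendirection `e j` of the Hessian matrix, the variance
`μ * noiseVariance G (e j) / (2 * meanStep * lam j)` to leading order. -/
theorem isMSD_isER
    (hD : ∀ᶠ μ in 𝓝[>] (0 : ℝ), D.StandingConditions P J ν δ K e lam G β σ κ γ ε Glim μ)
    (hmin : ∀ w, J D.wo ≤ J w) (μ : ℝ) (k : Fin N) :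
    D.IsMSD P μ k (μ * ∑ j, D.noiseVariance G (e j) / (2 * (D.meanStep * lam j))) ∧
    D.IsER P μ k (μ * (1 / 2 * ∑ j, lam j *
      (D.noiseVariance G (e j) / (2 * (D.meanStep * lam j))))) := by
  obtain ⟨_, hD₀⟩ := hD.exists
  have hN := hD₀.network
  obtain ⟨c, ρ, hρ0, hρ1, hc, hρ⟩ := exists_disagreementNorm_combine_le (M := M)
    hN.combination_mem hN.primitive hN.perron hN.perron_sum
  obtain ⟨B, hB⟩ := exists_scaledMoment_le hD hρ0 hρ1 hc hρ
  have hL := fun j => tendsto_integral_inner_iterate hD hc hρ hB k j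
  have hpos : ∀ᶠ z : ℝ × ℕ in (𝓝[>] 0).curry atTop, 0 < z.1 :=
    tendsto_fst_curry.eventually self_mem_nhdsWithin
  constructor
  · have hlim := tendsto_integral_norm_sq hD hL
    have hnonneg := ge_of_tendsto hlim (hpos.mono fun z hz =>
      div_nonneg (integral_nonneg fun ω => sq_nonneg _) hz.le)
    refine ⟨_, by rw [Real.coe_toNNReal _ hnonneg], ?_⟩
    refine tendsto_limsup_of_tendsto_curry ((ENNReal.tendsto_ofReal hlim).congr' ?_)
    refine eventually_curry_iff.2 ?_
    filter_upwards [hD, self_mem_nhdsWithin] with μ' hDμ hμ'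
    refine Eventually.of_forall fun i => ?_
    have hint : Integrable (fun ω => ‖D.wo - D.iterate μ' i k ω‖ ^ 2) P := by
      have h1 : MemLp (fun ω => D.wo - D.iterate μ' i k ω) 2 P :=
        ((memLp_const D.wo).sub (hDμ.memLp_iterate i k)).mono_exponent (by norm_num)
      simpa using h1.integrable_norm_pow (by norm_num)
    rw [ENNReal.ofReal_div_of_pos hμ', ofReal_integral_eq_lintegral_ofReal hint
      (Eventually.of_forall fun ω => sq_nonneg _)]
    simp only [ENNReal.ofReal_pow (norm_nonneg _), ofReal_norm]
  · have hlim := tendsto_integral_excess hD hc hB hL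
    have hnonneg := ge_of_tendsto hlim (hpos.mono fun z hz =>
      div_nonneg (integral_nonneg fun ω => sub_nonneg.2 (hmin _)) hz.le)
    refine ⟨_, by rw [Real.coe_toNNReal _ hnonneg], ?_⟩
    refine tendsto_limsup_of_tendsto_curry ((ENNReal.tendsto_ofReal hlim).congr' ?_)
    refine eventually_curry_iff.2 ?_
    filter_upwards [hD, self_mem_nhdsWithin] with μ' hDμ hμ'
    refine Eventually.of_forall fun i => ?_
    simp only [aggregateCost_eq hN hD₀.cost_eq hμ']
    rw [ENNReal.ofReal_div_of_pos hμ', ofReal_integral_eq_lintegral_ofReal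
      (hDμ.integrable_excess i k) (Eventually.of_forall fun ω => sub_nonneg.2 (hmin _))]

end Model

/-! ### Comparison of the two strategies -/

section Trace

variable {M : ℕ}

/-- The quadratic form of `G`. -/
def quadForm (G : Matrix (Fin M) (Fin M) ℝ) (v : Vec M) : ℝ := ∑ m, ∑ n, v m * v n * G m n

/-- The quadratic form of the diagonal part of `G`. -/
def diagForm (G : Matrix (Fin M) (Fin M) ℝ) (v : Vec M) : ℝ := ∑ m, v m * v m * G m m

/-- Completeness of an orthonormal basis, in coordinates. -/
lemma sum_apply_mul_apply (e : OrthonormalBasis (Fin M) ℝ (Vec M)) (m n : Fin M) :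
    ∑ j, e j m * e j n = if m = n then 1 else 0 := by
  have h1 := e.sum_inner_mul_inner (EuclideanSpace.single m (1 : ℝ))
    (EuclideanSpace.single n (1 : ℝ))
  simpa [EuclideanSpace.inner_single_left, EuclideanSpace.inner_single_right, Pi.single_apply,
    eq_comm] using h1

lemma sum_quadForm (e : OrthonormalBasis (Fin M) ℝ (Vec M)) (G : Matrix (Fin M) (Fin M) ℝ) :
    ∑ j, quadForm G (e j) = G.trace := by
  simp only [quadForm]
  rw [Finset.sum_comm]
  refine Finset.sum_congr rfl fun m _ => ?_
  rw [Finset.sum_comm]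
  simp only [← Finset.sum_mul, sum_apply_mul_apply]
  simp

lemma sum_diagForm (e : OrthonormalBasis (Fin M) ℝ (Vec M)) (G : Matrix (Fin M) (Fin M) ℝ) :
    ∑ j, diagForm G (e j) = G.trace := by
  simp only [diagForm]
  rw [Finset.sum_comm]
  simp only [← Finset.sum_mul, sum_apply_mul_apply]
  simp [Matrix.trace]

lemma sum_div_bounds {f lam : Fin M → ℝ} {ν δ : ℝ} (hν : 0 < ν) (hl : ∀ j, ν ≤ lam j)
    (hu : ∀ j, lam j ≤ δ) (hf : ∀ j, 0 ≤ f j) :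
    (∑ j, f j) / δ ≤ ∑ j, f j / lam j ∧ ∑ j, f j / lam j ≤ (∑ j, f j) / ν := by
  rw [Finset.sum_div, Finset.sum_div]
  refine ⟨Finset.sum_le_sum fun j _ => ?_, Finset.sum_le_sum fun j _ => ?_⟩
  · exact div_le_div_of_nonneg_left (hf j) (hν.trans_le (hl j)) (hu j)
  · exact div_le_div_of_nonneg_left (hf j) hν (hl j)

end Trace

/-- The bounds on `½ (α T₁ + (θ - α) T₂)` when both `T₁` and `T₂` lie between `t / δ` and
`t / ν`. -/
lemma comparison_bounds {ν δ α θ t T₁ T₂ d : ℝ} (hν : 0 < ν) (hνδ : ν ≤ δ) (ht : 0 ≤ t)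
    (hαθ : α ≤ θ) (h₁ : t / δ ≤ T₁ ∧ T₁ ≤ t / ν) (h₂ : t / δ ≤ T₂ ∧ T₂ ≤ t / ν)
    (hd : d = 1 / 2 * (α * T₁ + (θ - α) * T₂)) :
    (0 ≤ α → 0 ≤ d ∧ d ≤ 1 / 2 * (θ / ν) * t) ∧
    (α < 0 → (1 - δ / ν) * α ≤ θ →
      0 ≤ d ∧ d ≤ 1 / 2 * (θ / ν + (1 / δ - 1 / ν) * α) * t) ∧
    (α < 0 → θ ≤ (1 - ν / δ) * α →
      1 / 2 * (θ / δ + (1 / ν - 1 / δ) * α) * t ≤ d ∧ d ≤ 0) := by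
  have hδ : 0 < δ := hν.trans_le hνδ
  have hθ : 0 ≤ θ - α := sub_nonneg.2 hαθ
  have hl₂ := mul_le_mul_of_nonneg_left h₂.1 hθ
  have hu₂ := mul_le_mul_of_nonneg_left h₂.2 hθ
  have ht' : 0 ≤ t / δ := by positivity
  refine ⟨fun hα => ?_, fun hα hle => ?_, fun hα hle => ?_⟩
  · have hu₁ := mul_le_mul_of_nonneg_left h₁.2 hα
    have hT₁ := mul_nonneg hα (ht'.trans h₁.1)
    have hT₂ := mul_nonneg hθ (ht'.trans h₂.1)
    refine ⟨by rw [hd]; linarith, ?_⟩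
    have h : 1 / 2 * (θ / ν) * t = 1 / 2 * (α * (t / ν) + (θ - α) * (t / ν)) := by ring
    rw [hd, h]
    linarith
  · have hl₁ := mul_le_mul_of_nonpos_left h₁.2 hα.le
    have hu₁ := mul_le_mul_of_nonpos_left h₁.1 hα.le
    have h : α * (t / ν) + (θ - α) * (t / δ) = (θ - (1 - δ / ν) * α) * (t / δ) := by
      field_simp
      ring
    have h' : 1 / 2 * (θ / ν + (1 / δ - 1 / ν) * α) * t =
        1 / 2 * (α * (t / δ) + (θ - α) * (t / ν)) := by ring
    have h0 := mul_nonneg (sub_nonneg.2 hle) ht'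
    rw [h', hd]
    constructor <;> linarith
  · have hl₁ := mul_le_mul_of_nonpos_left h₁.2 hα.le
    have hu₁ := mul_le_mul_of_nonpos_left h₁.1 hα.le
    have h : α * (t / δ) + (θ - α) * (t / ν) = (θ - (1 - ν / δ) * α) * (t / ν) := by
      field_simp
      ring
    have h' : 1 / 2 * (θ / δ + (1 / ν - 1 / δ) * α) * t =
        1 / 2 * (α * (t / ν) + (θ - α) * (t / δ)) := by ring
    have h0 := mul_nonpos_of_nonpos_of_nonneg (sub_nonpos.2 hle) (div_nonneg ht hν.le)
    rw [h', hd]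
    constructor <;> linarith

namespace Model

variable {N M : ℕ} {Ω : Type*} {D : Model N M Ω} {ν δ : ℝ}

/-- The full-gradient strategy is the case of missing probabilities zero. -/
lemma NetworkConditions.fullGradient (h : D.NetworkConditions) :
    D.fullGradient.NetworkConditions :=
  { stochastic₁ := h.stochastic₁
    stochastic₂ := h.stochastic₂
    primitive := h.primitive
    perron := h.perron
    perron_sum := h.perron_sum
    step_pos := h.step_pos
    step_le := h.step_le
    step_max := h.step_max
    missing_nonneg := fun _ => le_rfl
    missing_lt := fun _ => zero_lt_one }

/-- Masking multiplies off-diagonal entries of a covariance matrix by `(1 - r) ^ 2`, but diagonal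
entries only by `1 - r`. -/
lemma noiseVariance_eq (D : Model N M Ω) (G : Matrix (Fin M) (Fin M) ℝ) (v : Vec M) :
    D.noiseVariance G v = (∑ l, D.relWeight l ^ 2 * (1 - D.r l) ^ 2) * quadForm G v +
      (∑ l, D.relWeight l ^ 2 * (1 - D.r l) - ∑ l, D.relWeight l ^ 2 * (1 - D.r l) ^ 2) *
        diagForm G v := by
  rw [noiseVariance, ← Finset.sum_sub_distrib, Finset.sum_mul, Finset.sum_mul,
    ← Finset.sum_add_distrib]
  refine Finset.sum_congr rfl fun l _ => ?_
  have h1 : ∀ m n, (if m = n then 1 - D.r l else (1 - D.r l) ^ 2) * (v m * v n * G m n) =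
      (1 - D.r l) ^ 2 * (v m * v n * G m n) +
        if m = n then ((1 - D.r l) - (1 - D.r l) ^ 2) * (v m * v n * G m n) else 0 := by
    intro m n
    split_ifs <;> ring
  simp only [h1, Finset.sum_add_distrib, Finset.sum_ite_eq, Finset.mem_univ, if_true,
    ← Finset.mul_sum]
  rw [quadForm, diagForm]
  ring

lemma noiseVariance_fullGradient (D : Model N M Ω) (G : Matrix (Fin M) (Fin M) ℝ) (v : Vec M) :
    D.fullGradient.noiseVariance G v = (∑ l, D.relWeight l ^ 2) * quadForm G v := by
  rw [noiseVariance_eq]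
  simp [Model.fullGradient, relWeight]

lemma meanStep_fullGradient (D : Model N M Ω) :
    D.fullGradient.meanStep = ∑ l, D.relWeight l := by
  simp [meanStep, Model.fullGradient, relWeight]

lemma q_eq (D : Model N M Ω) (μ : ℝ) (k : Fin N) : D.q μ k = μ * D.relWeight k :=
  mul_assoc _ _ _

lemma sum_sq_q_div (D : Model N M Ω) {μ : ℝ} (hμ : 0 < μ) (f g : Fin N → ℝ) :
    (∑ k, D.q μ k ^ 2 * f k) / (∑ k, D.q μ k * g k) =
      μ * ((∑ k, D.relWeight k ^ 2 * f k) / ∑ k, D.relWeight k * g k) := by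
  have h1 : ∑ k, D.q μ k ^ 2 * f k = μ ^ 2 * ∑ k, D.relWeight k ^ 2 * f k := by
    rw [Finset.mul_sum]
    exact Finset.sum_congr rfl fun k _ => by rw [q_eq]; ring
  have h2 : ∑ k, D.q μ k * g k = μ * ∑ k, D.relWeight k * g k := by
    rw [Finset.mul_sum]
    exact Finset.sum_congr rfl fun k _ => by rw [q_eq]; ring
  rw [h1, h2, sq, mul_assoc, mul_div_mul_left _ _ hμ.ne', mul_div_assoc]

lemma alpha_eq (D : Model N M Ω) {μ : ℝ} (hμ : 0 < μ) :
    D.alpha μ = μ * ((∑ l, D.relWeight l ^ 2 * (1 - D.r l) ^ 2) / D.meanStep -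
      (∑ l, D.relWeight l ^ 2) / ∑ l, D.relWeight l) := by
  have h := D.sum_sq_q_div hμ (fun _ => 1) (fun _ => 1)
  simp only [mul_one] at h
  rw [alpha, D.sum_sq_q_div hμ (fun k => (1 - D.r k) ^ 2) (fun k => 1 - D.r k), h, mul_sub,
    meanStep]

lemma theta_eq (D : Model N M Ω) {μ : ℝ} (hμ : 0 < μ) :
    D.theta μ = μ * ((∑ l, D.relWeight l ^ 2 * (1 - D.r l)) / D.meanStep -
      (∑ l, D.relWeight l ^ 2) / ∑ l, D.relWeight l) := by
  have h := D.sum_sq_q_div hμ (fun _ => 1) (fun _ => 1)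
  simp only [mul_one] at h
  rw [theta, D.sum_sq_q_div hμ (fun k => 1 - D.r k) (fun k => 1 - D.r k), h, mul_sub, meanStep]

lemma NetworkConditions.alpha_le_theta (hN : D.NetworkConditions) {μ : ℝ} (hμ : 0 < μ) :
    D.alpha μ ≤ D.theta μ := by
  have hm := hN.meanStep_pos
  have h1 : ∑ l, D.relWeight l ^ 2 * (1 - D.r l) ^ 2 ≤ ∑ l, D.relWeight l ^ 2 * (1 - D.r l) := by
    refine Finset.sum_le_sum fun l _ => ?_
    have h2 := hN.missing_nonneg l
    have h3 := hN.missing_lt l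
    gcongr
    nlinarith
  rw [alpha_eq D hμ, theta_eq D hμ]
  gcongr

lemma NetworkConditions.theta_eq_zero (hN : D.NetworkConditions) {μ : ℝ} (hμ : 0 < μ)
    (h : (∃ r₀ : ℝ, ∀ l, D.r l = r₀) ∨ ∃ q₀ : ℝ, ∀ l, D.q μ l = q₀) : D.theta μ = 0 := by
  have hm₁ : ∑ l, D.q μ l * (1 - D.r l) = μ * D.meanStep := by
    simp only [q_eq, meanStep, Finset.mul_sum, mul_assoc]
  have hm₀ : ∑ l, D.q μ l = μ * D.fullGradient.meanStep := by
    simp only [q_eq, meanStep_fullGradient, Finset.mul_sum]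
  have h₁ : ∑ l, D.q μ l * (1 - D.r l) ≠ 0 := hm₁ ▸ (mul_pos hμ hN.meanStep_pos).ne'
  have h₀ : ∑ l, D.q μ l ≠ 0 := hm₀ ▸ (mul_pos hμ hN.fullGradient.meanStep_pos).ne'
  rw [theta, sub_eq_zero]
  rcases h with ⟨r₀, hr⟩ | ⟨q₀, hq⟩
  · simp only [hr, ← Finset.sum_mul] at h₁ ⊢
    exact mul_div_mul_right _ _ (right_ne_zero_of_mul h₁)
  · simp only [sq, mul_assoc]
    have h2 : ∀ f : Fin N → ℝ, ∑ l, D.q μ l * f l = q₀ * ∑ l, f l := fun f => by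
      rw [Finset.mul_sum]
      exact Finset.sum_congr rfl fun l _ => by rw [hq]
    rw [h2 fun l => D.q μ l * (1 - D.r l), h2 (D.q μ), mul_div_cancel_right₀ _ h₁,
      mul_div_cancel_right₀ _ h₀]

variable [MeasurableSpace Ω] {P : Measure Ω}

namespace StandingConditions

variable {J : Vec M → ℝ} {K : ℝ}
  {e : OrthonormalBasis (Fin M) ℝ (Vec M)} {lam : Fin M → ℝ} {G : Matrix (Fin M) (Fin M) ℝ}
  {β σ : Fin N → ℝ} {κ γ ε : ℝ} {Glim : Fin N → Matrix (Fin M) (Fin M) ℝ} {μ : ℝ}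

lemma diagForm_nonneg (hD : D.StandingConditions P J ν δ K e lam G β σ κ γ ε Glim μ) (k : Fin N)
    (v : Vec M) : 0 ≤ diagForm G v := by
  refine Finset.sum_nonneg fun m _ => mul_nonneg (mul_self_nonneg _) ?_
  rw [← hD.noise_wo 0 k m m]
  exact integral_nonneg fun ω => mul_self_nonneg _

variable [IsProbabilityMeasure P]

lemma quadForm_nonneg (hD : D.StandingConditions P J ν δ K e lam G β σ κ γ ε Glim μ) (k : Fin N)
    (v : Vec M) : 0 ≤ quadForm G v := by
  have hmem : ∀ m, MemLp (fun ω => D.noise 0 k (fun _ => D.wo) ω m) 2 P := fun m =>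
    (memLp_apply (hD.noise.memLp 0 k _ ⟨measurable_const, memLp_const D.wo⟩) m).mono_exponent
      (by norm_num)
  have hint : ∀ m n, Integrable (fun ω => v m * v n *
      (D.noise 0 k (fun _ => D.wo) ω m * D.noise 0 k (fun _ => D.wo) ω n)) P := fun m n =>
    ((hmem m).integrable_mul (hmem n)).const_mul _
  have h1 : quadForm G v =
      ∫ ω, (∑ m, v m * D.noise 0 k (fun _ => D.wo) ω m) ^ 2 ∂P := by
    have h2 : ∀ ω, (∑ m, v m * D.noise 0 k (fun _ => D.wo) ω m) ^ 2 = ∑ m, ∑ n, v m * v n *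
        (D.noise 0 k (fun _ => D.wo) ω m * D.noise 0 k (fun _ => D.wo) ω n) := by
      intro ω
      rw [sq, Finset.sum_mul_sum]
      refine Finset.sum_congr rfl fun m _ => Finset.sum_congr rfl fun n _ => ?_
      ring
    simp only [h2, quadForm]
    rw [integral_finsetSum _ fun m _ => integrable_finsetSum _ fun n _ => hint m n]
    refine Finset.sum_congr rfl fun m _ => ?_
    rw [integral_finsetSum _ fun n _ => hint m n]
    refine Finset.sum_congr rfl fun n _ => ?_
    rw [integral_const_mul, hD.noise_wo]
  rw [h1]
  exact integral_nonneg fun ω => sq_nonneg _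

end StandingConditions

namespace UniformCosts

variable {X : Type*} [MeasurableSpace X] {law : Measure X} {Q : Vec M → X → ℝ}
  {x : ℕ → Fin N → Ω → X}

lemma fullGradient (h : D.UniformCosts P law Q x) : D.fullGradient.UniformCosts P law Q x :=
  { measurable_data := h.measurable_data
    data_law := h.data_law
    integrable_loss := h.integrable_loss
    cost_eq := h.cost_eq
    differentiable_loss := h.differentiable_loss
    measurable_grad := h.measurable_grad
    gradHat_eq := h.gradHat_eq }

/-- With uniform costs, the second-order moment of the gradient noise at the minimizer is the same
for all agents and at all times. -/
lemma integral_noise_mul_noise (h : D.UniformCosts P law Q x)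
    (hgrad : ∀ k, gradient (D.J k) D.wo = 0) (i : ℕ) (k : Fin N) (m n : Fin M) :
    ∫ ω, D.noise i k (fun _ => D.wo) ω m * D.noise i k (fun _ => D.wo) ω n ∂P =
      lossGradCov law Q D.wo m n := by
  have hg : Measurable fun y => gradient (fun v => Q v y) D.wo :=
    h.measurable_grad.comp (measurable_const.prodMk measurable_id)
  have hgm : ∀ m, Measurable fun y => gradient (fun v => Q v y) D.wo m := fun m =>
    (EuclideanSpace.proj (𝕜 := ℝ) m).continuous.measurable.comp hg
  simp only [noise, hgrad, sub_zero, h.gradHat_eq]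
  rw [lossGradCov, Matrix.of_apply, ← h.data_law i k]
  exact (integral_map (h.measurable_data i k).aemeasurable
    ((hgm m).mul (hgm n)).aestronglyMeasurable).symm

lemma exists_standingConditions (h : D.UniformCosts P law Q x) (hN : D.NetworkConditions)
    (hS : D.StochasticConditions P) {k : Fin N} {K : ℝ} {e : OrthonormalBasis (Fin M) ℝ (Vec M)}
    {lam : Fin M → ℝ} (hJ : QuadraticApprox (D.J k) D.wo ν δ K e lam) :
    ∃ (β σ : Fin N → ℝ) (κ γ ε : ℝ) (Glim : Fin N → Matrix (Fin M) (Fin M) ℝ),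
      ∀ᶠ μ in 𝓝[>] (0 : ℝ), D.StandingConditions P (D.J k) ν δ K e lam
        (lossGradCov law Q D.wo) β σ κ γ ε Glim μ := by
  obtain ⟨β, σ, κ, γ, ε, Glim, hκ, hγ, hγ4, hε, hnoise⟩ := hS.noise
  have hcost : ∀ l, D.J l = D.J k := fun l => by
    funext w
    rw [h.cost_eq, h.cost_eq]
  refine ⟨β, σ, κ, γ, ε, Glim, ?_⟩
  filter_upwards [hnoise, hS.indicator] with μ h1 h2
  exact
    { network := hN
      cost_eq := hcost
      approx := hJ
      measurable_init := hS.measurable_init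
      memLp_init := hS.memLp_init
      measurable_ind := hS.measurable_ind
      measurable_gradHat := hS.measurable_gradHat
      indicator := h2
      noise := h1
      κ_nonneg := hκ
      γ_pos := hγ
      γ_le := hγ4
      ε_pos := hε
      noise_wo := fun i l m n =>
        h.integral_noise_mul_noise (fun l => by rw [hcost l, hJ.gradient_eq_zero]) i l m n }

end UniformCosts

end Model

end Diffusion

theorem corollary3 {N M : ℕ} {Ω X : Type*} [MeasurableSpace Ω] [MeasurableSpace X]
    (P : Measure Ω) [IsProbabilityMeasure P]
    (D : Diffusion.Model N M Ω) (ν δ : ℝ)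
    (law : Measure X) (Q : Diffusion.Vec M → X → ℝ) (x : ℕ → Fin N → Ω → X)
    (hnetwork : D.NetworkConditions) (hcost : D.CostConditions ν δ)
    (hcoor : D.StochasticConditions P) (hgrad : D.fullGradient.StochasticConditions P)
    (huniform : D.UniformCosts P law Q x)
    (μ : ℝ) (hμ : 0 < μ) (k : Fin N) :
    ∃ MSDcoor MSDgrad ERcoor ERgrad : ℝ,
      D.IsMSD P μ k MSDcoor ∧ D.fullGradient.IsMSD P μ k MSDgrad ∧
      D.IsER P μ k ERcoor ∧ D.fullGradient.IsER P μ k ERgrad ∧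
      (0 ≤ D.alpha μ →
        0 ≤ MSDcoor - MSDgrad ∧
        MSDcoor - MSDgrad ≤
          1 / 2 * (D.theta μ / ν) * (Diffusion.lossGradCov law Q D.wo).trace) ∧
      (D.alpha μ < 0 → (1 - δ / ν) * D.alpha μ ≤ D.theta μ →
        0 ≤ MSDcoor - MSDgrad ∧
        MSDcoor - MSDgrad ≤
          1 / 2 * (D.theta μ / ν + (1 / δ - 1 / ν) * D.alpha μ)
            * (Diffusion.lossGradCov law Q D.wo).trace) ∧
      (D.alpha μ < 0 → D.theta μ ≤ (1 - ν / δ) * D.alpha μ →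
        1 / 2 * (D.theta μ / δ + (1 / ν - 1 / δ) * D.alpha μ)
            * (Diffusion.lossGradCov law Q D.wo).trace ≤ MSDcoor - MSDgrad ∧
        MSDcoor - MSDgrad ≤ 0) ∧
      ERcoor - ERgrad = D.theta μ / 4 * (Diffusion.lossGradCov law Q D.wo).trace ∧
      (((∃ r₀ : ℝ, ∀ l, D.r l = r₀) ∨ (∃ q₀ : ℝ, ∀ l, D.q μ l = q₀)) → ERcoor = ERgrad) := by
  obtain ⟨κ, hκ, ε, hε, hlip⟩ := hcost.hessian_lipschitz
  -- The cost is the same in both cases, so that one eigenbasis serves for both.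
  obtain ⟨K, e, lam, hJ⟩ := Diffusion.exists_quadraticApprox hcost.ν_pos hcost.ν_le_δ
    (hcost.minimizer k) (hcost.differentiable k) (hcost.twice_differentiable k)
    (hcost.hessian_lower k) (hcost.hessian_upper k) hκ hε (hlip k)
  obtain ⟨_, _, _, _, _, _, hD⟩ := huniform.exists_standingConditions hnetwork hcoor hJ
  obtain ⟨_, _, _, _, _, _, hD'⟩ :=
    huniform.fullGradient.exists_standingConditions hnetwork.fullGradient hgrad hJ
  obtain ⟨hmsd, her⟩ := Diffusion.Model.isMSD_isER hD (hcost.minimizer k) μ k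
  obtain ⟨hmsd', her'⟩ := Diffusion.Model.isMSD_isER hD' (hcost.minimizer k) μ k
  refine ⟨_, _, _, _, hmsd, hmsd', her, her', ?_⟩
  obtain ⟨_, hD₀⟩ := hD.exists
  simp only [Diffusion.Model.noiseVariance_fullGradient, Diffusion.Model.noiseVariance_eq D,
    Diffusion.Model.meanStep_fullGradient]
  set G := Diffusion.lossGradCov law Q D.wo with hG
  have hlam : ∀ j, lam j ≠ 0 := fun j => (hcost.ν_pos.trans_le (hJ.le_lam j)).ne'
  have hT₁ := Diffusion.sum_div_bounds hcost.ν_pos hJ.le_lam hJ.lam_le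
    fun j => hD₀.quadForm_nonneg k (e j)
  have hT₂ := Diffusion.sum_div_bounds hcost.ν_pos hJ.le_lam hJ.lam_le
    fun j => hD₀.diagForm_nonneg k (e j)
  have ht : 0 ≤ G.trace := by
    rw [← Diffusion.sum_quadForm e G]
    exact Finset.sum_nonneg fun j _ => hD₀.quadForm_nonneg k (e j)
  rw [Diffusion.sum_quadForm] at hT₁
  rw [Diffusion.sum_diagForm] at hT₂
  have hm₁ : D.meanStep ≠ 0 := hnetwork.meanStep_pos.ne'
  have hm₀ : ∑ l, D.relWeight l ≠ 0 := by
    rw [← Diffusion.Model.meanStep_fullGradient]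
    exact hnetwork.fullGradient.meanStep_pos.ne'
  have hα := D.alpha_eq hμ
  have hθ := D.theta_eq hμ
  have hαθ := hnetwork.alpha_le_theta hμ
  have hzero := hnetwork.theta_eq_zero hμ
  generalize D.alpha μ = α at *
  generalize D.theta μ = θ at *
  generalize ∑ l, D.relWeight l ^ 2 * (1 - D.r l) ^ 2 = S₁ at *
  generalize ∑ l, D.relWeight l ^ 2 * (1 - D.r l) = S₂ at *
  generalize ∑ l, D.relWeight l ^ 2 = S₀ at *
  generalize ∑ l, D.relWeight l = m₀ at *
  generalize D.meanStep = m₁ at *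
  -- the factors `lam j` cancel in the excess-risk, which leaves the trace of `G`
  have her_eq : μ * (1 / 2 * ∑ j, lam j * ((S₁ * Diffusion.quadForm G (e j) +
      (S₂ - S₁) * Diffusion.diagForm G (e j)) / (2 * (m₁ * lam j)))) -
      μ * (1 / 2 * ∑ j, lam j * (S₀ * Diffusion.quadForm G (e j) / (2 * (m₀ * lam j)))) =
      θ / 4 * G.trace := by
    have h1 : ∑ j, lam j * ((S₁ * Diffusion.quadForm G (e j) +
        (S₂ - S₁) * Diffusion.diagForm G (e j)) / (2 * (m₁ * lam j))) =
        S₂ / (2 * m₁) * G.trace := by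
      have h2 : S₂ / (2 * m₁) * G.trace = S₁ / (2 * m₁) * ∑ j, Diffusion.quadForm G (e j) +
          (S₂ - S₁) / (2 * m₁) * ∑ j, Diffusion.diagForm G (e j) := by
        rw [Diffusion.sum_quadForm, Diffusion.sum_diagForm]
        ring
      rw [h2, Finset.mul_sum, Finset.mul_sum, ← Finset.sum_add_distrib]
      refine Finset.sum_congr rfl fun j _ => ?_
      have := hlam j
      field_simp
    have h3 : ∑ j, lam j * (S₀ * Diffusion.quadForm G (e j) / (2 * (m₀ * lam j))) =
        S₀ / (2 * m₀) * G.trace := by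
      rw [← Diffusion.sum_quadForm e G, Finset.mul_sum]
      refine Finset.sum_congr rfl fun j _ => ?_
      have := hlam j
      field_simp
    rw [h1, h3, hθ]
    field_simp
    ring
  obtain ⟨ha, hb, hc⟩ := Diffusion.comparison_bounds hcost.ν_pos hcost.ν_le_δ ht hαθ hT₁ hT₂
    (d := μ * ∑ j, (S₁ * Diffusion.quadForm G (e j) +
      (S₂ - S₁) * Diffusion.diagForm G (e j)) / (2 * (m₁ * lam j)) -
      μ * ∑ j, S₀ * Diffusion.quadForm G (e j) / (2 * (m₀ * lam j))) (by
        simp only [hα, hθ, Finset.mul_sum]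
        rw [← Finset.sum_sub_distrib, ← Finset.sum_add_distrib, Finset.mul_sum]
        refine Finset.sum_congr rfl fun j _ => ?_
        have := hlam j
        field_simp
        ring)
  refine ⟨ha, hb, hc, her_eq, fun h => ?_⟩
  rw [hzero h, zero_div, zero_mul] at her_eq
  exact sub_eq_zero.1 her_eq
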